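/- Let $Q$ be a smooth (Hausdorff, second countable) manifold of dimension $D$ and let $L : TQ \to \mathbb R$ be a smooth autonomous Lagrangian. Let $\mathcal L : TQ \to T^*Q$, $(q,v)\mapsto (q,\partial L/\partial v)$, be its fibre derivative, $\omega = dq^a\wedge dp_a$ the canonical two-form of $T^*Q$, and $\Omega_L = -d\theta_L$, $\theta_L = (\partial L/\partial v^a)\,dq^a$, the Lagrange two-form on $TQ$. Assume that $L$ is almost regular: $C := \mathcal L(TQ)$ is an embedded submanifold of $T^*Q$, $\mathcal L$ is a submersion of $TQ$ onto $C$, and its fibres are connected. Let $N_0 = \dim\ker M(u)$, where $M = \partial^2L/\partial v\,\partial v$ is the fibre Hessian, and assume that $\Omega_L$ has constant rank with $\dim\ker\Omega_L(u) = 2N_0$ for all $u\in TQ$ (equivalently, every $\mathfrak z\in\ker M(u)$ is the horizontal part of a vector of $\ker\Omega_L(u)$). Let $\mathcal G$ be the space of vertical vectors in $\ker\Omega_L$. For an open $U\subseteq T^*Q$, let $\overline{\ker\Omega_L}$ over $U$ be the set of smooth vector fields $P$ on $\mathcal L^{-1}(U)$ with $i_P\Omega_L=0$ and with $[G,P]$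 vertical for every local vector field $G$ in $\mathcal G$, and let $\mathrm{Prim}^\flat$ over $U$ be the set of one-forms $\pi$ along $C\cap U$ of the form $\pi = i_{\mathcal L_*P}\,\omega$ with $P\in\overline{\ker\Omega_L}$, i.e. $\pi(\mathcal L(u)) = i_{T\mathcal L(P(u))}\,\omega$ for all $u\in\mathcal L^{-1}(U)$. A form is called smooth along $C\cap U$ if it is smooth on an open neighbourhood of $C\cap U$ in $T^*Q$; forms are compared at the points of $C\cap U$. Then: 1. Every point of $C$ has an open neighbourhood $U$ over which $\mathrm{Prim}^\flat$ has a smooth basis $\pi_{(1)},\dots,\pi_{(N_0)}$ (one-forms in $\mathrm{Prim}^\flat$, smooth along $C\cap U$, that are linearly independent at each point of $C\cap U$ and span there the values of $\mathrm{Prim}^\flat$). For every open $U$ and every such basis over $U$, with Pfaff system $\{\pi_{(n)}=0\}$: 2. The algebraic ideal generated by the Pfaff system equals the kernel of $\mathcal L^*$ on forms: for each degree, a form $\sigma$ smooth along $C\cap U$ satisfies $\mathcal L^*\sigma = 0$ on $\mathcal L^{-1}(U)$ if and only if $\sigma = \sum_{n=1}^{N_0}\xi^{n}\wedge\pi_{(n)}$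 on $C\cap U$ for some forms $\xi^n$ smooth along $C\cap U$ (in degree $0$: if and only if $\sigma=0$ on $C\cap U$). 3. The Pfaff system is closed: for every $\pi\in\mathrm{Prim}^\flat$ over $U$ that is smooth along $C\cap U$, $d\pi$ lies in this ideal, and $d\pi\wedge\pi_{(1)}\wedge\dots\wedge\pi_{(N_0)}=0$ on $C\cap U$. 4. The Pfaff system is completely integrable, with $N_0$ first integrals, the primary Hamiltonian constraints $\gamma^{[0]}_n$: every point of $C\cap U$ has an open neighbourhood $V\subseteq U$ with smooth functions $\gamma^{[0]}_1,\dots,\gamma^{[0]}_{N_0}$ on $V$ such that the $d\gamma^{[0]}_n$ are linearly independent on $V$; there is a smooth invertible matrix function $A$ on $V$ with $\pi_{(n)}=\sum_m A_{nm}\,d\gamma^{[0]}_m$ on $C\cap V$ (so $\{\pi_{(n)}=0\}\sim\{d\gamma^{[0]}_n=0\}$); for all nowhere vanishing smooth $f_n$ on $V$, the forms $f_n\,d\gamma^{[0]}_n$ are again a basis of $\mathrm{Prim}^\flat$ over $V$; and $C\cap V=\{s\in V : \gamma^{[0]}_n(s)=0,\ n=1,\dots,N_0\}$. -/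

import Mathlib

open scoped Manifold ContDiff Topology

noncomputable section

/-! ### Differential forms on a manifold -/

namespace ManifoldForm

section General

variable {F : Type*} [NormedAddCommGroup F] [NormedSpace ℝ F] {H : Type*} [TopologicalSpace H]
  (I : ModelWithCorners ℝ F H) (M : Type*) [TopologicalSpace M] [ChartedSpace H M]

/-- A (not necessarily smooth) differential `k`-form on `M`. -/
abbrev Form (k : ℕ) : Type _ := ∀ x : M, TangentSpace I x [⋀^Fin k]→L[ℝ] ℝ

variable {M} {k : ℕ}

/-- The coordinate expression of `σ` in the chart at `x₀`: the pullback of `σ` by the inverse of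
that chart, a form on the model vector space. -/
def chartRep (σ : Form I M k) (x₀ : M) : F → F [⋀^Fin k]→L[ℝ] ℝ := fun y =>
  (σ ((extChartAt I x₀).symm y)).compContinuousLinearMap
    ((mfderivWithin 𝓘(ℝ, F) I (extChartAt I x₀).symm (Set.range I) y).comp
      (NormedSpace.fromTangentSpace (𝕜 := ℝ) y).symm.toContinuousLinearMap)

/-- `σ` is smooth on (the open set) `U`: its coordinate expressions are smooth. -/
def SmoothOn (σ : Form I M k) (U : Set M) : Prop :=
  ∀ x ∈ U, ContDiffWithinAt ℝ ∞ (chartRep I σ x) (Set.range I) (extChartAt I x x)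

/-- `σ` restricts to a smooth form along the subset `A`, i.e. `σ` is smooth on some open
neighbourhood of `A`. -/
def SmoothAlong (A : Set M) (σ : Form I M k) : Prop :=
  ∃ W : Set M, IsOpen W ∧ A ⊆ W ∧ SmoothOn I σ W

/-- The exterior derivative, computed at `x` in the chart at `x`. -/
def extD (σ : Form I M k) : Form I M (k + 1) := fun x =>
  (extDerivWithin (chartRep I σ x) (Set.range I) (extChartAt I x x)).compContinuousLinearMap
    ((NormedSpace.fromTangentSpace (𝕜 := ℝ) (extChartAt I x x)).toContinuousLinearMap.comp
      (mfderiv I 𝓘(ℝ, F) (extChartAt I x) x))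

/-- A field of covectors, seen as a `1`-form. -/
def ofCovector (α : ∀ x : M, TangentSpace I x →L[ℝ] ℝ) : Form I M 1 := fun x =>
  ContinuousAlternatingMap.ofSubsingleton ℝ (TangentSpace I x) ℝ (0 : Fin 1) (α x)

/-- The differential of a function, as a `1`-form. -/
def dFun (f : M → ℝ) : Form I M 1 :=
  ofCovector I fun x =>
    (NormedSpace.fromTangentSpace (𝕜 := ℝ) (f x)).toContinuousLinearMap.comp
      (mfderiv I 𝓘(ℝ, ℝ) f x)

/-- The pullback `f^*σ` of a form by a map. -/
def pullback {F' : Type*} [NormedAddCommGroup F'] [NormedSpace ℝ F'] {H' : Type*}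
    [TopologicalSpace H'] (I' : ModelWithCorners ℝ F' H') {M' : Type*} [TopologicalSpace M']
    [ChartedSpace H' M'] (f : M → M') (σ : Form I' M' k) : Form I M k := fun x =>
  (σ (f x)).compContinuousLinearMap (mfderiv I I' f x)

end General

section Wedge

variable {V : Type*} [AddCommGroup V] [Module ℝ V] [TopologicalSpace V] {k : ℕ}

/-- The wedge product `ξ ∧ α` of a `k`-form with a `1`-form at a point:
`(ξ ∧ α)(v₀, …, v_k) = ∑ i, (-1)^(k - i) α(v_i) ξ(v₀, …, v_{i-1}, v_{i+1}, …, v_k)`. -/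
def wedge (ξ : V [⋀^Fin k]→L[ℝ] ℝ) (α : V [⋀^Fin 1]→L[ℝ] ℝ) : V [⋀^Fin (k + 1)]→L[ℝ] ℝ :=
  let a : V →ₗ[ℝ] ℝ := (AlternatingMap.ofSubsingleton ℝ V ℝ (0 : Fin 1)).symm α.toAlternatingMap
  let w : V [⋀^Fin (k + 1)]→ₗ[ℝ] ℝ :=
    (-1 : ℝ) ^ k • AlternatingMap.alternatizeUncurryFin (a.smulRight ξ.toAlternatingMap)
  { w with
    cont := by
      have h : (fun v : Fin (k + 1) → V => w v) = fun v =>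
          (-1 : ℝ) ^ k * ∑ i : Fin (k + 1),
            ((-1 : ℤ) ^ (i : ℕ)) • (α (fun _ => v i) * ξ (fun j => v (i.succAbove j))) := by
        funext v
        simp only [w, AlternatingMap.smul_apply, AlternatingMap.alternatizeUncurryFin_apply,
          smul_eq_mul]
        rfl
      change Continuous (fun v : Fin (k + 1) → V => w v)
      rw [h]
      refine continuous_const.mul (continuous_finsetSum _ fun i _ => Continuous.zsmul ?_ _)
      exact (α.cont.comp (by fun_prop)).mul (ξ.cont.comp (by fun_prop)) }

/-- The iterated wedge product `ξ ∧ α₀ ∧ ⋯ ∧ α_{n-1}`. -/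
def wedgeAll (ξ : V [⋀^Fin k]→L[ℝ] ℝ) :
    (n : ℕ) → (Fin n → V [⋀^Fin 1]→L[ℝ] ℝ) → V [⋀^Fin (k + n)]→L[ℝ] ℝ
  | 0, _ => ξ
  | n + 1, α => wedge (wedgeAll ξ n fun i => α i.castSucc) (α (Fin.last n))

end Wedge

end ManifoldForm

/-! ### Lagrangian mechanics on a configuration manifold -/

namespace SingularLagrangian

open ManifoldForm

variable {D : ℕ} {Q : Type*} [TopologicalSpace Q] [ChartedSpace (EuclideanSpace ℝ (Fin D)) Q]
  [IsManifold (𝓡 D) ∞ Q]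

/-- The Lagrangian (velocity) phase space `TQ`. -/
abbrev PL (D : ℕ) (Q : Type*) [TopologicalSpace Q] [ChartedSpace (EuclideanSpace ℝ (Fin D)) Q] :
    Type _ :=
  TangentBundle (𝓡 D) Q

/-- The canonical phase space `T^*Q`. -/
abbrev PC (D : ℕ) (Q : Type*) [TopologicalSpace Q] [ChartedSpace (EuclideanSpace ℝ (Fin D)) Q] :
    Type _ :=
  Bundle.TotalSpace (EuclideanSpace ℝ (Fin D) →L[ℝ] ℝ)
    (fun q : Q => TangentSpace (𝓡 D) q →L[ℝ] ℝ)

/-- The model with corners of `TQ`. -/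
abbrev IL (D : ℕ) : ModelWithCorners ℝ (EuclideanSpace ℝ (Fin D) × EuclideanSpace ℝ (Fin D))
    (ModelProd (EuclideanSpace ℝ (Fin D)) (EuclideanSpace ℝ (Fin D))) :=
  (𝓡 D).tangent

/-- The model with corners of `T^*Q`. -/
abbrev IC (D : ℕ) :
    ModelWithCorners ℝ (EuclideanSpace ℝ (Fin D) × (EuclideanSpace ℝ (Fin D) →L[ℝ] ℝ))
      (ModelProd (EuclideanSpace ℝ (Fin D)) (EuclideanSpace ℝ (Fin D) →L[ℝ] ℝ)) :=
  (𝓡 D).prod 𝓘(ℝ, EuclideanSpace ℝ (Fin D) →L[ℝ] ℝ)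

/-- The derivative `p = ∂L/∂v` of `L` along the fibre of `TQ`. -/
def momentum (L : PL D Q → ℝ) (u : PL D Q) : TangentSpace (𝓡 D) u.1 →L[ℝ] ℝ :=
  fderiv ℝ (fun w : TangentSpace (𝓡 D) u.1 => L ⟨u.1, w⟩) u.2

/-- The fibre derivative (Legendre map) `(q, v) ↦ (q, ∂L/∂v)`. -/
def fibreDeriv (L : PL D Q → ℝ) (u : PL D Q) : PC D Q := ⟨u.1, momentum L u⟩

/-- The Hessian `M = ∂²L/∂v∂v` of `L` along the fibre of `TQ`. -/
def hessian (L : PL D Q → ℝ) (u : PL D Q) :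
    TangentSpace (𝓡 D) u.1 →L[ℝ] TangentSpace (𝓡 D) u.1 →L[ℝ] ℝ :=
  fderiv ℝ (fun w : TangentSpace (𝓡 D) u.1 => momentum L ⟨u.1, w⟩) u.2

/-- The canonical (Liouville) one-form `p_a dq^a` on `T^*Q`. -/
def liouvilleForm : Form (IC D) (PC D Q) 1 :=
  ofCovector (IC D) fun s => s.2.comp (mfderiv (IC D) (𝓡 D) Bundle.TotalSpace.proj s)

/-- The canonical two-form `ω = -d(p_a dq^a) = dq^a ∧ dp_a` on `T^*Q`. -/
def canonicalForm : Form (IC D) (PC D Q) 2 := -extD (IC D) liouvilleForm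

/-- The one-form `θ_L = (∂L/∂v^a) dq^a` on `TQ`. -/
def thetaL (L : PL D Q → ℝ) : Form (IL D) (PL D Q) 1 :=
  ofCovector (IL D) fun u => (momentum L u).comp (mfderiv (IL D) (𝓡 D) Bundle.TotalSpace.proj u)

/-- The Lagrange two-form `Ω_L = -dθ_L` on `TQ`. -/
def lagrangeForm (L : PL D Q → ℝ) : Form (IL D) (PL D Q) 2 := -extD (IL D) (thetaL L)

/-- `ker Ω_L(u) = {K | i_K Ω_L = 0}`. -/
def kerOmega (L : PL D Q → ℝ) (u : PL D Q) : Submodule ℝ (TangentSpace (IL D) u) :=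
  LinearMap.ker (lagrangeForm L u).toAlternatingMap.curryLeft

/-- The vertical tangent vectors of `TQ → Q` at `u`. -/
def vertical (u : PL D Q) : Submodule ℝ (TangentSpace (IL D) u) :=
  LinearMap.ker (mfderiv (IL D) (𝓡 D) (Bundle.TotalSpace.proj : PL D Q → Q) u).toLinearMap

/-- The space `𝒢` at `u`: the vertical vectors in the kernel of `Ω_L`, that is, the vectors
`z · ∂/∂v` with `z` in the kernel of the Hessian at `u`. -/
def spaceG (L : PL D Q → ℝ) (u : PL D Q) : Submodule ℝ (TangentSpace (IL D) u) :=
  vertical u ⊓ kerOmega L u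

/-- Smooth vector fields on the open subset `W` of `TQ`. -/
def SmoothField (X : ∀ u : PL D Q, TangentSpace (IL D) u) (W : Set (PL D Q)) : Prop :=
  ContMDiffOn (IL D) (IL D).tangent ∞
    (fun u => (⟨u, X u⟩ : TangentBundle (IL D) (PL D Q))) W

/-- The Lagrangian `L` is almost regular: the image of the fibre derivative `𝓛` is an embedded
submanifold of `T^*Q`, `𝓛` is a submersion onto its image, and its fibres are connected. -/
structure IsAlmostRegular (L : PL D Q → ℝ) : Prop where
  submersion_onto_image : ∃ (m : ℕ)
    (_ : ChartedSpace (EuclideanSpace ℝ (Fin m)) (Set.range (fibreDeriv L))),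
    IsManifold (𝓡 m) ∞ (Set.range (fibreDeriv L)) ∧
    Manifold.IsImmersion (𝓡 m) (IC D) ∞ (Subtype.val : Set.range (fibreDeriv L) → PC D Q) ∧
    Manifold.IsSubmersion (IL D) (𝓡 m) ∞ (Set.rangeFactorization (fibreDeriv L))
  connected_fibres : ∀ s ∈ Set.range (fibreDeriv L), IsConnected (fibreDeriv L ⁻¹' {s})

/-- The vector fields `P` over the open set `W` that belong to the reduced kernel of `Ω_L`:
`P` takes values in `ker Ω_L`, and `[G, P]` is vertical for every vector field `G` in `𝒢`. -/
structure IsReducedKernelField (L : PL D Q → ℝ) (W : Set (PL D Q))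
    (P : ∀ u : PL D Q, TangentSpace (IL D) u) : Prop where
  smooth : SmoothField P W
  mem_ker : ∀ u ∈ W, P u ∈ kerOmega L u
  bracket_vertical : ∀ V : Set (PL D Q), IsOpen V → V ⊆ W →
    ∀ G : (∀ u : PL D Q, TangentSpace (IL D) u), SmoothField G V → (∀ u ∈ V, G u ∈ spaceG L u) →
      ∀ u ∈ V, VectorField.mlieBracket (IL D) G P u ∈ vertical u

/-- `π` belongs to `Prim^♭` over the open subset `U` of `T^*Q`: along the image of `𝓛` it is
`i_𝔓 ω` for the push-forward `𝔓 = 𝓛_* P` of a field `P` in the reduced kernel of `Ω_L`. -/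
def IsPrimFlat (L : PL D Q → ℝ) (U : Set (PC D Q)) (π : Form (IC D) (PC D Q) 1) : Prop :=
  ∃ P : (∀ u : PL D Q, TangentSpace (IL D) u),
    IsReducedKernelField L (fibreDeriv L ⁻¹' U) P ∧
    ∀ u, fibreDeriv L u ∈ U → ∀ Y : TangentSpace (IC D) (fibreDeriv L u),
      π (fibreDeriv L u) ![Y] =
        canonicalForm (fibreDeriv L u) ![mfderiv (IL D) (IC D) (fibreDeriv L) u (P u), Y]

/-- The part of the image of the fibre derivative that lies in `U`. -/
def imageIn (L : PL D Q → ℝ) (U : Set (PC D Q)) : Set (PC D Q) := Set.range (fibreDeriv L) ∩ U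

/-- `π₁, …, π_N` is a (local) basis of `Prim^♭` over the open set `U`; the equations `π_n = 0`
are then the Pfaff system of `Prim^♭` over `U`. -/
structure IsPrimFlatBasis (L : PL D Q → ℝ) (U : Set (PC D Q)) {N : ℕ}
    (π : Fin N → Form (IC D) (PC D Q) 1) : Prop where
  smooth : ∀ n, SmoothAlong (IC D) (imageIn L U) (π n)
  mem : ∀ n, IsPrimFlat L U (π n)
  independent : ∀ s ∈ imageIn L U, LinearIndependent ℝ fun n => π n s
  spanning : ∀ V : Set (PC D Q), IsOpen V → V ⊆ U → ∀ η : Form (IC D) (PC D Q) 1,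
    IsPrimFlat L V η → ∀ s ∈ imageIn L V, η s ∈ Submodule.span ℝ (Set.range fun n => π n s)

/-- The `k`-forms in the algebraic ideal generated by `π₁, …, π_N` in the exterior algebra of
smooth forms along the image of `𝓛` in `U`: the sums `∑ n, ξ^n ∧ π_n` (only `0` in degree `0`). -/
def pfaffIdeal (L : PL D Q → ℝ) (U : Set (PC D Q)) {N : ℕ}
    (π : Fin N → Form (IC D) (PC D Q) 1) : (k : ℕ) → Set (Form (IC D) (PC D Q) k)
  | 0 => {σ | SmoothAlong (IC D) (imageIn L U) σ ∧ ∀ s ∈ imageIn L U, σ s = 0}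
  | k + 1 => {σ | SmoothAlong (IC D) (imageIn L U) σ ∧
      ∃ ξ : Fin N → Form (IC D) (PC D Q) k, (∀ n, SmoothAlong (IC D) (imageIn L U) (ξ n)) ∧
        ∀ s ∈ imageIn L U, σ s = ∑ n, wedge (ξ n s) (π n s)}

/-- The smooth `k`-forms along the image of `𝓛` in `U` that lie in the kernel of `𝓛^*`. -/
def kerPullback (L : PL D Q → ℝ) (U : Set (PC D Q)) (k : ℕ) : Set (Form (IC D) (PC D Q) k) :=
  {σ | SmoothAlong (IC D) (imageIn L U) σ ∧
    ∀ u, fibreDeriv L u ∈ U → pullback (IL D) (IC D) (fibreDeriv L) σ u = 0}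

/-- `γ₁, …, γ_N` are primary Hamiltonian constraints on the open set `V` for the Pfaff system
`π_n = 0`: independent first integrals of the system on `V`, which cut out the image of `𝓛`. -/
structure IsPrimaryConstraints (L : PL D Q → ℝ) (V : Set (PC D Q)) {N : ℕ}
    (π : Fin N → Form (IC D) (PC D Q) 1) (γ : Fin N → PC D Q → ℝ) : Prop where
  smooth : ∀ n, ContMDiffOn (IC D) 𝓘(ℝ, ℝ) ∞ (γ n) V
  independent : ∀ s ∈ V, LinearIndependent ℝ fun n => dFun (IC D) (γ n) s
  /-- `{π_n = 0} ∼ {dγ_n = 0}` -/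
  equivalent : ∃ A : PC D Q → Matrix (Fin N) (Fin N) ℝ,
    (∀ n m, ContMDiffOn (IC D) 𝓘(ℝ, ℝ) ∞ (fun s => A s n m) V) ∧
    (∀ s ∈ V, (A s).det ≠ 0) ∧
    ∀ s ∈ imageIn L V, ∀ n, π n s = ∑ m, A s n m • dFun (IC D) (γ m) s
  /-- the basis of `Prim^♭` may be chosen of the form `f_n dγ_n` -/
  basis : ∀ f : Fin N → PC D Q → ℝ, (∀ n, ContMDiffOn (IC D) 𝓘(ℝ, ℝ) ∞ (f n) V) →
    (∀ n, ∀ s ∈ V, f n s ≠ 0) →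
      IsPrimFlatBasis L V fun n s => f n s • dFun (IC D) (γ n) s
  image_eq : imageIn L V = {s | s ∈ V ∧ ∀ n, γ n s = 0}

end SingularLagrangian

end

open SingularLagrangian ManifoldForm

noncomputable section

set_option linter.unusedSectionVars false

/-! ### Linear algebra -/

namespace LinearMap

variable {E : Type*} [AddCommGroup E] [Module ℝ E] {N : ℕ}

/-! Everything rests on one identification: at a point `𝓛(u)` of the image `C`, the smooth forms of
`Prim^♭` are exactly the smooth one-forms that annihilate the range of `T_u𝓛`, which is the tangent
space of `C`. Thus `Prim^♭` is the conormal bundle of `C`, and the four claims become standard facts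
about a submanifold and its conormal bundle.

The identification is a dimension count. Write `T = T_u𝓛`. Since `θ_L` is the pullback of the
Liouville form, `Ω_L = 𝓛^*ω`, so `v` lies in `ker Ω_L(u)` if and only if `ω(Tv, ·)` annihilates the
range of `T`. As `𝓛` covers the identity of `Q` and its fibre derivative is the Hessian, `ker T` is
a vertical copy of `ker M(u)`, of dimension `N₀`; hence the annihilator of the range also has
dimension `N₀`. The map `v ↦ ω(Tv, ·)` from `ker Ω_L(u)` to this annihilator has kernel `ker T`, and
`2N₀ - N₀ = N₀`, so it is onto (`exists_of_annihilates_range`).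

Given a smooth conormal form `β`, its `ω`-dual field is therefore tangent to `C`. Because `T𝓛` has
constant rank, local smooth lifts exist and are glued by a partition of unity to a field `P` with
`T𝓛(P) = β^♯ ∘ 𝓛` (`exists_related_field`). A field `G` in `𝒢` is `𝓛`-related to `0` and `P` to
`β^♯`, so `[G, P]` is killed by `T𝓛` and is vertical: `β` lies in `Prim^♭`
(`isPrimFlat_of_annihilates`).

The normal forms of immersions and submersions show that `C` is locally the zero set of `N₀`
independent functions (`IsAlmostRegular.exists_constraints`); their differentials are conormal and
form a basis. A form in the kernel of `𝓛^*` vanishes on vectors tangent to `C`, and linear algebra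
with a smooth dual frame, followed by a partition of unity, writes it as `∑ ξ^n ∧ π_n`. Closure of
the system follows from `𝓛^*dπ = d𝓛^*π = 0`. Complete integrability compares a given basis with the
basis of differentials through a smooth transition matrix. -/

theorem pi_surjective_of_linearIndependent {α : Fin N → E →ₗ[ℝ] ℝ} (h : LinearIndependent ℝ α) :
    Function.Surjective (LinearMap.pi α) := by
  rw [← LinearMap.range_eq_top]
  by_contra hne
  -- A functional vanishing on the range is a linear relation among the `α n`, with its values on
  -- the standard basis as coefficients.
  obtain ⟨f, hf0, hf⟩ := Submodule.exists_le_ker_of_lt_top _ (lt_top_iff_ne_top.2 hne)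
  apply hf0
  have key : ∑ n, f (Pi.single n 1) • α n = 0 := by
    ext v
    have h1 : f (LinearMap.pi α v) = 0 := hf ⟨v, rfl⟩
    rw [LinearMap.pi_apply_eq_sum_univ f] at h1
    have h2 : ∀ n : Fin N, (fun j => if n = j then (1 : ℝ) else 0) = Pi.single n 1 := by
      intro n; ext j; simp [Pi.single_apply, eq_comm]
    simp only [h2] at h1
    simpa [LinearMap.sum_apply, mul_comm] using h1
  have := Fintype.linearIndependent_iff.1 h _ key
  refine LinearMap.pi_ext' fun n => LinearMap.ext_ring ?_
  simpa using this n

theorem exists_dual_vectors {α : Fin N → E →ₗ[ℝ] ℝ} (h : LinearIndependent ℝ α) :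
    ∃ y : Fin N → E, ∀ n m, α n (y m) = if n = m then 1 else 0 := by
  choose y hy using fun m : Fin N =>
    pi_surjective_of_linearIndependent h (fun n => if n = m then 1 else 0)
  exact ⟨y, fun n m => congrFun (hy m) n⟩

theorem finrank_iInf_ker_add [FiniteDimensional ℝ E] {α : Fin N → E →ₗ[ℝ] ℝ}
    (h : LinearIndependent ℝ α) :
    Module.finrank ℝ (⨅ n, LinearMap.ker (α n) : Submodule ℝ E) + N = Module.finrank ℝ E := by
  rw [← LinearMap.ker_pi, ← LinearMap.finrank_range_add_finrank_ker (LinearMap.pi α),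
    LinearMap.range_eq_top.2 (pi_surjective_of_linearIndependent h)]
  simp [add_comm]

/-- If the radical of `w` pulled back by `T` has twice the dimension of the kernel of `T`, then the
range of `T` is coisotropic. -/
theorem exists_of_annihilates_range {V W : Type*} [AddCommGroup V] [Module ℝ V]
    [FiniteDimensional ℝ V] [AddCommGroup W] [Module ℝ W] [FiniteDimensional ℝ W]
    (T : V →ₗ[ℝ] W) (w : W →ₗ[ℝ] W →ₗ[ℝ] ℝ) (hw : Function.Injective w)
    (hdim : Module.finrank ℝ V = Module.finrank ℝ W)
    (hT : Module.finrank ℝ (LinearMap.ker T) = N) (K : Submodule ℝ V)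
    (hKmem : ∀ v, v ∈ K ↔ ∀ v', w (T v) (T v') = 0)
    (hK : Module.finrank ℝ K = 2 * N) (β : W →ₗ[ℝ] ℝ) (hβ : ∀ v, β (T v) = 0) :
    ∃ v ∈ K, w (T v) = β := by
  let A : Submodule ℝ (Module.Dual ℝ W) := (LinearMap.range T).dualAnnihilator
  have hA : Module.finrank ℝ A = N := by
    have h1 := Subspace.finrank_add_finrank_dualAnnihilator_eq (LinearMap.range T)
    have h2 := LinearMap.finrank_range_add_finrank_ker T
    change _ + Module.finrank ℝ A = _ at h1
    omega
  -- `Φ` maps `K` into the annihilator `A` with kernel `ker T`, so its range has dimension `2N - N =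
  -- N = dim A` and fills `A`.
  let Φ : K →ₗ[ℝ] Module.Dual ℝ W := (w ∘ₗ T) ∘ₗ K.subtype
  have hker : Module.finrank ℝ (LinearMap.ker Φ) = N := by
    rw [← hT]
    have hle : LinearMap.ker T ≤ K := by
      intro v hv
      rw [hKmem]
      intro v'
      rw [LinearMap.mem_ker.1 hv]
      simp
    have : LinearMap.ker Φ = Submodule.comap K.subtype (LinearMap.ker T) := by
      ext v
      simp only [Φ, LinearMap.mem_ker, LinearMap.comp_apply, Submodule.mem_comap]
      exact map_eq_zero_iff w hw
    rw [this]
    exact (Submodule.comapSubtypeEquivOfLe hle).finrank_eq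
  have hrange : LinearMap.range Φ ≤ A := by
    rintro _ ⟨v, rfl⟩
    rw [Submodule.mem_dualAnnihilator]
    rintro _ ⟨v', rfl⟩
    exact (hKmem v).1 v.2 v'
  have hr : Module.finrank ℝ (LinearMap.range Φ) = N := by
    have := LinearMap.finrank_range_add_finrank_ker Φ
    omega
  have heq := Submodule.eq_of_le_of_finrank_eq hrange (by rw [hr, hA])
  have hmem : β ∈ A := by
    rw [Submodule.mem_dualAnnihilator]
    rintro _ ⟨v, rfl⟩
    exact hβ v
  rw [← heq] at hmem
  obtain ⟨v, hv⟩ := hmem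
  exact ⟨v, v.2, hv⟩

end LinearMap

theorem ContDiffAt.clm_inverse {X E F : Type*} [NormedAddCommGroup X] [NormedSpace ℝ X]
    [NormedAddCommGroup E] [NormedSpace ℝ E] [CompleteSpace E] [NormedAddCommGroup F]
    [NormedSpace ℝ F] {T : X → E →L[ℝ] F} {x : X} (hT : ContDiffAt ℝ ∞ T x)
    (hx : (T x).IsInvertible) : ContDiffAt ℝ ∞ (fun x => (T x).inverse) x := by
  obtain ⟨e, he⟩ := hx
  have h1 := contDiffAt_map_inverse (𝕜 := ℝ) (n := ∞) e
  rw [he] at h1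
  exact h1.comp x hT

/-- A linear system of constant rank whose right-hand side is in the range can be solved
smoothly. -/
theorem exists_contDiffAt_solution {X E F : Type*} [NormedAddCommGroup X] [NormedSpace ℝ X]
    [NormedAddCommGroup E] [NormedSpace ℝ E] [FiniteDimensional ℝ E]
    [NormedAddCommGroup F] [NormedSpace ℝ F] [FiniteDimensional ℝ F] {N : ℕ}
    {A : X → E →L[ℝ] F} {c : X → F} {x₀ : X} (hA : ∀ᶠ x in 𝓝 x₀, ContDiffAt ℝ ∞ A x)
    (hc : ∀ᶠ x in 𝓝 x₀, ContDiffAt ℝ ∞ c x)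
    (hker : ∀ᶠ x in 𝓝 x₀, Module.finrank ℝ (LinearMap.ker (A x).toLinearMap) = N)
    (hmem : ∀ᶠ x in 𝓝 x₀, ∃ e, A x e = c x) :
    ∃ b : X → E, (∀ᶠ x in 𝓝 x₀, ContDiffAt ℝ ∞ b x) ∧ ∀ᶠ x in 𝓝 x₀, A x (b x) = c x := by
  -- Solutions are sought in a fixed complement `R` of the kernel at `x₀`. With `q` a left inverse
  -- of `A x₀` on `R`, the endomorphism `T x = q ∘ A x ∘ ι` of `R` is the identity at `x₀`, hence
  -- invertible nearby.
  obtain ⟨R, hR⟩ := Submodule.exists_isCompl (LinearMap.ker (A x₀).toLinearMap)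
  have hinj : Function.Injective ((A x₀).toLinearMap ∘ₗ R.subtype) := by
    rw [← LinearMap.ker_eq_bot, LinearMap.ker_comp, Submodule.eq_bot_iff]
    intro v hv
    have := (Submodule.disjoint_def.1 hR.disjoint) v hv v.2
    exact Subtype.ext this
  obtain ⟨q, hq⟩ := LinearMap.exists_leftInverse_of_injective _ (LinearMap.ker_eq_bot.2 hinj)
  have : CompleteSpace R := FiniteDimensional.complete ℝ R
  let q' : F →L[ℝ] R := LinearMap.toContinuousLinearMap q
  let ι : R →L[ℝ] E := R.subtypeL
  let T : X → R →L[ℝ] R := fun x => q'.comp ((A x).comp ι)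
  have hT : ∀ x, ContDiffAt ℝ ∞ A x → ContDiffAt ℝ ∞ T x := fun x hx =>
    contDiffAt_const.clm_comp (hx.clm_comp contDiffAt_const)
  have hT0 : T x₀ = ContinuousLinearMap.id ℝ R := by
    ext v
    have := LinearMap.congr_fun hq v
    exact congrArg Subtype.val this
  have hT1 : T x₀ = (ContinuousLinearEquiv.refl ℝ R : R →L[ℝ] R) := hT0
  have hTinv : ∀ᶠ x in 𝓝 x₀, (T x).IsInvertible := by
    have hU := ContinuousLinearEquiv.nhds (ContinuousLinearEquiv.refl ℝ R)
    rw [← hT1] at hU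
    exact (hT x₀ hA.self_of_nhds).continuousAt.eventually hU
  refine ⟨fun x => ι ((T x).inverse (q' (c x))), ?_, ?_⟩
  · filter_upwards [hA, hc, hTinv] with x hAx hcx hx
    exact contDiffAt_const.clm_apply
      (((hT x hAx).clm_inverse hx).clm_apply (contDiffAt_const.clm_apply hcx))
  · filter_upwards [hker, hmem, hTinv] with x hx ⟨e, he⟩ hu
    let B : R →ₗ[ℝ] F := (A x).toLinearMap ∘ₗ R.subtype
    have hBinj : Function.Injective B := by
      intro v w hvw
      have h1 : T x v = T x w := congrArg q' hvw
      exact hu.injective h1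
    have hdR : Module.finrank ℝ R + N = Module.finrank ℝ E := by
      rw [← hker.self_of_nhds, add_comm]
      exact Submodule.finrank_add_eq_of_isCompl hR
    -- Constant rank enters here: `A x` is injective on `R` and `dim R` is the rank of `A x`, so `R`
    -- already reaches the whole range, and the solution in `R` is the one given by the inverse of
    -- `T x`.
    have hrange : LinearMap.range B = LinearMap.range (A x).toLinearMap := by
      refine Submodule.eq_of_le_of_finrank_eq (LinearMap.range_comp_le_range _ _) ?_
      rw [LinearMap.finrank_range_of_inj hBinj]
      have := LinearMap.finrank_range_add_finrank_ker (A x).toLinearMap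
      omega
    have : c x ∈ LinearMap.range B := hrange ▸ ⟨e, he⟩
    obtain ⟨r, hr⟩ := this
    have h4 : (T x).inverse (q' (c x)) = r := by
      rw [← hr]
      exact hu.inverse_apply_self r
    change A x (ι ((T x).inverse (q' (c x)))) = c x
    rw [h4, ← hr]
    rfl

/-! ### Algebra of the wedge product -/

namespace ManifoldForm

section

variable {V : Type*} [AddCommGroup V] [Module ℝ V] [TopologicalSpace V] {k : ℕ}

theorem wedge_apply (ξ : V [⋀^Fin k]→L[ℝ] ℝ) (α : V [⋀^Fin 1]→L[ℝ] ℝ) (v : Fin (k + 1) → V) :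
    wedge ξ α v = (-1 : ℝ) ^ k * ∑ i : Fin (k + 1),
      (-1 : ℝ) ^ (i : ℕ) * (α (fun _ => v i) * ξ (fun j => v (i.succAbove j))) := by
  change ((-1 : ℝ) ^ k • AlternatingMap.alternatizeUncurryFin
    (((AlternatingMap.ofSubsingleton ℝ V ℝ (0 : Fin 1)).symm α.toAlternatingMap).smulRight
      ξ.toAlternatingMap)) v = _
  simp only [AlternatingMap.smul_apply, AlternatingMap.alternatizeUncurryFin_apply, smul_eq_mul,
    zsmul_eq_mul]
  congr 1
  refine Finset.sum_congr rfl fun i _ => ?_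
  push_cast
  rfl

theorem wedge_add_left (ξ η : V [⋀^Fin k]→L[ℝ] ℝ) (α : V [⋀^Fin 1]→L[ℝ] ℝ) :
    wedge (ξ + η) α = wedge ξ α + wedge η α := by
  ext v
  simp only [wedge_apply, ContinuousAlternatingMap.add_apply, mul_add, Finset.sum_add_distrib]

theorem wedge_smul_left (c : ℝ) (ξ : V [⋀^Fin k]→L[ℝ] ℝ) (α : V [⋀^Fin 1]→L[ℝ] ℝ) :
    wedge (c • ξ) α = c • wedge ξ α := by
  ext v
  simp only [wedge_apply, ContinuousAlternatingMap.smul_apply, smul_eq_mul, Finset.mul_sum]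
  exact Finset.sum_congr rfl fun i _ => by ring

theorem wedge_zero_left (α : V [⋀^Fin 1]→L[ℝ] ℝ) :
    wedge (0 : V [⋀^Fin k]→L[ℝ] ℝ) α = 0 := by
  simpa using wedge_smul_left 0 (0 : V [⋀^Fin k]→L[ℝ] ℝ) α

theorem wedge_add_right (ξ : V [⋀^Fin k]→L[ℝ] ℝ) (α β : V [⋀^Fin 1]→L[ℝ] ℝ) :
    wedge ξ (α + β) = wedge ξ α + wedge ξ β := by
  ext v
  simp only [wedge_apply, ContinuousAlternatingMap.add_apply, add_mul, mul_add,
    Finset.sum_add_distrib]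

theorem wedge_sum_left {ι : Type*} (s : Finset ι) (ξ : ι → V [⋀^Fin k]→L[ℝ] ℝ)
    (α : V [⋀^Fin 1]→L[ℝ] ℝ) : wedge (∑ i ∈ s, ξ i) α = ∑ i ∈ s, wedge (ξ i) α := by
  classical
  induction s using Finset.induction_on with
  | empty => simpa using wedge_zero_left α
  | insert a s ha ih => rw [Finset.sum_insert ha, Finset.sum_insert ha, wedge_add_left, ih]

theorem wedge_compContinuousLinearMap {W : Type*} [AddCommGroup W] [Module ℝ W]
    [TopologicalSpace W] (ξ : V [⋀^Fin k]→L[ℝ] ℝ) (α : V [⋀^Fin 1]→L[ℝ] ℝ) (f : W →L[ℝ] V) :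
    (wedge ξ α).compContinuousLinearMap f =
      wedge (ξ.compContinuousLinearMap f) (α.compContinuousLinearMap f) := by
  ext v
  simp only [wedge_apply, ContinuousAlternatingMap.compContinuousLinearMap_apply]
  rfl

/-- Up to sign this is the double alternatization of `(x, y) ↦ α(x) α(y) ξ`, which is symmetric in
`x` and `y`. -/
theorem wedge_wedge_self (ξ : V [⋀^Fin k]→L[ℝ] ℝ) (α : V [⋀^Fin 1]→L[ℝ] ℝ) :
    wedge (wedge ξ α) α = 0 := by
  let a : V →ₗ[ℝ] ℝ := (AlternatingMap.ofSubsingleton ℝ V ℝ (0 : Fin 1)).symm α.toAlternatingMap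
  let f : V →ₗ[ℝ] V →ₗ[ℝ] V [⋀^Fin k]→ₗ[ℝ] ℝ := a.smulRight (a.smulRight ξ.toAlternatingMap)
  have hf := AlternatingMap.alternatizeUncurryFin_alternatizeUncurryFinLM_comp_of_symmetric
    (f := f) (fun x y => by simp [f, smul_smul, mul_comm])
  ext v
  have hv := DFunLike.congr_fun hf v
  simp only [AlternatingMap.alternatizeUncurryFin_apply] at hv
  rw [wedge_apply]
  change _ = (0 : ℝ)
  simp only [wedge_apply]
  have : ∀ i : Fin (k + 2), ((AlternatingMap.alternatizeUncurryFinLM ∘ₗ f) (v i)) (i.removeNth v)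
      = α (fun _ => v i) * ∑ j : Fin (k + 1), (-1 : ℝ) ^ (j : ℕ) *
        (α (fun _ => v (i.succAbove j)) * ξ (fun l => v (i.succAbove (j.succAbove l)))) := by
    intro i
    change (AlternatingMap.alternatizeUncurryFin (f (v i))) (i.removeNth v) = _
    simp only [AlternatingMap.alternatizeUncurryFin_apply, Finset.mul_sum]
    refine Finset.sum_congr rfl fun j _ => ?_
    simp only [f, LinearMap.smulRight_apply, LinearMap.smul_apply, AlternatingMap.smul_apply,
      smul_eq_mul, zsmul_eq_mul]
    push_cast
    change (-1 : ℝ) ^ (j : ℕ) * (α (fun _ => v i) * (α (fun _ => v (i.succAbove j)) *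
      ξ (fun l => v (i.succAbove (j.succAbove l))))) = _
    ring
  simp only [this, zsmul_eq_mul] at hv
  push_cast at hv
  simp only [AlternatingMap.zero_apply] at hv
  have hk : ∀ i : Fin (k + 2), (-1 : ℝ) ^ (i : ℕ) * (α (fun _ => v i) * ((-1 : ℝ) ^ k *
      ∑ j : Fin (k + 1), (-1 : ℝ) ^ (j : ℕ) * (α (fun _ => v (i.succAbove j)) *
        ξ (fun l => v (i.succAbove (j.succAbove l))))))
      = (-1 : ℝ) ^ k * ((-1 : ℝ) ^ (i : ℕ) * (α (fun _ => v i) *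
      ∑ j : Fin (k + 1), (-1 : ℝ) ^ (j : ℕ) * (α (fun _ => v (i.succAbove j)) *
        ξ (fun l => v (i.succAbove (j.succAbove l)))))) := fun i => by ring
  simp only [hk, ← Finset.mul_sum, hv, mul_zero]

/-- Polarization of `wedge_wedge_self` at `α + β`. -/
theorem wedge_wedge_swap (ξ : V [⋀^Fin k]→L[ℝ] ℝ) (α β : V [⋀^Fin 1]→L[ℝ] ℝ) :
    wedge (wedge ξ α) β = -wedge (wedge ξ β) α := by
  have h := wedge_wedge_self ξ (α + β)
  simp only [wedge_add_right, wedge_add_left, wedge_wedge_self, zero_add, add_zero] at h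
  exact eq_neg_of_add_eq_zero_right h

theorem wedgeAll_add (ξ η : V [⋀^Fin k]→L[ℝ] ℝ) (n : ℕ) (α : Fin n → V [⋀^Fin 1]→L[ℝ] ℝ) :
    wedgeAll (ξ + η) n α = wedgeAll ξ n α + wedgeAll η n α := by
  induction n with
  | zero => rfl
  | succ n ih => simp only [wedgeAll, ih, wedge_add_left]

theorem wedgeAll_zero (n : ℕ) (α : Fin n → V [⋀^Fin 1]→L[ℝ] ℝ) :
    wedgeAll (0 : V [⋀^Fin k]→L[ℝ] ℝ) n α = 0 := by
  have := wedgeAll_add (0 : V [⋀^Fin k]→L[ℝ] ℝ) 0 n α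
  rw [add_zero] at this
  simpa using this

theorem wedgeAll_sum {ι : Type*} (s : Finset ι) (ξ : ι → V [⋀^Fin k]→L[ℝ] ℝ) (n : ℕ)
    (α : Fin n → V [⋀^Fin 1]→L[ℝ] ℝ) :
    wedgeAll (∑ i ∈ s, ξ i) n α = ∑ i ∈ s, wedgeAll (ξ i) n α := by
  classical
  induction s using Finset.induction_on with
  | empty => simpa using wedgeAll_zero n α
  | insert a s ha ih => rw [Finset.sum_insert ha, Finset.sum_insert ha, wedgeAll_add, ih]

theorem wedge_wedgeAll_wedge_self (ξ : V [⋀^Fin k]→L[ℝ] ℝ) (β : V [⋀^Fin 1]→L[ℝ] ℝ) (n : ℕ)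
    (α : Fin n → V [⋀^Fin 1]→L[ℝ] ℝ) : wedge (wedgeAll (wedge ξ β) n α) β = 0 := by
  induction n with
  | zero => exact wedge_wedge_self ξ β
  | succ n ih => rw [wedgeAll, wedge_wedge_swap, ih, wedge_zero_left, neg_zero]

/-- A repeated factor kills the product. This turns membership of `dπ` in the ideal into the
Frobenius condition `dπ ∧ π₁ ∧ ⋯ ∧ π_N = 0`. -/
theorem wedgeAll_wedge_of_mem (ξ : V [⋀^Fin k]→L[ℝ] ℝ) (n : ℕ)
    (α : Fin n → V [⋀^Fin 1]→L[ℝ] ℝ) (i : Fin n) : wedgeAll (wedge ξ (α i)) n α = 0 := by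
  induction n with
  | zero => exact i.elim0
  | succ n ih =>
    rw [wedgeAll]
    induction i using Fin.lastCases with
    | last => exact wedge_wedgeAll_wedge_self ξ _ n _
    | cast i => rw [ih (fun i => α i.castSucc) i, wedge_zero_left]

end

/-! ### Smooth families of alternating forms on a vector space -/

section Smooth

variable {X F : Type*} [NormedAddCommGroup X] [NormedSpace ℝ X] [NormedAddCommGroup F]
  [NormedSpace ℝ F] {k N : ℕ}

theorem contDiffAt_alternating_apply {σ : X → F [⋀^Fin k]→L[ℝ] ℝ} {w : Fin k → X → F} {x₀ : X}
    (hσ : ContDiffAt ℝ ∞ σ x₀) (hw : ∀ i, ContDiffAt ℝ ∞ (w i) x₀) :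
    ContDiffAt ℝ ∞ (fun x => σ x fun i => w i x) x₀ := by
  let B : (F [⋀^Fin k]→L[ℝ] ℝ) →L[ℝ] ContinuousMultilinearMap ℝ (fun _ : Fin k => F) ℝ :=
    ContinuousAlternatingMap.toContinuousMultilinearMapCLM ℝ
  have hB : ContDiff ℝ ∞ (fun p : (F [⋀^Fin k]→L[ℝ] ℝ) × (Fin k → F) => B p.1 p.2) :=
    contDiff_iff_contDiffAt.2 fun p => B.analyticAt_uncurry_of_multilinear.contDiffAt
  exact hB.contDiffAt.comp x₀ (hσ.prodMk (contDiffAt_pi.2 hw))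

/-- In finite dimension a form depends linearly on its values on tuples of basis vectors, through a
left inverse of the evaluation map. -/
theorem contDiffAt_alternating_iff [FiniteDimensional ℝ F] {σ : X → F [⋀^Fin k]→L[ℝ] ℝ}
    {x₀ : X} : ContDiffAt ℝ ∞ σ x₀ ↔ ∀ v : Fin k → F, ContDiffAt ℝ ∞ (fun x => σ x v) x₀ := by
  refine ⟨fun h v => contDiffAt_alternating_apply h fun i => contDiffAt_const, fun h => ?_⟩
  let b := Module.finBasis ℝ F
  let ev : (F [⋀^Fin k]→L[ℝ] ℝ) →ₗ[ℝ] ((Fin k → Fin (Module.finrank ℝ F)) → ℝ) :=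
    { toFun := fun τ I => τ fun i => b (I i)
      map_add' := fun _ _ => rfl
      map_smul' := fun _ _ => rfl }
  have hinj : Function.Injective ev := by
    intro τ τ' h
    apply ContinuousAlternatingMap.toAlternatingMap_injective
    exact b.ext_alternating fun I _ => congrFun h I
  obtain ⟨G, hG⟩ := LinearMap.exists_leftInverse_of_injective ev (LinearMap.ker_eq_bot.2 hinj)
  have : σ = fun x => LinearMap.toContinuousLinearMap G (ev (σ x)) := by
    funext x
    exact (LinearMap.congr_fun hG (σ x)).symm
  rw [this]
  exact (ContinuousLinearMap.contDiff _).contDiffAt.comp x₀ (contDiffAt_pi.2 fun I => h _)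

theorem contDiffAt_compContinuousLinearMap {F' : Type*} [NormedAddCommGroup F'] [NormedSpace ℝ F']
    [FiniteDimensional ℝ F'] {σ : X → F [⋀^Fin k]→L[ℝ] ℝ} {g : X → F' →L[ℝ] F} {x₀ : X}
    (hσ : ContDiffAt ℝ ∞ σ x₀) (hg : ContDiffAt ℝ ∞ g x₀) :
    ContDiffAt ℝ ∞ (fun x => (σ x).compContinuousLinearMap (g x)) x₀ :=
  contDiffAt_alternating_iff.2 fun v =>
    contDiffAt_alternating_apply (w := fun i x => g x (v i)) hσ fun _ =>
      hg.clm_apply contDiffAt_const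

/-- Expand `σ(v₀ - α(v₀) y, …, v_k - α(v_k) y)` by multilinearity. Terms containing `y` twice
vanish, and the terms linear in `y` assemble to a wedge product with `α`; the factor `(-1)^k`
cancels the one in the convention for `wedge`. -/
theorem sub_compContinuousLinearMap_eq_wedge (σ : F [⋀^Fin (k + 1)]→L[ℝ] ℝ)
    (α : F [⋀^Fin 1]→L[ℝ] ℝ) (y : F) (p : F →L[ℝ] F) (hp : ∀ v, p v = v - α (fun _ => v) • y) :
    σ = wedge ((-1 : ℝ) ^ k • σ.curryLeft y) α + σ.compContinuousLinearMap p := by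
  ext v
  let h : Fin (k + 1) → F := fun i => -α (fun _ => v i) • y
  have h1 := σ.toMultilinearMap.map_add_eq_map_add_linearDeriv_add v h
  have h2 : ∑ s : Finset (Fin (k + 1)) with 2 ≤ s.card, σ.toMultilinearMap (s.piecewise h v)
      = 0 := by
    refine Finset.sum_eq_zero fun s hs => ?_
    obtain ⟨i, hi, j, hj, hij⟩ := Finset.one_lt_card.1 (Finset.mem_filter.1 hs).2
    have hpw : s.piecewise h v = fun l => (if l ∈ s then -α (fun _ => v l) else 1) •
        (if l ∈ s then y else v l) := by
      funext l
      by_cases hl : l ∈ s <;> simp [hl, h]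
    rw [hpw, MultilinearMap.map_smul_univ]
    have : σ.toMultilinearMap (fun l => if l ∈ s then y else v l) = 0 :=
      σ.map_eq_zero_of_eq _ (by simp [hi, hj]) hij
    rw [this, smul_zero]
  rw [h2, add_zero, MultilinearMap.linearDeriv_apply] at h1
  have h3 : ∀ i, σ.toMultilinearMap (Function.update v i (h i)) =
      -((-1 : ℝ) ^ (i : ℕ) * (α (fun _ => v i) * σ.curryLeft y (fun j => v (i.succAbove j)))) := by
    intro i
    have h4 : Function.update v i y = i.insertNth y (i.removeNth v) := by
      rw [Fin.insertNth_removeNth]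
    have h5 := AlternatingMap.map_insertNth σ.toAlternatingMap i y (i.removeNth v)
    change σ.toMultilinearMap (Function.update v i (-α (fun _ => v i) • y)) = _
    rw [MultilinearMap.map_update_smul, h4]
    change -α (fun _ => v i) • σ.toAlternatingMap (i.insertNth y (i.removeNth v)) = _
    rw [h5]
    simp only [smul_eq_mul, zsmul_eq_mul]
    push_cast
    change -α (fun _ => v i) * ((-1 : ℝ) ^ (i : ℕ) * σ.curryLeft y (fun j => v (i.succAbove j))) = _
    ring
  have h6 : (σ.compContinuousLinearMap p) v = σ.toMultilinearMap (v + h) := by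
    change σ (fun i => p (v i)) = σ (v + h)
    congr 1
    funext i
    simp [hp, h, sub_eq_add_neg]
  rw [ContinuousAlternatingMap.add_apply, h6, h1, wedge_smul_left]
  simp only [h3, Finset.sum_neg_distrib, ContinuousAlternatingMap.smul_apply, wedge_apply,
    smul_eq_mul]
  rw [← mul_assoc, ← mul_pow]
  simp only [mul_neg, mul_one, neg_neg, one_pow, one_mul]
  change σ v = _ + (σ v + - _)
  ring

/-- Constant vectors dual to the `α n x₀` have a pairing matrix `T x` with the `α n x` that is the
identity at `x₀`; correcting them by the inverse of `T x` makes them dual at all nearby points. -/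
theorem exists_contDiffAt_dual_vectors {α : Fin N → X → F [⋀^Fin 1]→L[ℝ] ℝ} {x₀ : X}
    (hα : ∀ n, ∀ᶠ x in 𝓝 x₀, ContDiffAt ℝ ∞ (α n) x)
    (h : LinearIndependent ℝ fun n => α n x₀) :
    ∃ Y : Fin N → X → F, (∀ n, ∀ᶠ x in 𝓝 x₀, ContDiffAt ℝ ∞ (Y n) x) ∧
      ∀ᶠ x in 𝓝 x₀, ∀ n m, α n x (fun _ => Y m x) = if n = m then 1 else 0 := by
  let e : (F →L[ℝ] ℝ) ≃ₗᵢ[ℝ] (F [⋀^Fin 1]→L[ℝ] ℝ) :=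
    ContinuousAlternatingMap.ofSubsingletonLIE (0 : Fin 1)
  let a : Fin N → X → F →L[ℝ] ℝ := fun n x => e.symm (α n x)
  have ha : ∀ n x, ContDiffAt ℝ ∞ (α n) x → ContDiffAt ℝ ∞ (a n) x := fun n x hx =>
    e.symm.toContinuousLinearEquiv.contDiff.contDiffAt.comp x hx
  have hind : LinearIndependent ℝ fun n => (a n x₀ : F →ₗ[ℝ] ℝ) := by
    have h1 := h.map' (e.symm.toLinearEquiv : _ →ₗ[ℝ] F →L[ℝ] ℝ)
      (LinearMap.ker_eq_bot.2 e.symm.injective)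
    exact h1.map' (ContinuousLinearMap.coeLM ℝ)
      (LinearMap.ker_eq_bot.2 ContinuousLinearMap.coe_injective)
  obtain ⟨y, hy⟩ := LinearMap.exists_dual_vectors hind
  let Yc : (Fin N → ℝ) →L[ℝ] F := ∑ m, (ContinuousLinearMap.proj m).smulRight (y m)
  let T : X → (Fin N → ℝ) →L[ℝ] (Fin N → ℝ) := fun x =>
    ∑ n, ((a n x).comp Yc).smulRight (Pi.single n (1 : ℝ))
  have hTv : ∀ x c n, T x c n = a n x (Yc c) := fun x c n => by
    simp [T, Finset.sum_apply, Pi.single_apply]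
  have hT : ∀ x, (∀ n, ContDiffAt ℝ ∞ (a n) x) → ContDiffAt ℝ ∞ T x := fun x hx =>
    ContDiffAt.sum fun n _ => ((hx n).clm_comp contDiffAt_const).smulRight contDiffAt_const
  have hT1 : T x₀ = (ContinuousLinearEquiv.refl ℝ (Fin N → ℝ) : (Fin N → ℝ) →L[ℝ] _) := by
    ext c n
    have : ∀ m, a n x₀ (y m) = if n = m then 1 else 0 := fun m => hy n m
    change T x₀ _ n = _
    rw [hTv]
    simp [Yc, this]
  have hα' := Filter.eventually_all.2 hα
  have hTinv : ∀ᶠ x in 𝓝 x₀, (T x).IsInvertible := by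
    have hU := ContinuousLinearEquiv.nhds (ContinuousLinearEquiv.refl ℝ (Fin N → ℝ))
    rw [← hT1] at hU
    exact (hT x₀ fun n => ha n x₀ (hα'.self_of_nhds n)).continuousAt.eventually hU
  refine ⟨fun m x => Yc ((T x).inverse (Pi.single m 1)), fun m => ?_, ?_⟩
  · filter_upwards [hα', hTinv] with x hx hTx
    exact contDiffAt_const.clm_apply
      (((hT x fun n => ha n x (hx n)).clm_inverse hTx).clm_apply contDiffAt_const)
  · filter_upwards [hTinv] with x hTx n m
    change a n x (Yc ((T x).inverse (Pi.single m 1))) = _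
    rw [← hTv, hTx.self_apply_inverse, Pi.single_apply]

/-- Each induction step splits off the last covector by the projection along its dual vector. What
remains at the end is `σ` composed with a map `q` into the common kernel of the `α n`, the part that
vanishes when `σ` is zero on that kernel. Smoothness and the identity are stated separately, each at
the points where its own assumptions hold. -/
theorem exists_wedge_decomposition [FiniteDimensional ℝ F]
    (α : Fin N → X → F [⋀^Fin 1]→L[ℝ] ℝ) (Y : Fin N → X → F)
    (σ : X → F [⋀^Fin (k + 1)]→L[ℝ] ℝ) :
    ∃ (ξ : Fin N → X → F [⋀^Fin k]→L[ℝ] ℝ) (q : X → F →L[ℝ] F),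
      (∀ x, (∀ n, ContDiffAt ℝ ∞ (α n) x) → (∀ n, ContDiffAt ℝ ∞ (Y n) x) →
        ContDiffAt ℝ ∞ σ x → ∀ n, ContDiffAt ℝ ∞ (ξ n) x) ∧
      ∀ x, (∀ n m, α n x (fun _ => Y m x) = if n = m then 1 else 0) →
        (∀ n v, α n x (fun _ => q x v) = 0) ∧
        σ x = ∑ n, wedge (ξ n x) (α n x) + (σ x).compContinuousLinearMap (q x) := by
  induction N generalizing σ with
  | zero =>
    exact ⟨fun n => n.elim0, fun _ => ContinuousLinearMap.id ℝ F, fun _ _ _ _ n => n.elim0,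
      fun x _ => ⟨fun n => n.elim0, by simp; rfl⟩⟩
  | succ N ih =>
    let e : (F →L[ℝ] ℝ) ≃ₗᵢ[ℝ] (F [⋀^Fin 1]→L[ℝ] ℝ) :=
      ContinuousAlternatingMap.ofSubsingletonLIE (0 : Fin 1)
    let a : X → F →L[ℝ] ℝ := fun x => e.symm (α (Fin.last N) x)
    let p : X → F →L[ℝ] F := fun x =>
      ContinuousLinearMap.id ℝ F - (a x).smulRight (Y (Fin.last N) x)
    have hpv : ∀ x v, p x v = v - α (Fin.last N) x (fun _ => v) • Y (Fin.last N) x :=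
      fun x v => rfl
    obtain ⟨ξ, q, hξ, H⟩ := ih (fun n => α n.castSucc) (fun n => Y n.castSucc)
      (fun x => (σ x).compContinuousLinearMap (p x))
    refine ⟨Fin.snoc ξ fun x => (-1 : ℝ) ^ k • (σ x).curryLeft (Y (Fin.last N) x),
      fun x => (p x).comp (q x), fun x₀ hα hY hσ n => ?_, fun x hx => ?_⟩
    · have ha : ContDiffAt ℝ ∞ a x₀ :=
        e.symm.toContinuousLinearEquiv.contDiff.contDiffAt.comp x₀ (hα _)
      have hp : ContDiffAt ℝ ∞ p x₀ := contDiffAt_const.sub (ha.smulRight (hY _))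
      induction n using Fin.lastCases with
      | last =>
        simp only [Fin.snoc_last]
        refine contDiffAt_alternating_iff.2 fun v => ?_
        refine contDiffAt_const.mul ?_
        refine contDiffAt_alternating_apply (w := Fin.cons (Y (Fin.last N)) fun i _ => v i)
          hσ (fun i => ?_) |>.congr_of_eventuallyEq (.of_forall fun x => ?_)
        · refine Fin.cases ?_ (fun i => ?_) i
          · exact hY _
          · exact contDiffAt_const
        · change σ x (Fin.cons (Y (Fin.last N) x) v) = _
          congr 1
          funext i
          refine Fin.cases ?_ (fun i => ?_) i <;> rfl
      | cast n => 
        simpa only [Fin.snoc_castSucc] using hξ x₀ (fun n => hα _) (fun n => hY _)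
          (contDiffAt_compContinuousLinearMap hσ hp) n
    · obtain ⟨h1, h2⟩ := H x fun n m => by
        simpa only [Fin.castSucc_inj] using hx n.castSucc m.castSucc
      have hαp : ∀ n w, α n x (fun _ => p x w) =
          α n x (fun _ => w) - α (Fin.last N) x (fun _ => w) * α n x (fun _ => Y (Fin.last N) x) :=
        fun n w => by
        have : ∀ z, α n x (fun _ => z) = e.symm (α n x) z := fun z => rfl
        rw [this, this, this (Y (Fin.last N) x), hpv, map_sub, map_smul, smul_eq_mul]
      refine ⟨fun n v => ?_, ?_⟩
      · rw [ContinuousLinearMap.comp_apply, hαp, hx]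
        induction n using Fin.lastCases with
        | last => simp
        | cast n => simp [(Fin.castSucc_lt_last n).ne, h1 n v]
      · rw [Fin.sum_univ_castSucc]
        simp only [Fin.snoc_castSucc, Fin.snoc_last]
        have h3 := sub_compContinuousLinearMap_eq_wedge (σ x) (α (Fin.last N) x)
          (Y (Fin.last N) x) (p x) (hpv x)
        conv_lhs => rw [h3, h2]
        exact (by intro a b c; abel :
          ∀ a b c : F [⋀^Fin (k + 1)]→L[ℝ] ℝ, a + (b + c) = b + a + c) _ _ _

end Smooth

end ManifoldForm

/-! ### Calculus of differential forms on manifolds without boundary -/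

namespace ManifoldForm

section General

variable {F : Type*} [NormedAddCommGroup F] [NormedSpace ℝ F] {H : Type*} [TopologicalSpace H]
  (I : ModelWithCorners ℝ F H) {M : Type*} [TopologicalSpace M] [ChartedSpace H M]
  {F' : Type*} [NormedAddCommGroup F'] [NormedSpace ℝ F'] {H' : Type*} [TopologicalSpace H']
  (I' : ModelWithCorners ℝ F' H') {M' : Type*} [TopologicalSpace M'] [ChartedSpace H' M']
  {k : ℕ}

/-- The values of a form, seen as forms on the model vector space. -/
def Form.raw {I : ModelWithCorners ℝ F H} (σ : Form I M k) : M → F [⋀^Fin k]→L[ℝ] ℝ := σ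

/-- The derivative of a map between manifolds, seen as a map between model vector spaces. -/
def rawDeriv (f : M → M') (x : M) : F →L[ℝ] F' := mfderiv I I' f x

/-- The derivative of the chart at `x₀`, as a map between model vector spaces. -/
def chartDeriv (x₀ x : M) : F →L[ℝ] F := mfderiv I 𝓘(ℝ, F) (extChartAt I x₀) x

/-- The derivative of the inverse of the chart at `x₀`, as a map between model vector spaces. -/
def symmDeriv (x₀ : M) (y : F) : F →L[ℝ] F :=
  mfderivWithin 𝓘(ℝ, F) I (extChartAt I x₀).symm (Set.range I) y

variable {I I'}

theorem chartRep_eq (σ : Form I M k) (x₀ : M) (y : F) :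
    chartRep I σ x₀ y =
      (σ.raw ((extChartAt I x₀).symm y)).compContinuousLinearMap (symmDeriv I x₀ y) := rfl

theorem raw_pullback (f : M → M') (σ : Form I' M' k) (x : M) :
    (pullback I I' f σ).raw x = (σ.raw (f x)).compContinuousLinearMap (rawDeriv I I' f x) := rfl

theorem raw_extD (σ : Form I M k) (x : M) :
    (extD I σ).raw x = (extDerivWithin (chartRep I σ x) (Set.range I)
      (extChartAt I x x)).compContinuousLinearMap (chartDeriv I x x) := rfl

theorem chartRep_chart (σ : Form I M k) {x₀ x : M} (hx : x ∈ (extChartAt I x₀).source) :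
    chartRep I σ x₀ (extChartAt I x₀ x) =
      (σ.raw x).compContinuousLinearMap (symmDeriv I x₀ (extChartAt I x₀ x)) := by
  rw [chartRep_eq, (extChartAt I x₀).left_inv hx]

variable [I.Boundaryless] [I'.Boundaryless] [IsManifold I ∞ M] [IsManifold I' ∞ M']

theorem isManifold_one (I : ModelWithCorners ℝ F H) (M : Type*) [TopologicalSpace M]
    [ChartedSpace H M] [IsManifold I ∞ M] : IsManifold I 1 M :=
  IsManifold.of_le (n := ∞) (by exact_mod_cast le_top)

theorem symmDeriv_chartDeriv {x₀ x : M} (hx : x ∈ (extChartAt I x₀).source) (v : F) :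
    symmDeriv I x₀ (extChartAt I x₀ x) (chartDeriv I x₀ x v) = v := by
  have := isManifold_one I M
  exact DFunLike.congr_fun (mfderivWithin_extChartAt_symm_comp_mfderiv_extChartAt' hx) v

theorem chartDeriv_symmDeriv {x₀ x : M} (hx : x ∈ (extChartAt I x₀).source) (v : F) :
    chartDeriv I x₀ x (symmDeriv I x₀ (extChartAt I x₀ x) v) = v := by
  have := isManifold_one I M
  exact DFunLike.congr_fun (mfderiv_extChartAt_comp_mfderivWithin_extChartAt_symm' hx) v

theorem raw_eq_chartRep (σ : Form I M k) {x₀ x : M} (hx : x ∈ (extChartAt I x₀).source) :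
    σ.raw x = (chartRep I σ x₀ (extChartAt I x₀ x)).compContinuousLinearMap
      (chartDeriv I x₀ x) := by
  rw [chartRep_chart σ hx]
  ext v
  simp only [ContinuousAlternatingMap.compContinuousLinearMap_apply]
  congr 1
  funext i
  exact (symmDeriv_chartDeriv hx (v i)).symm

theorem fderiv_writtenInChart {f : M → M'} {x₀ x : M} {s₀ : M'}
    (hx : x ∈ (extChartAt I x₀).source) (hs : f x ∈ (extChartAt I' s₀).source)
    (hf : MDifferentiableAt I I' f x) :
    fderiv ℝ (extChartAt I' s₀ ∘ f ∘ (extChartAt I x₀).symm) (extChartAt I x₀ x) =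
      (chartDeriv I' s₀ (f x)).comp ((rawDeriv I I' f x).comp
        (symmDeriv I x₀ (extChartAt I x₀ x))) := by
  have := isManifold_one I M
  have := isManifold_one I' M'
  have hr : Set.range I = Set.univ := I.range_eq_univ
  have h1 : HasMFDerivAt 𝓘(ℝ, F) I (extChartAt I x₀).symm (extChartAt I x₀ x)
      (mfderivWithin 𝓘(ℝ, F) I (extChartAt I x₀).symm (Set.range I) (extChartAt I x₀ x)) := by
    rw [← hasMFDerivWithinAt_univ, ← hr]
    exact (mdifferentiableWithinAt_extChartAt_symm
      ((extChartAt I x₀).map_source hx)).hasMFDerivWithinAt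
  have hx' := (extChartAt I x₀).left_inv hx
  have h2 : HasMFDerivAt I I' f ((extChartAt I x₀).symm (extChartAt I x₀ x))
      (mfderiv I I' f ((extChartAt I x₀).symm (extChartAt I x₀ x))) :=
    MDifferentiableAt.hasMFDerivAt (by rwa [hx'])
  have h3 := (mdifferentiableAt_extChartAt (I := I') (x := s₀)
    (y := f ((extChartAt I x₀).symm (extChartAt I x₀ x)))
    (by rw [hx']; simpa using hs)).hasMFDerivAt
  have h5 := HasMFDerivAt.comp _ h2 h1
  have h4 := HasMFDerivAt.comp (g := extChartAt I' s₀) (f := f ∘ (extChartAt I x₀).symm) _ h3 h5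
  have h6 : HasFDerivAt (extChartAt I' s₀ ∘ f ∘ (extChartAt I x₀).symm)
      ((chartDeriv I' s₀ (f ((extChartAt I x₀).symm (extChartAt I x₀ x)))).comp
        ((rawDeriv I I' f ((extChartAt I x₀).symm (extChartAt I x₀ x))).comp
          (symmDeriv I x₀ (extChartAt I x₀ x)))) (extChartAt I x₀ x) :=
    hasMFDerivAt_iff_hasFDerivAt.1 h4
  rw [h6.fderiv, hx']

theorem chartRep_pullback {f : M → M'} (σ : Form I' M' k) {x₀ x : M} {s₀ : M'}
    (hx : x ∈ (extChartAt I x₀).source) (hs : f x ∈ (extChartAt I' s₀).source)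
    (hf : MDifferentiableAt I I' f x) :
    chartRep I (pullback I I' f σ) x₀ (extChartAt I x₀ x) =
      (chartRep I' σ s₀ (extChartAt I' s₀ (f x))).compContinuousLinearMap
        (fderiv ℝ (extChartAt I' s₀ ∘ f ∘ (extChartAt I x₀).symm) (extChartAt I x₀ x)) := by
  rw [chartRep_chart _ hx, chartRep_chart _ hs, raw_pullback, fderiv_writtenInChart hx hs hf]
  ext v
  simp only [ContinuousAlternatingMap.compContinuousLinearMap_apply]
  congr 1
  funext i
  exact (symmDeriv_chartDeriv hs _).symm

theorem pullback_id (σ : Form I M k) : pullback I I (id : M → M) σ = σ := by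
  funext x
  change (σ x).compContinuousLinearMap (mfderiv I I id x) = σ x
  rw [mfderiv_id]
  rfl

/-- Allows identities between coordinate expressions to be checked at points of `M` instead of
points of the model space. -/
theorem eventually_nhds_chart {x₀ x : M} (hx : x ∈ (extChartAt I x₀).source) {p : F → Prop}
    (hp : ∀ᶠ x' in 𝓝 x, x' ∈ (extChartAt I x₀).source → p (extChartAt I x₀ x')) :
    ∀ᶠ y in 𝓝 (extChartAt I x₀ x), p y := by
  have h1 : ContinuousAt (extChartAt I x₀).symm (extChartAt I x₀ x) :=
    continuousAt_extChartAt_symm' hx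
  have h2 : ∀ᶠ x' in 𝓝 ((extChartAt I x₀).symm (extChartAt I x₀ x)),
      x' ∈ (extChartAt I x₀).source → p (extChartAt I x₀ x') := by
    rwa [(extChartAt I x₀).left_inv hx]
  filter_upwards [h1.eventually h2, extChartAt_target_mem_nhds' ((extChartAt I x₀).map_source hx)]
    with y hy hyt
  have := hy ((extChartAt I x₀).map_target hyt)
  rwa [(extChartAt I x₀).right_inv hyt] at this

theorem eventually_mem_source {x₀ x : M} (hx : x ∈ (extChartAt I x₀).source) :
    ∀ᶠ x' in 𝓝 x, x' ∈ (extChartAt I x₀).source :=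
  (isOpen_extChartAt_source x₀).mem_nhds hx

theorem contDiffAt_writtenInChart {f : M → M'} {x₀ x : M} {s₀ : M'}
    (hx : x ∈ (extChartAt I x₀).source) (hs : f x ∈ (extChartAt I' s₀).source)
    (hf : ContMDiffAt I I' ∞ f x) :
    ContDiffAt ℝ ∞ (extChartAt I' s₀ ∘ f ∘ (extChartAt I x₀).symm) (extChartAt I x₀ x) := by
  have := ((contMDiffAt_iff_of_mem_source (by simpa using hx) (by simpa using hs)).1 hf).2
  rwa [I.range_eq_univ, contDiffWithinAt_univ] at this

theorem contDiffAt_chartRep_pullback [FiniteDimensional ℝ F] {f : M → M'} {σ : Form I' M' k}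
    {x₀ x : M} {s₀ : M'} (hx : x ∈ (extChartAt I x₀).source)
    (hs : f x ∈ (extChartAt I' s₀).source) (hf : ∀ᶠ x' in 𝓝 x, ContMDiffAt I I' ∞ f x')
    (hσ : ContDiffAt ℝ ∞ (chartRep I' σ s₀) (extChartAt I' s₀ (f x))) :
    ContDiffAt ℝ ∞ (chartRep I (pullback I I' f σ) x₀) (extChartAt I x₀ x) := by
  set g := extChartAt I' s₀ ∘ f ∘ (extChartAt I x₀).symm with hg
  have hgs : ContDiffAt ℝ ∞ g (extChartAt I x₀ x) :=
    contDiffAt_writtenInChart hx hs hf.self_of_nhds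
  have hgx : ∀ x' ∈ (extChartAt I x₀).source, g (extChartAt I x₀ x') = extChartAt I' s₀ (f x') :=
    fun x' hx' => by simp only [hg, Function.comp_apply, (extChartAt I x₀).left_inv hx']
  have h1 : ContDiffAt ℝ ∞ (fun y => (chartRep I' σ s₀ (g y)).compContinuousLinearMap
      (fderiv ℝ g y)) (extChartAt I x₀ x) := by
    refine contDiffAt_compContinuousLinearMap ?_ (hgs.fderiv_right (by norm_num))
    exact ContDiffAt.comp _ (by rwa [hgx x hx]) hgs
  refine h1.congr_of_eventuallyEq (eventually_nhds_chart hx ?_)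
  have hfs : ∀ᶠ x' in 𝓝 x, f x' ∈ (extChartAt I' s₀).source :=
    hf.self_of_nhds.continuousAt.eventually (eventually_mem_source hs)
  filter_upwards [hf, hfs] with x' hfx' hsx' hx'
  rw [hgx x' hx']
  exact chartRep_pullback σ hx' hsx' (hfx'.mdifferentiableAt (by simp))

/-- Smoothness of a form at a point. -/
def SmoothAt (σ : Form I M k) (x : M) : Prop :=
  ContDiffAt ℝ ∞ (chartRep I σ x) (extChartAt I x x)

theorem smoothOn_iff {σ : Form I M k} {U : Set M} : SmoothOn I σ U ↔ ∀ x ∈ U, SmoothAt σ x := by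
  simp only [SmoothOn, SmoothAt, I.range_eq_univ, contDiffWithinAt_univ]

/-- A change of chart is a pullback by the identity map, so chart independence is a case of
`contDiffAt_chartRep_pullback`. -/
theorem smoothAt_iff [FiniteDimensional ℝ F] {σ : Form I M k} {x₀ x : M}
    (hx : x ∈ (extChartAt I x₀).source) :
    SmoothAt σ x ↔ ContDiffAt ℝ ∞ (chartRep I σ x₀) (extChartAt I x₀ x) := by
  have hid : ∀ᶠ x' in 𝓝 x, ContMDiffAt I I ∞ (id : M → M) x' :=
    .of_forall fun _ => contMDiffAt_id
  refine ⟨fun h => ?_, fun h => ?_⟩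
  · have := contDiffAt_chartRep_pullback (f := id) (s₀ := x) hx (mem_extChartAt_source x) hid h
    rwa [pullback_id] at this
  · have := contDiffAt_chartRep_pullback (f := id) (x₀ := x) (mem_extChartAt_source x) hx hid h
    rwa [pullback_id] at this

theorem SmoothAt.pullback [FiniteDimensional ℝ F] {f : M → M'} {σ : Form I' M' k} {x : M}
    (hσ : SmoothAt σ (f x)) (hf : ∀ᶠ x' in 𝓝 x, ContMDiffAt I I' ∞ f x') :
    SmoothAt (pullback I I' f σ) x :=
  contDiffAt_chartRep_pullback (mem_extChartAt_source x) (mem_extChartAt_source (f x)) hf hσ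

theorem extDeriv_chartRep_pullback [FiniteDimensional ℝ F] {f : M → M'} {σ : Form I' M' k}
    {x₀ x : M} {s₀ : M'} (hx : x ∈ (extChartAt I x₀).source)
    (hs : f x ∈ (extChartAt I' s₀).source) (hf : ∀ᶠ x' in 𝓝 x, ContMDiffAt I I' ∞ f x')
    (hσ : ContDiffAt ℝ ∞ (chartRep I' σ s₀) (extChartAt I' s₀ (f x))) :
    extDeriv (chartRep I (pullback I I' f σ) x₀) (extChartAt I x₀ x) =
      (extDeriv (chartRep I' σ s₀) (extChartAt I' s₀ (f x))).compContinuousLinearMap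
        (fderiv ℝ (extChartAt I' s₀ ∘ f ∘ (extChartAt I x₀).symm) (extChartAt I x₀ x)) := by
  set g := extChartAt I' s₀ ∘ f ∘ (extChartAt I x₀).symm with hg
  have hgs : ContDiffAt ℝ ∞ g (extChartAt I x₀ x) :=
    contDiffAt_writtenInChart hx hs hf.self_of_nhds
  have hgx : ∀ x' ∈ (extChartAt I x₀).source, g (extChartAt I x₀ x') = extChartAt I' s₀ (f x') :=
    fun x' hx' => by simp only [hg, Function.comp_apply, (extChartAt I x₀).left_inv hx']
  have hfs : ∀ᶠ x' in 𝓝 x, f x' ∈ (extChartAt I' s₀).source :=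
    hf.self_of_nhds.continuousAt.eventually (eventually_mem_source hs)
  have h2 : chartRep I (ManifoldForm.pullback I I' f σ) x₀ =ᶠ[𝓝 (extChartAt I x₀ x)] fun y =>
      (chartRep I' σ s₀ (g y)).compContinuousLinearMap (fderiv ℝ g y) := by
    refine eventually_nhds_chart hx ?_
    filter_upwards [hf, hfs] with x' hfx' hsx' hx'
    rw [hgx x' hx']
    exact chartRep_pullback σ hx' hsx' (hfx'.mdifferentiableAt (by simp))
  rw [h2.extDeriv_eq, ← hgx x hx]
  refine extDeriv_pullback (r := ∞) ?_ hgs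
    (minSmoothness_of_isRCLikeNormedField.le.trans
      (WithTop.coe_le_coe.2 (le_top : (2 : ℕ∞) ≤ ⊤)))
  rw [hgx x hx]
  exact hσ.differentiableAt (by simp)

/-- Since `extD` uses a different chart at every point, chart independence is needed before `dσ` has
a single coordinate expression on a neighbourhood. It is naturality of `extDeriv` under the identity
map read in two charts. -/
theorem chartRep_extD [FiniteDimensional ℝ F] {σ : Form I M k} {x₀ x : M}
    (hx : x ∈ (extChartAt I x₀).source) (hσ : SmoothAt σ x) :
    chartRep I (extD I σ) x₀ (extChartAt I x₀ x) =
      extDeriv (chartRep I σ x₀) (extChartAt I x₀ x) := by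
  have hid : ∀ᶠ x' in 𝓝 x, ContMDiffAt I I ∞ (id : M → M) x' :=
    .of_forall fun _ => contMDiffAt_id
  have h1 := extDeriv_chartRep_pullback (f := id) (s₀ := x) hx (mem_extChartAt_source x) hid hσ
  have h2 := fderiv_writtenInChart (f := id) (s₀ := x) hx (mem_extChartAt_source x)
    (mdifferentiableAt_id (I := I))
  rw [pullback_id] at h1
  rw [h1, chartRep_chart _ hx, raw_extD, I.range_eq_univ, extDerivWithin_univ, h2]
  have h3 : rawDeriv I I (id : M → M) x = ContinuousLinearMap.id ℝ F := mfderiv_id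
  rw [h3]
  rfl

theorem raw_extD_of_mem [FiniteDimensional ℝ F] {σ : Form I M k} {x₀ x : M}
    (hx : x ∈ (extChartAt I x₀).source) (hσ : SmoothAt σ x) :
    (extD I σ).raw x = (extDeriv (chartRep I σ x₀) (extChartAt I x₀ x)).compContinuousLinearMap
      (chartDeriv I x₀ x) := by
  rw [raw_eq_chartRep _ hx, chartRep_extD hx hσ]

theorem SmoothAt.extD [FiniteDimensional ℝ F] {σ : Form I M k} {x : M}
    (hσ : ∀ᶠ x' in 𝓝 x, SmoothAt σ x') : SmoothAt (extD I σ) x := by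
  have h0 : SmoothAt σ x := hσ.self_of_nhds
  have h1 : ContDiffAt ℝ ∞ (extDeriv (chartRep I σ x)) (extChartAt I x x) := by
    have h2 : ContDiffAt ℝ ∞ (fderiv ℝ (chartRep I σ x)) (extChartAt I x x) :=
      ContDiffAt.fderiv_right h0 (by norm_num)
    exact (ContinuousLinearMap.contDiff
      (ContinuousAlternatingMap.alternatizeUncurryFinCLM ℝ F ℝ)).contDiffAt.comp _ h2
  refine h1.congr_of_eventuallyEq (eventually_nhds_chart (mem_extChartAt_source x) ?_)
  filter_upwards [hσ] with x' hσ' hx'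
  exact chartRep_extD hx' hσ'

theorem extD_pullback [FiniteDimensional ℝ F] [FiniteDimensional ℝ F'] {f : M → M'}
    {σ : Form I' M' k} {x : M} (hσ : SmoothAt σ (f x))
    (hf : ∀ᶠ x' in 𝓝 x, ContMDiffAt I I' ∞ f x') :
    extD I (pullback I I' f σ) x = pullback I I' f (extD I' σ) x := by
  have hx := mem_extChartAt_source (I := I) x
  have hs := mem_extChartAt_source (I := I') (f x)
  change (extD I (pullback I I' f σ)).raw x = (pullback I I' f (extD I' σ)).raw x
  rw [raw_extD_of_mem hx (hσ.pullback hf), extDeriv_chartRep_pullback hx hs hf hσ, raw_pullback,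
    raw_extD_of_mem hs hσ, fderiv_writtenInChart hx hs (hf.self_of_nhds.mdifferentiableAt (by simp))]
  ext v
  simp only [ContinuousAlternatingMap.compContinuousLinearMap_apply]
  congr 1
  funext i
  change chartDeriv I' (f x) (f x) (rawDeriv I I' f x (symmDeriv I x (extChartAt I x x)
    (chartDeriv I x x (v i)))) = _
  rw [symmDeriv_chartDeriv hx]
  rfl

theorem SmoothAt.add {σ τ : Form I M k} {x : M} (hσ : SmoothAt σ x) (hτ : SmoothAt τ x) :
    SmoothAt (σ + τ) x :=
  ContDiffAt.add hσ hτ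

theorem smoothAt_zero {x : M} : SmoothAt (0 : Form I M k) x :=
  contDiffAt_const (c := (0 : F [⋀^Fin k]→L[ℝ] ℝ))

theorem SmoothAt.sum {ι : Type*} {s : Finset ι} {σ : ι → Form I M k} {x : M}
    (hσ : ∀ i ∈ s, SmoothAt (σ i) x) : SmoothAt (fun x' => ∑ i ∈ s, σ i x') x := by
  classical
  induction s using Finset.induction_on with
  | empty => exact smoothAt_zero
  | insert a s ha ih =>
    have h1 : (fun x' => ∑ i ∈ insert a s, σ i x') = σ a + fun x' => ∑ i ∈ s, σ i x' := by
      funext x'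
      exact Finset.sum_insert ha
    rw [h1]
    exact (hσ a (Finset.mem_insert_self a s)).add
      (ih fun i hi => hσ i (Finset.mem_insert_of_mem hi))

theorem contDiffAt_comp_chart_symm {V : Type*} [NormedAddCommGroup V] [NormedSpace ℝ V]
    {g : M → V} {x₀ x : M} (hx : x ∈ (extChartAt I x₀).source)
    (hg : ContMDiffAt I 𝓘(ℝ, V) ∞ g x) :
    ContDiffAt ℝ ∞ (g ∘ (extChartAt I x₀).symm) (extChartAt I x₀ x) :=
  contDiffAt_writtenInChart (s₀ := g x) hx (mem_extChartAt_source (I := 𝓘(ℝ, V)) (g x)) hg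

theorem contMDiffAt_comp_chart {V : Type*} [NormedAddCommGroup V] [NormedSpace ℝ V]
    {g : F → V} {x₀ x : M} (hx : x ∈ (extChartAt I x₀).source)
    (hg : ContDiffAt ℝ ∞ g (extChartAt I x₀ x)) :
    ContMDiffAt I 𝓘(ℝ, V) ∞ (fun x' => g (extChartAt I x₀ x')) x :=
  hg.contMDiffAt.comp x (contMDiffAt_extChartAt' (by simpa using hx))

theorem SmoothAt.smul {f : M → ℝ} {σ : Form I M k} {x : M} (hf : ContMDiffAt I 𝓘(ℝ, ℝ) ∞ f x)
    (hσ : SmoothAt σ x) : SmoothAt (fun x' => f x' • σ x') x :=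
  ContDiffAt.smul (contDiffAt_comp_chart_symm (mem_extChartAt_source x) hf) hσ

theorem SmoothAt.congr [FiniteDimensional ℝ F] {σ τ : Form I M k} {x : M} (hσ : SmoothAt σ x)
    (h : ∀ᶠ x' in 𝓝 x, τ x' = σ x') : SmoothAt τ x := by
  refine ContDiffAt.congr_of_eventuallyEq hσ (eventually_nhds_chart (mem_extChartAt_source x) ?_)
  filter_upwards [h] with x' hx' hs
  rw [chartRep_chart _ hs, chartRep_chart _ hs]
  exact congrArg (fun τ : F [⋀^Fin k]→L[ℝ] ℝ => τ.compContinuousLinearMap _) hx'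

/-- The form on the domain of the chart at `x₀` with prescribed coordinate expression. -/
def ofChart (I : ModelWithCorners ℝ F H) (x₀ : M) (τ : F → F [⋀^Fin k]→L[ℝ] ℝ) : Form I M k :=
  fun x => ((τ (extChartAt I x₀ x)).compContinuousLinearMap (chartDeriv I x₀ x) :)

theorem chartRep_ofChart {x₀ x : M} (τ : F → F [⋀^Fin k]→L[ℝ] ℝ)
    (hx : x ∈ (extChartAt I x₀).source) :
    chartRep I (ofChart I x₀ τ) x₀ (extChartAt I x₀ x) = τ (extChartAt I x₀ x) := by
  rw [chartRep_chart _ hx]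
  ext v
  change τ (extChartAt I x₀ x) (fun i => chartDeriv I x₀ x (symmDeriv I x₀ (extChartAt I x₀ x) (v i))) = _
  simp only [chartDeriv_symmDeriv hx]

theorem smoothAt_ofChart [FiniteDimensional ℝ F] {x₀ x : M} {τ : F → F [⋀^Fin k]→L[ℝ] ℝ}
    (hx : x ∈ (extChartAt I x₀).source) (hτ : ContDiffAt ℝ ∞ τ (extChartAt I x₀ x)) :
    SmoothAt (ofChart I x₀ τ) x := by
  rw [smoothAt_iff hx]
  exact hτ.congr_of_eventuallyEq (eventually_nhds_chart hx
    (.of_forall fun x' hx' => chartRep_ofChart τ hx'))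

theorem chartRep_dFun {f : M → ℝ} {x₀ x : M} (hx : x ∈ (extChartAt I x₀).source)
    (hf : MDifferentiableAt I 𝓘(ℝ, ℝ) f x) :
    chartRep I (dFun I f) x₀ (extChartAt I x₀ x) =
      ContinuousAlternatingMap.ofSubsingleton ℝ F ℝ (0 : Fin 1)
        (fderiv ℝ (f ∘ (extChartAt I x₀).symm) (extChartAt I x₀ x)) := by
  have h := fderiv_writtenInChart (s₀ := f x) hx (mem_extChartAt_source (I := 𝓘(ℝ, ℝ)) (f x)) hf
  have h2 : (extChartAt 𝓘(ℝ, ℝ) (f x) ∘ f ∘ (extChartAt I x₀).symm) =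
    f ∘ (extChartAt I x₀).symm := by
    rw [extChartAt_model_space_eq_id]; rfl
  rw [h2] at h
  rw [chartRep_chart _ hx, h]
  have h3 : ∀ z : ℝ, chartDeriv 𝓘(ℝ, ℝ) (f x) (f x) z = z := by
    intro z
    have : chartDeriv 𝓘(ℝ, ℝ) (f x) (f x) = ContinuousLinearMap.id ℝ ℝ := by
      have key : ∀ e : PartialEquiv ℝ ℝ, e = PartialEquiv.refl ℝ →
          (mfderiv 𝓘(ℝ, ℝ) 𝓘(ℝ, ℝ) e (f x) :) = ContinuousLinearMap.id ℝ ℝ := by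
        rintro _ rfl
        exact mfderiv_id
      exact key _ (extChartAt_model_space_eq_id ℝ (f x))
    rw [this]
    rfl
  ext v
  exact (h3 _).symm

theorem smoothAt_dFun [FiniteDimensional ℝ F] {f : M → ℝ} {x : M}
    (hf : ∀ᶠ x' in 𝓝 x, ContMDiffAt I 𝓘(ℝ, ℝ) ∞ f x') : SmoothAt (dFun I f) x := by
  have hx := mem_extChartAt_source (I := I) x
  have h1 : ContDiffAt ℝ ∞ (fun y => ContinuousAlternatingMap.ofSubsingletonLIE (0 : Fin 1)
      (fderiv ℝ (f ∘ (extChartAt I x).symm) y)) (extChartAt I x x) :=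
    (ContinuousAlternatingMap.ofSubsingletonLIE (𝕜 := ℝ) (E := F) (F := ℝ)
      (0 : Fin 1)).toContinuousLinearEquiv.contDiff.contDiffAt.comp _
      ((contDiffAt_comp_chart_symm hx hf.self_of_nhds).fderiv_right (by norm_num))
  refine h1.congr_of_eventuallyEq (eventually_nhds_chart hx ?_)
  filter_upwards [hf] with x' hf' hx'
  exact chartRep_dFun hx' (hf'.mdifferentiableAt (by simp))

end General

end ManifoldForm

/-! ### Forms vanishing on the kernel of a Pfaff system -/

namespace ManifoldForm

section

variable {F : Type*} [NormedAddCommGroup F] [NormedSpace ℝ F] [FiniteDimensional ℝ F]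
  {H : Type*} [TopologicalSpace H]
  {I : ModelWithCorners ℝ F H} [I.Boundaryless] {M : Type*} [TopologicalSpace M]
  [ChartedSpace H M] [IsManifold I ∞ M] {k N : ℕ}

/-- The partition of unity lives on the open submanifold `⋃ U i` and is extended by zero. The
extension may fail to be continuous at the boundary, so every assertion concerns points of the
union. -/
theorem exists_partition [T2Space M] [SecondCountableTopology M] (I : ModelWithCorners ℝ F H)
    [I.Boundaryless] [IsManifold I ∞ M] {ι : Type*} {U : ι → Set M} (hU : ∀ i, IsOpen (U i)) :
    ∃ ρ : ι → M → ℝ, ∀ x ∈ ⋃ i, U i, (∀ i, ContMDiffAt I 𝓘(ℝ, ℝ) ∞ (ρ i) x) ∧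
      (∃ s : Finset ι, (∀ᶠ x' in 𝓝 x, ∀ i ∉ s, ρ i x' = 0) ∧
        ∀ᶠ x' in 𝓝 x, ∑ i ∈ s, ρ i x' = 1) ∧
      ∀ i, x ∉ U i → ∀ᶠ x' in 𝓝 x, ρ i x' = 0 := by
  classical
  let W : TopologicalSpace.Opens M := ⟨⋃ i, U i, isOpen_iUnion hU⟩
  have : LocallyCompactSpace W := Manifold.locallyCompact_of_finiteDimensional I
  obtain ⟨f, hf⟩ := SmoothPartitionOfUnity.exists_isSubordinate I (isClosed_univ (X := W))
    (fun i => (Subtype.val : W → M) ⁻¹' U i)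
    (fun i => (hU i).preimage continuous_subtype_val) (fun x _ => by
      obtain ⟨i, hi⟩ := Set.mem_iUnion.1 x.2
      exact Set.mem_iUnion.2 ⟨i, hi⟩)
  let ρ : ι → M → ℝ := fun i x => if h : x ∈ W then f i ⟨x, h⟩ else 0
  have hρ : ∀ i (x : W), ρ i x = f i x := fun i x => by simp [ρ]
  have hev : ∀ (x : W) (p : M → Prop), (∀ᶠ x' : W in 𝓝 x, p x') → ∀ᶠ x' in 𝓝 (x : M), p x' := by
    intro x p hp
    have := W.isOpen.isOpenEmbedding_subtypeVal.map_nhds_eq x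
    rw [← this]
    exact hp
  refine ⟨ρ, fun x hx => ?_⟩
  obtain ⟨x, rfl⟩ : ∃ y : W, (y : M) = x := ⟨⟨x, hx⟩, rfl⟩
  refine ⟨fun i => ?_, ?_, fun i hi => ?_⟩
  · rw [← contMDiffAt_subtype_iff (U := W)]
    have : (fun y : W => ρ i y) = f i := funext fun y => hρ i y
    rw [this]
    exact (f i).contMDiff.contMDiffAt
  · obtain ⟨V, hV, hfin⟩ := f.locallyFinite x
    refine ⟨hfin.toFinset, hev x _ ?_, hev x _ ?_⟩
    · filter_upwards [hV] with y hy i hi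
      by_contra hne
      rw [hρ] at hne
      exact hi (hfin.mem_toFinset.2 ⟨y, hne, hy⟩)
    · filter_upwards [hV] with y hy
      have h1 := f.sum_eq_one (Set.mem_univ y)
      rw [finsum_eq_sum_of_support_subset (s := hfin.toFinset)] at h1
      · simpa only [hρ] using h1
      · intro i hi
        exact hfin.mem_toFinset.2 ⟨y, hi, hy⟩
  · refine hev x _ ?_
    have h1 : x ∉ tsupport (f i) := fun h => hi (hf i h)
    filter_upwards [notMem_tsupport_iff_eventuallyEq.1 h1] with y hy
    rw [hρ]
    exact hy

theorem linearIndependent_chartRep {π : Fin N → Form I M 1} {x : M}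
    (h : LinearIndependent ℝ fun n => π n x) :
    LinearIndependent ℝ fun n => chartRep I (π n) x (extChartAt I x x) := by
  rw [Fintype.linearIndependent_iff] at h ⊢
  intro c hc
  refine h c ?_
  have h1 : ∀ n, (π n).raw x = (chartRep I (π n) x (extChartAt I x x)).compContinuousLinearMap
      (chartDeriv I x x) := fun n => raw_eq_chartRep (π n) (mem_extChartAt_source x)
  change ∑ n, c n • (π n).raw x = 0
  ext v
  have h2 := DFunLike.congr_fun hc fun i => chartDeriv I x x (v i)
  simp only [h1, ContinuousAlternatingMap.sum_apply, ContinuousAlternatingMap.smul_apply] at h2 ⊢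
  exact h2

/-- In the chart at `x`, the remainder of `exists_wedge_decomposition` evaluates `σ` on vectors
killed by all `π n`, which gives zero at points of `S`. The coefficients are smooth on a full
neighbourhood, although the identity holds only on `S`. -/
theorem exists_local_wedge_decomposition {π : Fin N → Form I M 1} {σ : Form I M (k + 1)} {x : M}
    {S : Set M} (hπ : ∀ n, ∀ᶠ x' in 𝓝 x, SmoothAt (π n) x') (hσ : ∀ᶠ x' in 𝓝 x, SmoothAt σ x')
    (hind : LinearIndependent ℝ fun n => π n x)
    (hker : ∀ s ∈ S, ∀ v : Fin (k + 1) → TangentSpace I s,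
      (∀ i n, π n s (fun _ => v i) = 0) → σ s v = 0) :
    ∃ ξ : Fin N → Form I M k, ∀ᶠ x' in 𝓝 x, (∀ n, SmoothAt (ξ n) x') ∧
      (x' ∈ S → σ x' = ∑ n, wedge (ξ n x') (π n x')) := by
  have hx := mem_extChartAt_source (I := I) x
  have hev : ∀ {l : ℕ} {τ : Form I M l}, (∀ᶠ x' in 𝓝 x, SmoothAt τ x') →
      ∀ᶠ y in 𝓝 (extChartAt I x x), ContDiffAt ℝ ∞ (chartRep I τ x) y := by
    intro l τ hτ
    refine eventually_nhds_chart hx ?_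
    filter_upwards [hτ] with x' h1 h2
    exact (smoothAt_iff h2).1 h1
  obtain ⟨Y, hY, hdual⟩ := exists_contDiffAt_dual_vectors (fun n => hev (hπ n))
    (linearIndependent_chartRep hind)
  obtain ⟨ξ, q, hξ, hdec⟩ := exists_wedge_decomposition (fun n => chartRep I (π n) x) Y
    (chartRep I σ x)
  have hall : ∀ᶠ y in 𝓝 (extChartAt I x x), (∀ n, ContDiffAt ℝ ∞ (ξ n) y) ∧
      ∀ n m, chartRep I (π n) x y (fun _ => Y m y) = if n = m then 1 else 0 := by
    filter_upwards [Filter.eventually_all.2 fun n => hev (hπ n), Filter.eventually_all.2 hY,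
      hev hσ, hdual] with y h1 h2 h3 h4
    exact ⟨hξ y h1 h2 h3, h4⟩
  refine ⟨fun n => ofChart I x (ξ n), ?_⟩
  filter_upwards [eventually_mem_source hx, (continuousAt_extChartAt x).eventually hall]
    with x' hx' ⟨h1, h2⟩
  refine ⟨fun n => smoothAt_ofChart hx' (h1 n), fun hS => ?_⟩
  obtain ⟨h3, h4⟩ := hdec _ h2
  have h5 : (chartRep I σ x (extChartAt I x x')).compContinuousLinearMap
      (q (extChartAt I x x')) = 0 := by
    rw [chartRep_chart _ hx']
    ext v
    refine hker x' hS _ fun i n => ?_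
    have h6 := h3 n (v i)
    rw [chartRep_chart _ hx'] at h6
    exact h6
  rw [h5, add_zero] at h4
  let w : Fin N → F [⋀^Fin (k + 1)]→L[ℝ] ℝ := fun n =>
    wedge (ofChart I x (ξ n) x' : F [⋀^Fin k]→L[ℝ] ℝ) ((π n).raw x')
  have h7 : ∀ n, w n = (wedge (ξ n (extChartAt I x x')) (chartRep I (π n) x
      (extChartAt I x x'))).compContinuousLinearMap (chartDeriv I x x') := by
    intro n
    rw [wedge_compContinuousLinearMap, ← raw_eq_chartRep (π n) hx']
    rfl
  change σ.raw x' = ∑ n, w n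
  rw [raw_eq_chartRep σ hx', h4]
  ext v
  simp [h7, ContinuousAlternatingMap.sum_apply]

theorem smoothAlong_iff {σ : Form I M k} {S : Set M} :
    SmoothAlong I S σ ↔ ∃ W : Set M, IsOpen W ∧ S ⊆ W ∧ ∀ x ∈ W, SmoothAt σ x := by
  simp only [SmoothAlong, smoothOn_iff]

theorem SmoothAlong.eventually {σ : Form I M k} {S : Set M} (h : SmoothAlong I S σ) {x : M}
    (hx : x ∈ S) : ∀ᶠ x' in 𝓝 x, SmoothAt σ x' := by
  obtain ⟨W, hW, hSW, hσ⟩ := smoothAlong_iff.1 h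
  filter_upwards [hW.mem_nhds (hSW hx)] with x' hx' using hσ x' hx'

/-- The equation is affine in the coefficients `ξ`, so a partition of unity glues local solutions
into a global one. -/
theorem exists_wedge_decomposition_along [T2Space M] [SecondCountableTopology M]
    {π : Fin N → Form I M 1} {σ : Form I M (k + 1)} {S : Set M}
    (hπ : ∀ n, SmoothAlong I S (π n)) (hσ : SmoothAlong I S σ)
    (hind : ∀ x ∈ S, LinearIndependent ℝ fun n => π n x)
    (hker : ∀ s ∈ S, ∀ v : Fin (k + 1) → TangentSpace I s,
      (∀ i n, π n s (fun _ => v i) = 0) → σ s v = 0) :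
    ∃ ξ : Fin N → Form I M k, (∀ n, SmoothAlong I S (ξ n)) ∧
      ∀ s ∈ S, σ s = ∑ n, wedge (ξ n s) (π n s) := by
  choose ξ hξ using fun x : S => exists_local_wedge_decomposition (k := k) (σ := σ) (S := S)
    (fun n => (hπ n).eventually x.2) (hσ.eventually x.2) (hind x x.2) hker
  choose U hU hUo hxU using fun x : S => eventually_nhds_iff.1 (hξ x)
  obtain ⟨ρ, hρ⟩ := exists_partition I hUo
  have hSW : S ⊆ ⋃ i, U i := fun x hx => Set.mem_iUnion.2 ⟨⟨x, hx⟩, hxU ⟨x, hx⟩⟩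
  have hsum : ∀ x ∈ ⋃ i, U i, ∃ s : Finset S, (∀ᶠ x' in 𝓝 x, ∑ i ∈ s, ρ i x' = 1) ∧
      ∀ n, ∀ᶠ x' in 𝓝 x, ∑ᶠ i, ρ i x' • ξ i n x' = ∑ i ∈ s, ρ i x' • ξ i n x' := by
    intro x hx
    obtain ⟨s, h1, h2⟩ := (hρ x hx).2.1
    refine ⟨s, h2, fun n => ?_⟩
    filter_upwards [h1] with x' h3
    refine finsum_eq_sum_of_support_subset _ fun i hi => ?_
    by_contra his
    exact hi (by simp only [h3 i his, zero_smul])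
  refine ⟨fun n x => ∑ᶠ i, ρ i x • ξ i n x, fun n => smoothAlong_iff.2
    ⟨⋃ i, U i, isOpen_iUnion hUo, hSW, fun x hx => ?_⟩, fun x hx => ?_⟩
  · obtain ⟨s, -, h2⟩ := hsum x hx
    refine SmoothAt.congr (σ := fun x' => ∑ i ∈ s, ρ i x' • ξ i n x') ?_ (h2 n)
    refine SmoothAt.sum (σ := fun i x' => ρ i x' • ξ i n x') fun i _ => ?_
    by_cases hi : x ∈ U i
    · exact ((hU i x hi).1 n).smul ((hρ x hx).1 i)
    · refine SmoothAt.congr smoothAt_zero ?_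
      filter_upwards [(hρ x hx).2.2 i hi] with x' h3
      simp only [h3, zero_smul]
      rfl
  · obtain ⟨s, h1, h2⟩ := hsum x (hSW hx)
    have h1' := h1.self_of_nhds
    have h3 : ∀ n, wedge (∑ᶠ i, ρ i x • ξ i n x) (π n x) =
        ∑ i ∈ s, ρ i x • wedge (ξ i n x) (π n x) := by
      intro n
      rw [(h2 n).self_of_nhds, wedge_sum_left]
      simp only [wedge_smul_left]
    simp only [h3]
    rw [Finset.sum_comm]
    calc σ x = ∑ i ∈ s, ρ i x • σ x := by rw [← Finset.sum_smul, h1', one_smul]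
      _ = _ := by
        refine Finset.sum_congr rfl fun i _ => ?_
        by_cases hi : x ∈ U i
        · rw [(hU i x hi).2 hx, Finset.smul_sum]
        · have := ((hρ x (hSW hx)).2.2 i hi).self_of_nhds
          simp only [this, zero_smul, Finset.sum_const_zero]

end

end ManifoldForm

/-! ### Total spaces of bundles -/

section Bundle

variable {B : Type*} [TopologicalSpace B] (F : Type*) [TopologicalSpace F] (E : B → Type*)
  [∀ b, TopologicalSpace (E b)] [TopologicalSpace (Bundle.TotalSpace F E)] [FiberBundle F E]

/-- Together with second countability, this provides partitions of unity on `TQ` and `T^*Q`. Two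
points of one fibre are separated in a trivialization, other pairs by their projections. -/
theorem FiberBundle.t2Space_totalSpace [T2Space B] [T2Space F] :
    T2Space (Bundle.TotalSpace F E) := by
  refine ⟨fun x y hxy => ?_⟩
  by_cases hp : x.proj = y.proj
  · let e := (trivializationAt F E x.proj).toOpenPartialHomeomorph
    have hx : x ∈ e.source := FiberBundle.mem_trivializationAt_proj_source
    have hy : y ∈ e.source := by
      rw [(trivializationAt F E x.proj).mem_source, ← hp]
      exact FiberBundle.mem_baseSet_trivializationAt' _
    obtain ⟨U, V, hU, hV, hxU, hyV, hUV⟩ := t2_separation (e.injOn.ne hx hy hxy)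
    exact ⟨e.source ∩ e ⁻¹' U, e.source ∩ e ⁻¹' V, e.isOpen_inter_preimage hU,
      e.isOpen_inter_preimage hV, ⟨hx, hxU⟩, ⟨hy, hyV⟩,
      (hUV.preimage e).mono Set.inter_subset_right Set.inter_subset_right⟩
  · obtain ⟨U, V, hU, hV, hxU, hyV, hUV⟩ := t2_separation hp
    have hc := FiberBundle.continuous_proj F E
    exact ⟨_, _, hU.preimage hc, hV.preimage hc, hxU, hyV, hUV.preimage _⟩

theorem FiberBundle.secondCountableTopology_totalSpace [SecondCountableTopology B]
    [SecondCountableTopology F] : SecondCountableTopology (Bundle.TotalSpace F E) := by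
  obtain ⟨s, hs, hcov⟩ := TopologicalSpace.countable_cover_nhds fun b : B =>
    (trivializationAt F E b).open_baseSet.mem_nhds (FiberBundle.mem_baseSet_trivializationAt' b)
  have : Countable s := hs.to_subtype
  let U : s → Set (Bundle.TotalSpace F E) := fun b => (trivializationAt F E (b : B)).source
  have : ∀ b, SecondCountableTopology (U b) := fun b =>
    (trivializationAt F E (b : B)).toOpenPartialHomeomorph.secondCountableTopology_source
  refine TopologicalSpace.secondCountableTopology_of_countable_cover (U := U)
    (fun b => (trivializationAt F E (b : B)).open_source) ?_
  refine Set.eq_univ_of_forall fun x => ?_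
  have hx : x.proj ∈ ⋃ b ∈ s, (trivializationAt F E b).baseSet := by rw [hcov]; trivial
  obtain ⟨b, hb, hxb⟩ := Set.mem_iUnion₂.1 hx
  exact Set.mem_iUnion.2 ⟨⟨b, hb⟩, (trivializationAt F E b).mem_source.2 hxb⟩

end Bundle

namespace SingularLagrangian

open ManifoldForm

section VectorBundle

variable {EB : Type*} [NormedAddCommGroup EB] [NormedSpace ℝ EB] {HB : Type*} [TopologicalSpace HB]
  {IB : ModelWithCorners ℝ EB HB} [IB.Boundaryless] {B : Type*} [TopologicalSpace B]
  [ChartedSpace HB B] [IsManifold IB ∞ B]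
  {F : Type*} [NormedAddCommGroup F] [NormedSpace ℝ F] {E : B → Type*}
  [∀ b, TopologicalSpace (E b)] [∀ b, AddCommGroup (E b)] [∀ b, Module ℝ (E b)]
  [TopologicalSpace (Bundle.TotalSpace F E)] [FiberBundle F E] [VectorBundle ℝ F E]
  [ContMDiffVectorBundle ∞ F E IB]

theorem extChartAt_totalSpace (x z : Bundle.TotalSpace F E) :
    extChartAt (IB.prod 𝓘(ℝ, F)) x z =
      (extChartAt IB x.proj (trivializationAt F E x.proj z).1,
        (trivializationAt F E x.proj z).2) := by
  rw [FiberBundle.extChartAt]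
  rfl

theorem mem_extChartAt_source_totalSpace {x z : Bundle.TotalSpace F E} :
    z ∈ (extChartAt (IB.prod 𝓘(ℝ, F)) x).source ↔
      z.proj ∈ (trivializationAt F E x.proj).baseSet ∧ z.proj ∈ (extChartAt IB x.proj).source := by
  rw [FiberBundle.extChartAt, PartialEquiv.trans_source, Set.mem_inter_iff]
  have h1 : z ∈ (trivializationAt F E x.proj).toPartialEquiv.source ↔
      z.proj ∈ (trivializationAt F E x.proj).baseSet := (trivializationAt F E x.proj).mem_source
  rw [h1]
  refine and_congr_right fun h => ?_
  rw [Set.mem_preimage, PartialEquiv.prod_source, Set.mem_prod]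
  have h2 : ((trivializationAt F E x.proj).toPartialEquiv z).1 = z.proj :=
    (trivializationAt F E x.proj).coe_fst' h
  rw [h2]
  simp

/-- In a bundle chart and the underlying base chart, the projection is `Prod.fst`. -/
theorem chartDeriv_proj {x z : Bundle.TotalSpace F E}
    (hz : z ∈ (extChartAt (IB.prod 𝓘(ℝ, F)) x).source) (v : EB × F) :
    rawDeriv (IB.prod 𝓘(ℝ, F)) IB (Bundle.TotalSpace.proj : Bundle.TotalSpace F E → B) z
      (symmDeriv (IB.prod 𝓘(ℝ, F)) x (extChartAt (IB.prod 𝓘(ℝ, F)) x z) v) =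
    symmDeriv IB x.proj (extChartAt IB x.proj z.proj) v.1 := by
  have hz' := mem_extChartAt_source_totalSpace.1 hz
  have hsm : ContMDiffAt (IB.prod 𝓘(ℝ, F)) IB ∞
      (Bundle.TotalSpace.proj : Bundle.TotalSpace F E → B) z := Bundle.contMDiffAt_proj E
  have h := fderiv_writtenInChart (s₀ := x.proj) hz hz'.2 (hsm.mdifferentiableAt (by simp))
  have h2 : (extChartAt IB x.proj ∘ Bundle.TotalSpace.proj ∘ (extChartAt (IB.prod 𝓘(ℝ, F)) x).symm)
      =ᶠ[𝓝 (extChartAt (IB.prod 𝓘(ℝ, F)) x z)] Prod.fst := by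
    refine eventually_nhds_chart hz (.of_forall fun z' hz' => ?_)
    have h3 := mem_extChartAt_source_totalSpace.1 hz'
    rw [Function.comp_apply, Function.comp_apply, (extChartAt (IB.prod 𝓘(ℝ, F)) x).left_inv hz',
      extChartAt_totalSpace, (trivializationAt F E x.proj).coe_fst' h3.1]
  rw [h2.fderiv_eq, fderiv_fst] at h
  have h4 := DFunLike.congr_fun h v
  have h5 := symmDeriv_chartDeriv hz'.2
    (rawDeriv (IB.prod 𝓘(ℝ, F)) IB (Bundle.TotalSpace.proj : Bundle.TotalSpace F E → B) z
      (symmDeriv (IB.prod 𝓘(ℝ, F)) x (extChartAt (IB.prod 𝓘(ℝ, F)) x z) v))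
  rw [← h5]
  exact congrArg _ h4.symm

end VectorBundle

end SingularLagrangian

namespace ManifoldForm

section SelfChart

variable {F : Type*} [NormedAddCommGroup F] [NormedSpace ℝ F] {H : Type*} [TopologicalSpace H]
  {I : ModelWithCorners ℝ F H} {M : Type*} [TopologicalSpace M] [ChartedSpace H M]
  [IsManifold I ∞ M]

theorem chartDeriv_self (x : M) : chartDeriv I x x = ContinuousLinearMap.id ℝ F := by
  have := isManifold_one I M
  exact mfderiv_extChartAt_self

theorem symmDeriv_self (x : M) :
    symmDeriv I x (extChartAt I x x) = ContinuousLinearMap.id ℝ F := by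
  have := isManifold_one I M
  exact mfderivWithin_range_extChartAt_symm

end SelfChart

end ManifoldForm

/-! ### Bundle projections and fibre coordinates in charts -/

namespace SingularLagrangian

open ManifoldForm

section Canonical

variable {D : ℕ} {Q : Type*} [TopologicalSpace Q] [ChartedSpace (EuclideanSpace ℝ (Fin D)) Q]
  [IsManifold (𝓡 D) ∞ Q]

/-- The model space of the cotangent bundle. -/
abbrev CModel (D : ℕ) : Type :=
  EuclideanSpace ℝ (Fin D) × (EuclideanSpace ℝ (Fin D) →L[ℝ] ℝ)

/-- A tangent space is identified with the model space through the chart at its own base point,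
where the chart has derivative the identity. -/
theorem rawDeriv_proj_PC (s : PC D Q) (v : CModel D) :
    rawDeriv (IC D) (𝓡 D) (Bundle.TotalSpace.proj : PC D Q → Q) s v = v.1 := by
  have h := chartDeriv_proj (IB := 𝓡 D) (mem_extChartAt_source (I := IC D) s) v
  rw [symmDeriv_self] at h
  refine h.trans ?_
  rw [symmDeriv_self]
  rfl

theorem rawDeriv_proj_PL (u : PL D Q)
    (v : EuclideanSpace ℝ (Fin D) × EuclideanSpace ℝ (Fin D)) :
    rawDeriv (IL D) (𝓡 D) (Bundle.TotalSpace.proj : PL D Q → Q) u v = v.1 := by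
  have h := chartDeriv_proj (IB := 𝓡 D) (mem_extChartAt_source (I := IL D) u) v
  rw [symmDeriv_self] at h
  refine h.trans ?_
  rw [symmDeriv_self]
  rfl

/-- The covector of a point of the cotangent bundle, as a covector on the model space. -/
def rawCovector (s : PC D Q) : EuclideanSpace ℝ (Fin D) →L[ℝ] ℝ := s.2

/-- This shows that the charts of `T^*Q` are the coordinates `(q, p)` induced by the charts of `Q`,
hence Darboux charts. -/
theorem trivializationAt_PC_snd (q : Q) (s : PC D Q)
    (hs : s.proj ∈ (extChartAt (𝓡 D) q).source) :
    (trivializationAt (EuclideanSpace ℝ (Fin D) →L[ℝ] ℝ)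
      (fun q : Q => TangentSpace (𝓡 D) q →L[ℝ] ℝ) q s).2 =
      (rawCovector s).comp (symmDeriv (𝓡 D) q (extChartAt (𝓡 D) q s.proj)) := by
  have := isManifold_one (𝓡 D) Q
  have h1 := TangentBundle.symmL_trivializationAt (I := 𝓡 D) (x₀ := q) (x := s.proj)
    (by simpa using hs)
  have h2 : trivializationAt (EuclideanSpace ℝ (Fin D) →L[ℝ] ℝ)
      (fun q : Q => TangentSpace (𝓡 D) q →L[ℝ] ℝ) q s = _ :=
    hom_trivializationAt_apply (RingHom.id ℝ) (F₁ := EuclideanSpace ℝ (Fin D))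
    (E₁ := (TangentSpace (𝓡 D) : Q → Type)) (F₂ := ℝ) (E₂ := fun _ : Q => ℝ) q s
  rw [h2]
  ext v
  have h3 : ∀ v, ContinuousLinearMap.inCoordinates (EuclideanSpace ℝ (Fin D)) (TangentSpace (𝓡 D)) ℝ
      (fun _ : Q => ℝ) q s.proj q s.proj s.snd v = s.snd (Bundle.Trivialization.symmL ℝ
        (trivializationAt (EuclideanSpace ℝ (Fin D)) (TangentSpace (𝓡 D)) q) s.proj v) := fun v => by
    simp [ContinuousLinearMap.inCoordinates]
  refine (h3 v).trans ?_
  rw [h1]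
  rfl

end Canonical

end SingularLagrangian

theorem finrank_continuousDual (V : Type*) [NormedAddCommGroup V] [NormedSpace ℝ V]
    [FiniteDimensional ℝ V] : Module.finrank ℝ (V →L[ℝ] ℝ) = Module.finrank ℝ V := by
  rw [← (LinearMap.toContinuousLinearMap (𝕜 := ℝ) (E := V) (F' := ℝ)).finrank_eq]
  exact Subspace.dual_finrank_eq

theorem ContinuousLinearMap.exists_rightInverse_of_injective_dual {V : Type*}
    [NormedAddCommGroup V] [NormedSpace ℝ V] [FiniteDimensional ℝ V] (f : V →L[ℝ] V →L[ℝ] ℝ)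
    (hf : Function.Injective f) : ∃ g : (V →L[ℝ] ℝ) →L[ℝ] V, ∀ α, f (g α) = α := by
  have h : Function.Surjective f.toLinearMap :=
    (LinearMap.injective_iff_surjective_of_finrank_eq_finrank (f := f.toLinearMap)
      (finrank_continuousDual V).symm).1 hf
  obtain ⟨g, hg⟩ := f.toLinearMap.exists_rightInverse_of_surjective (LinearMap.range_eq_top.2 h)
  exact ⟨LinearMap.toContinuousLinearMap g, fun α => DFunLike.congr_fun hg α⟩

/-! ### The canonical two-form in Darboux charts and its musical isomorphisms -/

namespace SingularLagrangian

open ManifoldForm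

variable {D : ℕ} {Q : Type*} [TopologicalSpace Q] [ChartedSpace (EuclideanSpace ℝ (Fin D)) Q]
  [IsManifold (𝓡 D) ∞ Q]

/-- The model space of the tangent bundle. -/
abbrev LModel (D : ℕ) : Type := EuclideanSpace ℝ (Fin D) × EuclideanSpace ℝ (Fin D)

/-- The Liouville form of the model space of the cotangent bundle, as a linear map from points to
`1`-forms. -/
def modelLiouvilleCLM : CModel D →L[ℝ] CModel D [⋀^Fin 1]→L[ℝ] ℝ :=
  (ContinuousAlternatingMap.ofSubsingletonLIE (𝕜 := ℝ) (E := CModel D) (F := ℝ)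
    (0 : Fin 1)).toContinuousLinearEquiv.toContinuousLinearMap.comp
    (((ContinuousLinearMap.compL ℝ (CModel D) (EuclideanSpace ℝ (Fin D)) ℝ).flip
      (ContinuousLinearMap.fst ℝ _ _)).comp (ContinuousLinearMap.snd ℝ _ _))

/-- In induced coordinates the form is `p dq`, which is linear in the point; its derivative is
therefore constant, and so is `ω` in every chart. -/
theorem chartRep_liouvilleForm {x s : PC D Q} (hs : s ∈ (extChartAt (IC D) x).source) :
    chartRep (IC D) liouvilleForm x (extChartAt (IC D) x s) =
      modelLiouvilleCLM (extChartAt (IC D) x s) := by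
  rw [chartRep_chart _ hs]
  ext v
  have hs' := mem_extChartAt_source_totalSpace.1 hs
  have h1 := chartDeriv_proj (IB := 𝓡 D) hs (v 0)
  have h2 := trivializationAt_PC_snd x.proj s hs'.2
  have h3 := congrArg Prod.snd (extChartAt_totalSpace (IB := 𝓡 D) x s)
  change rawCovector s (rawDeriv (IC D) (𝓡 D) (Bundle.TotalSpace.proj : PC D Q → Q) s
      (symmDeriv (IC D) x (extChartAt (IC D) x s) (v 0))) = (extChartAt (IC D) x s).2 (v 0).1
  rw [h1]
  refine Eq.trans ?_ (DFunLike.congr_fun (h3.trans h2) (v 0).1).symm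
  rfl

theorem smoothAt_liouvilleForm (s : PC D Q) : SmoothAt (I := IC D) liouvilleForm s :=
  modelLiouvilleCLM.contDiff.contDiffAt.congr_of_eventuallyEq
    (eventually_nhds_chart (mem_extChartAt_source s)
      (.of_forall fun _ h => chartRep_liouvilleForm h))

theorem chartRep_canonicalForm {x s : PC D Q} (hs : s ∈ (extChartAt (IC D) x).source)
    (v w : CModel D) :
    chartRep (IC D) canonicalForm x (extChartAt (IC D) x s) ![v, w] = w.2 v.1 - v.2 w.1 := by
  have h1 := chartRep_extD hs (smoothAt_liouvilleForm s)
  have h2 : chartRep (IC D) (liouvilleForm (D := D) (Q := Q)) x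
      =ᶠ[𝓝 (extChartAt (IC D) x s)] modelLiouvilleCLM :=
    eventually_nhds_chart hs (.of_forall fun _ h => chartRep_liouvilleForm h)
  rw [extDeriv, h2.fderiv_eq, ContinuousLinearMap.fderiv] at h1
  have h3 : chartRep (IC D) (canonicalForm (D := D) (Q := Q)) x (extChartAt (IC D) x s) =
    -chartRep (IC D) (extD (IC D) (liouvilleForm (D := D) (Q := Q))) x (extChartAt (IC D) x s) := rfl
  rw [h3, h1]
  have h4 : ContinuousAlternatingMap.alternatizeUncurryFin (modelLiouvilleCLM (D := D)) ![v, w] =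
      v.2 w.1 - w.2 v.1 := by
    rw [ContinuousAlternatingMap.alternatizeUncurryFin_apply, Fin.sum_univ_two]
    simp
    rfl
  rw [ContinuousAlternatingMap.neg_apply, h4]
  ring

/-- In a chart of the cotangent bundle, the canonical two-form is constant. -/
theorem raw_canonicalForm_symmDeriv {x s : PC D Q} (hs : s ∈ (extChartAt (IC D) x).source)
    (v w : CModel D) :
    (canonicalForm (D := D) (Q := Q)).raw s ![symmDeriv (IC D) x (extChartAt (IC D) x s) v,
      symmDeriv (IC D) x (extChartAt (IC D) x s) w] = w.2 v.1 - v.2 w.1 := by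
  rw [← chartRep_canonicalForm hs, chartRep_chart _ hs,
    ContinuousAlternatingMap.compContinuousLinearMap_apply]
  congr 1
  funext i
  fin_cases i <;> rfl

theorem raw_canonicalForm (s : PC D Q) (v w : CModel D) :
    (canonicalForm (D := D) (Q := Q)).raw s ![v, w] = w.2 v.1 - v.2 w.1 := by
  have := raw_canonicalForm_symmDeriv (mem_extChartAt_source (I := IC D) s) v w
  rwa [symmDeriv_self] at this

/-- The isomorphism `v ↦ i_v ω` on the model space of the cotangent bundle. -/
def modelFlat (D : ℕ) : CModel D →L[ℝ] (CModel D →L[ℝ] ℝ) :=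
  ((ContinuousLinearMap.compL ℝ (CModel D) (EuclideanSpace ℝ (Fin D) →L[ℝ] ℝ) ℝ).flip
      (ContinuousLinearMap.snd ℝ _ _)).comp
    ((ContinuousLinearMap.apply ℝ ℝ).comp (ContinuousLinearMap.fst ℝ _ _)) -
  ((ContinuousLinearMap.compL ℝ (CModel D) (EuclideanSpace ℝ (Fin D)) ℝ).flip
      (ContinuousLinearMap.fst ℝ _ _)).comp (ContinuousLinearMap.snd ℝ _ _)

theorem modelFlat_apply (v w : CModel D) : modelFlat D v w = w.2 v.1 - v.2 w.1 := rfl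

theorem modelFlat_injective : Function.Injective (modelFlat D) := by
  rw [injective_iff_map_eq_zero]
  intro v hv
  have h1 : v.2 = 0 := by
    refine ContinuousLinearMap.ext fun x => ?_
    have := DFunLike.congr_fun hv ((x, 0) : CModel D)
    simpa [modelFlat_apply] using this
  have h2 : v.1 = 0 := by
    -- The covector `⟨v.1, ·⟩` is chosen so that the pairing equals `⟨v.1, v.1⟩`.
    have := DFunLike.congr_fun hv ((0, innerSL ℝ v.1) : CModel D)
    rw [modelFlat_apply] at this
    simpa using this
  exact Prod.ext h2 h1

theorem finrank_CModel : Module.finrank ℝ (CModel D) = 2 * D := by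
  rw [Module.finrank_prod, finrank_continuousDual]
  simp; ring

theorem finrank_LModel : Module.finrank ℝ (LModel D) = 2 * D := by
  rw [Module.finrank_prod]
  simp; ring

theorem exists_modelSharp (D : ℕ) : ∃ g : (CModel D →L[ℝ] ℝ) →L[ℝ] CModel D,
    ∀ α, modelFlat D (g α) = α :=
  ContinuousLinearMap.exists_rightInverse_of_injective_dual (modelFlat D) modelFlat_injective

/-- The inverse of `modelFlat`. -/
def modelSharp (D : ℕ) : (CModel D →L[ℝ] ℝ) →L[ℝ] CModel D := (exists_modelSharp D).choose

theorem modelFlat_modelSharp (α : CModel D →L[ℝ] ℝ) : modelFlat D (modelSharp D α) = α :=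
  (exists_modelSharp D).choose_spec α

/-! ### The derivative of the fibre derivative -/

section FibreDeriv

variable {L : PL D Q → ℝ}

/-- `𝓛` covers the identity of `Q`; differentiate `proj ∘ 𝓛 = proj`. -/
theorem rawDeriv_fibreDeriv_fst (h : ContMDiff (IL D) (IC D) ∞ (fibreDeriv L)) (u : PL D Q)
    (v : LModel D) : (rawDeriv (IL D) (IC D) (fibreDeriv L) u v).1 = v.1 := by
  have h1 : MDifferentiableAt (IL D) (IC D) (fibreDeriv L) u :=
    (h u).mdifferentiableAt (by simp)
  have h2 : MDifferentiableAt (IC D) (𝓡 D) (Bundle.TotalSpace.proj : PC D Q → Q)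
      (fibreDeriv L u) :=
    (Bundle.contMDiffAt_proj (n := ∞) _).mdifferentiableAt (by simp)
  have h3 := mfderiv_comp u h2 h1
  have h4 : rawDeriv (IL D) (𝓡 D) (Bundle.TotalSpace.proj : PL D Q → Q) u =
    (rawDeriv (IC D) (𝓡 D) (Bundle.TotalSpace.proj : PC D Q → Q) (fibreDeriv L u)).comp
      (rawDeriv (IL D) (IC D) (fibreDeriv L) u) := h3
  rw [← rawDeriv_proj_PC (fibreDeriv L u), ← rawDeriv_proj_PL u, h4]
  rfl

theorem thetaL_eq_pullback (h : ContMDiff (IL D) (IC D) ∞ (fibreDeriv L)) :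
    thetaL L = pullback (IL D) (IC D) (fibreDeriv L) liouvilleForm := by
  funext u
  refine ContinuousAlternatingMap.ext fun v => ?_
  change (momentum L u) (rawDeriv (IL D) (𝓡 D) (Bundle.TotalSpace.proj : PL D Q → Q) u (v 0)) =
    (momentum L u) (rawDeriv (IC D) (𝓡 D) (Bundle.TotalSpace.proj : PC D Q → Q) (fibreDeriv L u)
      (rawDeriv (IL D) (IC D) (fibreDeriv L) u (v 0)))
  congr 1
  exact (rawDeriv_proj_PL u (v 0)).trans ((rawDeriv_fibreDeriv_fst h u (v 0)).symm.trans
    (rawDeriv_proj_PC _ _).symm)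

theorem lagrangeForm_eq_pullback (h : ContMDiff (IL D) (IC D) ∞ (fibreDeriv L)) :
    lagrangeForm L = pullback (IL D) (IC D) (fibreDeriv L) canonicalForm := by
  funext u
  have := extD_pullback (I := IL D) (f := fibreDeriv L) (x := u) (σ := liouvilleForm) (smoothAt_liouvilleForm (fibreDeriv L u))
    (.of_forall fun u' => h u')
  rw [← thetaL_eq_pullback h] at this
  change -extD (IL D) (thetaL L) u = _
  rw [this]
  rfl

/-- `ker Ω_L(u)` as a subspace of the model space. -/
def rawKerOmega (L : PL D Q → ℝ) (u : PL D Q) : Submodule ℝ (LModel D) := kerOmega L u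

/-- This is `Ω_L = 𝓛^*ω` read pointwise, in the form required by
`LinearMap.exists_of_annihilates_range`. -/
theorem mem_rawKerOmega (h : ContMDiff (IL D) (IC D) ∞ (fibreDeriv L)) {u : PL D Q}
    {v : LModel D} : v ∈ rawKerOmega L u ↔
      ∀ w, modelFlat D (rawDeriv (IL D) (IC D) (fibreDeriv L) u v)
        (rawDeriv (IL D) (IC D) (fibreDeriv L) u w) = 0 := by
  have h1 : ∀ w : LModel D, (lagrangeForm L).raw u ![v, w] =
      modelFlat D (rawDeriv (IL D) (IC D) (fibreDeriv L) u v)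
        (rawDeriv (IL D) (IC D) (fibreDeriv L) u w) := fun w => by
    rw [lagrangeForm_eq_pullback h, raw_pullback, modelFlat_apply,
      ContinuousAlternatingMap.compContinuousLinearMap_apply,
      ← raw_canonicalForm (fibreDeriv L u)]
    congr 1
    funext i
    fin_cases i <;> rfl
  have h2 : v ∈ rawKerOmega L u ↔
      ((lagrangeForm L).raw u).toAlternatingMap.curryLeft v = 0 := by
    change v ∈ LinearMap.ker ((lagrangeForm L).raw u).toAlternatingMap.curryLeft ↔ _
    rw [LinearMap.mem_ker]
  rw [h2]
  refine ⟨fun hv w => ?_, fun hv => ?_⟩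
  · rw [← h1]
    exact DFunLike.congr_fun hv ![w]
  · ext w
    refine Eq.trans ?_ ((h1 (w 0)).trans (hv (w 0)))
    change (lagrangeForm L).raw u (Matrix.vecCons v w) = _
    congr 1
    funext i
    fin_cases i <;> rfl

theorem mem_vertical {u : PL D Q} {v : LModel D} :
    (show TangentSpace (IL D) u from v) ∈ vertical u ↔ v.1 = 0 := by
  have h2 : (show TangentSpace (IL D) u from v) ∈ vertical u ↔
    rawDeriv (IL D) (𝓡 D) (Bundle.TotalSpace.proj : PL D Q → Q) u v = 0 := LinearMap.mem_ker
  rw [h2, rawDeriv_proj_PL]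

/-- The Hessian as a bilinear form on the model space. -/
def rawHessian (L : PL D Q → ℝ) (u : PL D Q) :
    EuclideanSpace ℝ (Fin D) →L[ℝ] EuclideanSpace ℝ (Fin D) →L[ℝ] ℝ := hessian L u

theorem trivializationAt_PL_self (q : Q) (w : EuclideanSpace ℝ (Fin D)) :
    (trivializationAt (EuclideanSpace ℝ (Fin D)) (TangentSpace (𝓡 D)) q (⟨q, w⟩ : PL D Q)).2 = w := by
  have := isManifold_one (𝓡 D) Q
  have h := TangentBundle.continuousLinearMapAt_trivializationAt (I := 𝓡 D) (x₀ := q) (x := q)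
    (by simp)
  have h2 := chartDeriv_self (I := 𝓡 D) q
  have h3 := DFunLike.congr_fun (h.trans h2) w
  refine Eq.trans ?_ h3
  symm
  exact ((trivializationAt (EuclideanSpace ℝ (Fin D)) (TangentSpace (𝓡 D)) q).linearMapAt_apply
    (R := ℝ) _).trans (if_pos (by simp))

/-- Over a fixed `q`, the charts centred over `q` reduce to the identity on fibre coordinates, so in
them `𝓛` is `w ↦ momentum L ⟨q, w⟩`, whose derivative is the Hessian. -/
theorem rawDeriv_fibreDeriv_inr (h : ContMDiff (IL D) (IC D) ∞ (fibreDeriv L)) (u : PL D Q)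
    (b : EuclideanSpace ℝ (Fin D)) :
    (rawDeriv (IL D) (IC D) (fibreDeriv L) u (0, b)).2 = rawHessian L u b := by
  obtain ⟨q, w₀, rfl⟩ : ∃ (q : Q) (w₀ : EuclideanSpace ℝ (Fin D)), (⟨q, w₀⟩ : PL D Q) = u :=
    ⟨u.1, u.2, rfl⟩
  set u : PL D Q := ⟨q, w₀⟩
  set g := extChartAt (IC D) (fibreDeriv L u) ∘ fibreDeriv L ∘ (extChartAt (IL D) u).symm with hg
  have h1 := fderiv_writtenInChart (mem_extChartAt_source (I := IL D) u)
    (mem_extChartAt_source (I := IC D) (fibreDeriv L u)) ((h u).mdifferentiableAt (by simp))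
  rw [chartDeriv_self, symmDeriv_self] at h1
  have h2 : ∀ w : EuclideanSpace ℝ (Fin D), extChartAt (IL D) u ⟨q, w⟩ =
      (extChartAt (𝓡 D) q q, w) := fun w =>
    (extChartAt_totalSpace (IB := 𝓡 D) u ⟨q, w⟩).trans
      (congrArg₂ (fun a b => (extChartAt (𝓡 D) q a, b))
        (Bundle.Trivialization.coe_fst' _ (FiberBundle.mem_baseSet_trivializationAt' q))
        (trivializationAt_PL_self q w))
  have h3 : ∀ w : EuclideanSpace ℝ (Fin D), (g (extChartAt (𝓡 D) q q, w)).2 =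
      (momentum L (⟨q, w⟩ : PL D Q) : EuclideanSpace ℝ (Fin D) →L[ℝ] ℝ) := fun w => by
    rw [← h2, hg, Function.comp_apply, Function.comp_apply, PartialEquiv.left_inv]
    · rw [extChartAt_totalSpace (IB := 𝓡 D)]
      refine (trivializationAt_PC_snd q _ (mem_extChartAt_source q)).trans ?_
      change (rawCovector (fibreDeriv L ⟨q, w⟩)).comp
        (symmDeriv (𝓡 D) q (extChartAt (𝓡 D) q q)) = _
      rw [symmDeriv_self]
      rfl
    · refine mem_extChartAt_source_totalSpace.2 ⟨?_, mem_extChartAt_source (I := 𝓡 D) q⟩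
      exact FiberBundle.mem_baseSet_trivializationAt' q
  have h4 : DifferentiableAt ℝ g (extChartAt (𝓡 D) q q, w₀) := by
    rw [← h2]
    exact (contDiffAt_writtenInChart (mem_extChartAt_source u) (mem_extChartAt_source _)
      (h u)).differentiableAt (by simp)
  have h5 : HasFDerivAt (fun w : EuclideanSpace ℝ (Fin D) => (extChartAt (𝓡 D) q q, w))
      (ContinuousLinearMap.inr ℝ (EuclideanSpace ℝ (Fin D)) (EuclideanSpace ℝ (Fin D))) w₀ :=
    hasFDerivAt_prodMk_right _ _
  have h6 := (h4.hasFDerivAt.comp w₀ h5).snd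
  let p : EuclideanSpace ℝ (Fin D) → EuclideanSpace ℝ (Fin D) →L[ℝ] ℝ :=
    fun w => momentum L (⟨q, w⟩ : PL D Q)
  have h7 : HasFDerivAt p _ w₀ := h6.congr_of_eventuallyEq (.of_forall fun w => (h3 w).symm)
  have h8 : rawHessian L u = fderiv ℝ p w₀ := rfl
  rw [h8, h7.fderiv]
  have h9 : fderiv ℝ g (extChartAt (𝓡 D) q q, w₀) = rawDeriv (IL D) (IC D) (fibreDeriv L) u := by
    rw [← h2]
    exact h1
  rw [h9]
  rfl

/-- A vector killed by `T𝓛` is vertical because `𝓛` covers the identity, and on vertical vectors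
`T𝓛` is the Hessian. -/
theorem ker_rawDeriv_fibreDeriv (h : ContMDiff (IL D) (IC D) ∞ (fibreDeriv L)) (u : PL D Q) :
    LinearMap.ker (rawDeriv (IL D) (IC D) (fibreDeriv L) u).toLinearMap =
      (LinearMap.ker (rawHessian L u).toLinearMap).map (LinearMap.inr ℝ _ _) := by
  ext v
  simp only [LinearMap.mem_ker, ContinuousLinearMap.coe_coe, Submodule.mem_map]
  constructor
  · intro hv
    have h1 : v.1 = 0 := by rw [← rawDeriv_fibreDeriv_fst h u, hv]; rfl
    have h2 : v = (0, v.2) := Prod.ext h1 rfl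
    refine ⟨v.2, ?_, h2.symm⟩
    rw [← rawDeriv_fibreDeriv_inr h, ← h2, hv]
    rfl
  · rintro ⟨b, hb, rfl⟩
    exact Prod.ext (rawDeriv_fibreDeriv_fst h u (0, b)) ((rawDeriv_fibreDeriv_inr h u b).trans hb)

theorem finrank_ker_rawDeriv_fibreDeriv (h : ContMDiff (IL D) (IC D) ∞ (fibreDeriv L))
    (u : PL D Q) :
    Module.finrank ℝ (LinearMap.ker (rawDeriv (IL D) (IC D) (fibreDeriv L) u).toLinearMap) =
      Module.finrank ℝ (LinearMap.ker (rawHessian L u).toLinearMap) := by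
  rw [ker_rawDeriv_fibreDeriv h]
  exact (Submodule.equivMapOfInjective _ LinearMap.inr_injective _).finrank_eq.symm

/-- Vertical vectors in the kernel of the Lagrange form are killed by the fibre derivative. -/
theorem rawDeriv_eq_zero_of_mem_spaceG (h : ContMDiff (IL D) (IC D) ∞ (fibreDeriv L))
    {u : PL D Q} {v : LModel D} (hv : (show TangentSpace (IL D) u from v) ∈ spaceG L u) :
    rawDeriv (IL D) (IC D) (fibreDeriv L) u v = 0 := by
  have h1 : v.1 = 0 := mem_vertical.1 hv.1
  have h2 := (mem_rawKerOmega h).1 (show v ∈ rawKerOmega L u from hv.2)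
  have h3 := rawDeriv_fibreDeriv_fst h u v
  refine Prod.ext (h3.trans h1) ?_
  refine ContinuousLinearMap.ext fun w => ?_
  -- As `T𝓛 v` has no horizontal part, its pairing with `T𝓛 (w, 0)` is just minus its momentum part
  -- evaluated at `w`.
  have h4 := h2 (w, 0)
  rw [modelFlat_apply, rawDeriv_fibreDeriv_fst h, rawDeriv_fibreDeriv_fst h, h1, map_zero,
    zero_sub, neg_eq_zero] at h4
  exact h4

end FibreDeriv

end SingularLagrangian

/-! ### Immersions and submersions -/

namespace Manifold

section Immersion

variable {E E' : Type*} [NormedAddCommGroup E] [NormedSpace ℝ E] [NormedAddCommGroup E']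
  [NormedSpace ℝ E'] {H G : Type*} [TopologicalSpace H] [TopologicalSpace G]
  {I : ModelWithCorners ℝ E H} {J : ModelWithCorners ℝ E' G} [I.Boundaryless] [J.Boundaryless]
  {M N : Type*} [TopologicalSpace M] [ChartedSpace H M] [IsManifold I ∞ M]
  [TopologicalSpace N] [ChartedSpace G N] [IsManifold J ∞ N]

open ManifoldForm

theorem contMDiffAt_extend_symm {e : OpenPartialHomeomorph M H}
    (he : e ∈ IsManifold.maximalAtlas I ∞ M) {y : E} (hy : y ∈ (e.extend I).target) :
    ContMDiffAt 𝓘(ℝ, E) I ∞ (e.extend I).symm y := by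
  have h1 := contMDiffOn_extend_symm he
  rw [← e.extend_target'] at h1
  exact h1.contMDiffAt (e.isOpen_extend_target.mem_nhds hy)

/-- The linear maps `d(e.extend J)` are surjective. -/
theorem rawDeriv_extend_surjective {e : OpenPartialHomeomorph N G}
    (he : e ∈ IsManifold.maximalAtlas J ∞ N) {y : N} (hy : y ∈ e.source) :
    Function.Surjective (rawDeriv J 𝓘(ℝ, E') (e.extend J) y) := by
  have hy' : y ∈ (e.extend J).source := by rwa [e.extend_source]
  have h1 := (e.contMDiffAt_extend he hy).mdifferentiableAt (by simp)
  have hz := (e.extend J).map_source hy'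
  have h2 := (contMDiffAt_extend_symm he hz).mdifferentiableAt (by simp)
  have h1' : MDifferentiableAt J 𝓘(ℝ, E') (e.extend J) ((e.extend J).symm (e.extend J y)) := by
    rwa [(e.extend J).left_inv hy']
  have h3 := mfderiv_comp (e.extend J y) h1' h2
  have h4 : (e.extend J ∘ (e.extend J).symm) =ᶠ[𝓝 (e.extend J y)] id :=
    Filter.eventuallyEq_of_mem (e.isOpen_extend_target.mem_nhds hz)
      fun z hz => (e.extend J).right_inv hz
  rw [h4.mfderiv_eq, mfderiv_id, (e.extend J).left_inv hy'] at h3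
  exact fun v => ⟨mfderiv 𝓘(ℝ, E') J (e.extend J).symm (e.extend J y) v,
    (DFunLike.congr_fun h3 v).symm⟩

/-- Near a point, the range of an embedded immersion is cut out by independent functions. -/
theorem IsImmersionAt.exists_defining_functions [FiniteDimensional ℝ E'] {f : M → N} {x : M}
    (h : IsImmersionAt I J ∞ f x) (hf : Topology.IsInducing f) :
    ∃ (c : ℕ) (V : Set N) (γ : Fin c → N → ℝ), IsOpen V ∧ f x ∈ V ∧
      Module.finrank ℝ E + c = Module.finrank ℝ E' ∧ (∀ n, ContMDiffOn J 𝓘(ℝ, ℝ) ∞ (γ n) V) ∧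
      (∀ y ∈ V, LinearIndependent ℝ fun n => rawDeriv J 𝓘(ℝ, ℝ) (γ n) y) ∧
      Set.range f ∩ V = {y | y ∈ V ∧ ∀ n, γ n y = 0} := by
  -- Embeddedness enters here: `f ⁻¹' W` is exactly the domain chart's source, so inside `W` no
  -- other sheet of the image appears.
  obtain ⟨W, hW, hWs⟩ := hf.isOpen_iff.1 h.domChart.open_source
  have hEf : FiniteDimensional ℝ (E × h.complement) :=
    h.equiv.symm.toLinearEquiv.finiteDimensional
  have hE : FiniteDimensional ℝ E :=
    Module.Finite.of_surjective (LinearMap.fst ℝ E h.complement) LinearMap.fst_surjective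
  have hc : FiniteDimensional ℝ h.complement :=
    Module.Finite.of_surjective (LinearMap.snd ℝ E h.complement) LinearMap.snd_surjective
  let b := Module.finBasis ℝ h.complement
  -- In the adapted charts `f` is `x ↦ (x, 0)`; the defining functions are the coordinates of the
  -- complementary component.
  let Φ : N → E × h.complement := fun y => h.equiv.symm (h.codChart.extend J y)
  let ℓ : Fin (Module.finrank ℝ h.complement) → E' →L[ℝ] ℝ := fun n =>
    ((LinearMap.toContinuousLinearMap (b.coord n)).comp
      (ContinuousLinearMap.snd ℝ E h.complement)).comp h.equiv.symm.toContinuousLinearMap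
  let γ : Fin (Module.finrank ℝ h.complement) → N → ℝ := fun n y => ℓ n (h.codChart.extend J y)
  have hΦf : ∀ x' ∈ h.domChart.source, Φ (f x') = (h.domChart.extend I x', 0) := fun x' hx' => by
    have hx'' : x' ∈ (h.domChart.extend I).source := by rwa [h.domChart.extend_source]
    have := h.writtenInCharts ((h.domChart.extend I).map_source hx'')
    simp only [Function.comp_apply, (h.domChart.extend I).left_inv hx''] at this
    simp only [Φ, this, ContinuousLinearEquiv.symm_apply_apply]
  have hγ0 : ∀ y, (∀ n, γ n y = 0) ↔ (Φ y).2 = 0 := fun y => by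
    rw [← b.forall_coord_eq_zero_iff]
    rfl
  have hΦc : ContinuousOn (fun y => (Φ y).1) h.codChart.source :=
    (continuous_fst.comp h.equiv.symm.continuous).comp_continuousOn
      (by simpa only [OpenPartialHomeomorph.extend_source] using
        h.codChart.continuousOn_extend (I := J))
  -- The preimage condition guarantees that the first component of a zero of all `γ n` lies in the
  -- image of the domain chart, so that it lifts to a point of `M`.
  let V : Set N := (h.codChart.source ∩ (fun y => (Φ y).1) ⁻¹' (h.domChart.extend I).target) ∩ W
  have hγs : ∀ n, ∀ y ∈ h.codChart.source, ContMDiffAt J 𝓘(ℝ, ℝ) ∞ (γ n) y := fun n y hy =>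
    (ℓ n).contDiff.contMDiff.contMDiffAt.comp y
      (h.codChart.contMDiffAt_extend h.codChart_mem_maximalAtlas hy)
  refine ⟨_, V, γ, (hΦc.isOpen_inter_preimage h.codChart.open_source
    h.domChart.isOpen_extend_target).inter hW, ⟨⟨h.mem_codChart_source, ?_⟩, ?_⟩, ?_, ?_, ?_, ?_⟩
  · change (Φ (f x)).1 ∈ (h.domChart.extend I).target
    rw [hΦf x h.mem_domChart_source]
    exact (h.domChart.extend I).map_source (by rw [h.domChart.extend_source]; exact h.mem_domChart_source)
  · have := h.mem_domChart_source
    rwa [← hWs] at this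
  · rw [← Module.finrank_prod]
    exact h.equiv.toLinearEquiv.finrank_eq
  · exact fun n y hy => (hγs n y hy.1.1).contMDiffWithinAt
  · intro y hy
    have h1 : ∀ n v, rawDeriv J 𝓘(ℝ, ℝ) (γ n) y v =
        ℓ n (rawDeriv J 𝓘(ℝ, E') (h.codChart.extend J) y v) := fun n v => by
      have h2 := mfderiv_comp y (ℓ n).mdifferentiableAt
        ((h.codChart.contMDiffAt_extend h.codChart_mem_maximalAtlas hy.1.1).mdifferentiableAt
          (by simp))
      refine (DFunLike.congr_fun h2 v).trans ?_
      rw [ContinuousLinearMap.mfderiv_eq]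
      rfl
    have h3 := rawDeriv_extend_surjective h.codChart_mem_maximalAtlas hy.1.1
    choose v hv using fun m => h3 (h.equiv (0, b m))
    rw [Fintype.linearIndependent_iff]
    intro a ha m
    have h4 := DFunLike.congr_fun ha (v m)
    rw [sum_apply] at h4
    simp only [smul_apply, h1, hv] at h4
    have h5 : ∀ n, ℓ n (h.equiv (0, b m)) = if m = n then 1 else 0 := fun n => by
      simp [ℓ, Finsupp.single_apply]
    simpa [h5] using h4
  · ext y
    constructor
    · rintro ⟨⟨x', rfl⟩, hy⟩
      have hx' : x' ∈ h.domChart.source := by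
        rw [← hWs]; exact hy.2
      exact ⟨hy, (hγ0 _).2 (by rw [hΦf x' hx'])⟩
    · rintro ⟨hy, hy0⟩
      refine ⟨⟨(h.domChart.extend I).symm (Φ y).1, ?_⟩, hy⟩
      have hx' : (h.domChart.extend I).symm (Φ y).1 ∈ h.domChart.source := by
        rw [← h.domChart.extend_source (I := I)]
        exact (h.domChart.extend I).map_target hy.1.2
      have h6 := hΦf _ hx'
      rw [(h.domChart.extend I).right_inv hy.1.2, ← (hγ0 y).1 hy0] at h6
      have h7 : h.codChart.extend J (f ((h.domChart.extend I).symm (Φ y).1)) =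
        h.codChart.extend J y := h.equiv.symm.injective h6
      refine (h.codChart.extend J).injOn ?_ ?_ h7
      · rw [h.codChart.extend_source]
        exact h.source_subset_preimage_source hx'
      · rw [h.codChart.extend_source]
        exact hy.1.1

end Immersion

section Composition

variable {E₁ E E' : Type*} [NormedAddCommGroup E₁] [NormedSpace ℝ E₁] [NormedAddCommGroup E]
  [NormedSpace ℝ E] [NormedAddCommGroup E']
  [NormedSpace ℝ E'] {H₁ H G : Type*} [TopologicalSpace H₁] [TopologicalSpace H]
  [TopologicalSpace G] {I₁ : ModelWithCorners ℝ E₁ H₁} [I₁.Boundaryless]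
  {I : ModelWithCorners ℝ E H} {J : ModelWithCorners ℝ E' G} [I.Boundaryless] [J.Boundaryless]
  {M₁ M N : Type*} [TopologicalSpace M₁] [ChartedSpace H₁ M₁] [IsManifold I₁ ∞ M₁]
  [TopologicalSpace M] [ChartedSpace H M] [IsManifold I ∞ M]
  [TopologicalSpace N] [ChartedSpace G N] [IsManifold J ∞ N]

open ManifoldForm

theorem finrank_le_of_factorization {V W₁ W₂ : Type*} [AddCommGroup V] [Module ℝ V]
    [AddCommGroup W₁] [Module ℝ W₁] [FiniteDimensional ℝ W₁] [AddCommGroup W₂] [Module ℝ W₂]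
    [FiniteDimensional ℝ W₂]
    (a : V →ₗ[ℝ] W₁) (T : W₁ →ₗ[ℝ] W₂) (r : W₂ →ₗ[ℝ] V) (h : ∀ v, r (T (a v)) = v) :
    Module.finrank ℝ V ≤ Module.finrank ℝ (LinearMap.range T) := by
  have h1 : Function.Injective (T.rangeRestrict ∘ₗ a) := fun v w hvw => by
    have h2 : T (a v) = T (a w) := congrArg Subtype.val hvw
    rw [← h v, ← h w, h2]
  exact LinearMap.finrank_le_finrank_of_injective h1

/-- The rank of a submersion followed by an immersion is at least the dimension of the manifold
in the middle. -/
theorem IsImmersionAt.finrank_le_finrank_range_comp [FiniteDimensional ℝ E₁]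
    [FiniteDimensional ℝ E'] {g : M₁ → M} {f : M → N} {x : M₁}
    (hf : IsImmersionAt I J ∞ f (g x)) (hg : IsSubmersionAt I₁ I ∞ g x) :
    Module.finrank ℝ E ≤
      Module.finrank ℝ (LinearMap.range (rawDeriv I₁ J (f ∘ g) x).toLinearMap) := by
  have hx : x ∈ (hg.domChart.extend I₁).source := by
    rw [hg.domChart.extend_source]; exact hg.mem_domChart_source
  have hgx : g x ∈ (hg.codChart.extend I).source := by
    rw [hg.codChart.extend_source]; exact hg.mem_codChart_source
  have hgx' : g x ∈ (hf.domChart.extend I).source := by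
    rw [hf.domChart.extend_source]; exact hf.mem_domChart_source
  let y₀ : E := hg.codChart.extend I (g x)
  let e₀ := hg.equiv (hg.domChart.extend I₁ x)
  have he₀ : e₀.1 = y₀ := by
    have := hg.writtenInCharts ((hg.domChart.extend I₁).map_source hx)
    simp only [Function.comp_apply, (hg.domChart.extend I₁).left_inv hx] at this
    exact this.symm
  -- In the normal form of the submersion `g`, freezing the complementary coordinate at its value at
  -- `x` yields a local section `s` through `x`.
  let a : E → E₁ := fun y => hg.equiv.symm (y, e₀.2)
  have ha₀ : a y₀ = hg.domChart.extend I₁ x := by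
    simp [a, ← he₀, e₀]
  have ha : ContDiff ℝ ∞ a := hg.equiv.symm.contDiff.comp (contDiff_id.prodMk contDiff_const)
  have hat : a y₀ ∈ (hg.domChart.extend I₁).target := by
    rw [ha₀]; exact (hg.domChart.extend I₁).map_source hx
  let s : E → M₁ := (hg.domChart.extend I₁).symm ∘ a
  have hs₀ : s y₀ = x := by
    change (hg.domChart.extend I₁).symm (a y₀) = x
    rw [ha₀, (hg.domChart.extend I₁).left_inv hx]
  have hs : ContMDiffAt 𝓘(ℝ, E) I₁ ∞ s y₀ :=
    (contMDiffAt_extend_symm hg.domChart_mem_maximalAtlas hat).comp y₀ ha.contMDiff.contMDiffAt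
  have hgs : ∀ᶠ y in 𝓝 y₀, g (s y) = (hg.codChart.extend I).symm y := by
    filter_upwards [ha.continuous.continuousAt.preimage_mem_nhds
      (hg.domChart.isOpen_extend_target.mem_nhds hat)] with y hy
    have h1 := hg.writtenInCharts hy
    have h2 : s y ∈ hg.domChart.source := by
      rw [← hg.domChart.extend_source (I := I₁)]
      exact (hg.domChart.extend I₁).map_target hy
    have h3 : g (s y) ∈ (hg.codChart.extend I).source := by
      rw [hg.codChart.extend_source]; exact hg.source_subset_preimage_source h2
    have h4 : hg.codChart.extend I (g (s y)) = y := by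
      refine Eq.trans h1 ?_
      simp [a]
    rw [← h4, (hg.codChart.extend I).left_inv h3, h4]
  -- In the normal form of the immersion, the first component is a local left inverse of `f`. After
  -- a change of chart, `p ∘ (f ∘ g) ∘ s` is the identity near `y₀`, so the identity of `E` factors
  -- through `d(f ∘ g)`.
  let q : N → E := fun z => (hf.equiv.symm (hf.codChart.extend J z)).1
  have hq : ContMDiffAt J 𝓘(ℝ, E) ∞ q (f (g x)) :=
    ((contDiff_fst.comp hf.equiv.symm.contDiff).contMDiff.contMDiffAt).comp _
      (hf.codChart.contMDiffAt_extend hf.codChart_mem_maximalAtlas hf.mem_codChart_source)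
  have hqf : ∀ x' ∈ hf.domChart.source, q (f x') = hf.domChart.extend I x' := fun x' hx' => by
    have hx'' : x' ∈ (hf.domChart.extend I).source := by rwa [hf.domChart.extend_source]
    have := hf.writtenInCharts ((hf.domChart.extend I).map_source hx'')
    simp only [Function.comp_apply, (hf.domChart.extend I).left_inv hx''] at this
    simp only [q, this, ContinuousLinearEquiv.symm_apply_apply]
  let p : N → E := hg.codChart.extend I ∘ (hf.domChart.extend I).symm ∘ q
  have hqx : q (f (g x)) = hf.domChart.extend I (g x) := hqf _ hf.mem_domChart_source
  have hp : ContMDiffAt J 𝓘(ℝ, E) ∞ p (f (g x)) := by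
    refine ContMDiffAt.comp (I' := I) (f (g x)) ?_ (ContMDiffAt.comp (I' := 𝓘(ℝ, E)) _ ?_ hq)
    · have : ((hf.domChart.extend I).symm ∘ q) (f (g x)) = g x := by
        rw [Function.comp_apply, hqx, (hf.domChart.extend I).left_inv hgx']
      rw [this]
      exact hg.codChart.contMDiffAt_extend hg.codChart_mem_maximalAtlas hg.mem_codChart_source
    · rw [hqx]
      exact contMDiffAt_extend_symm hf.domChart_mem_maximalAtlas
        ((hf.domChart.extend I).map_source hgx')
  have hpfg : (p ∘ (f ∘ g) ∘ s) =ᶠ[𝓝 y₀] id := by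
    have h1 : ContinuousAt (hg.codChart.extend I).symm y₀ :=
      (contMDiffAt_extend_symm hg.codChart_mem_maximalAtlas
        ((hg.codChart.extend I).map_source hgx)).continuousAt
    have h2 : (hg.codChart.extend I).symm y₀ ∈ hf.domChart.source := by
      rw [(hg.codChart.extend I).left_inv hgx]
      exact hf.mem_domChart_source
    filter_upwards [hgs, h1.preimage_mem_nhds (hf.domChart.open_source.mem_nhds h2),
      hg.codChart.isOpen_extend_target.mem_nhds ((hg.codChart.extend I).map_source hgx)]
      with y hy1 hy2 hy3
    have hy4 : (hg.codChart.extend I).symm y ∈ (hf.domChart.extend I).source := by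
      rwa [hf.domChart.extend_source]
    simp only [p, Function.comp_apply, hy1, id]
    rw [hqf _ hy2, (hf.domChart.extend I).left_inv hy4, (hg.codChart.extend I).right_inv hy3]
  have hfg : ContMDiffAt I₁ J ∞ (f ∘ g) x := hf.contMDiffAt.comp x hg.contMDiffAt
  have h1 : MDifferentiableAt I₁ J (f ∘ g) (s y₀) := by
    rw [hs₀]; exact hfg.mdifferentiableAt (by simp)
  have h2 : MDifferentiableAt J 𝓘(ℝ, E) p (((f ∘ g) ∘ s) y₀) := by
    rw [Function.comp_apply, hs₀]; exact hp.mdifferentiableAt (by simp)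
  have h3 := mfderiv_comp y₀ h1 (hs.mdifferentiableAt (by simp))
  have h4 := mfderiv_comp y₀ h2 (h1.comp y₀ (hs.mdifferentiableAt (by simp)))
  rw [hpfg.mfderiv_eq, mfderiv_id, h3, hs₀] at h4
  exact finrank_le_of_factorization (rawDeriv 𝓘(ℝ, E) I₁ s y₀).toLinearMap
    (rawDeriv I₁ J (f ∘ g) x).toLinearMap
    (rawDeriv J 𝓘(ℝ, E) p (((f ∘ g) ∘ s) y₀)).toLinearMap
    fun v => (DFunLike.congr_fun h4 v).symm

end Composition

end Manifold

/-! ### Related vector fields -/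

/-- Differentiate `Dg(V) = 0` along `W` and `Dg(W) = X ∘ g` along `V`. Subtracting the two, the
second derivatives of `g` cancel by symmetry, and the derivative of `X ∘ g` along `V` vanishes
because `Dg(V) = 0`. -/
theorem fderiv_apply_lieBracket_eq_zero {E F : Type*} [NormedAddCommGroup E] [NormedSpace ℝ E]
    [NormedAddCommGroup F] [NormedSpace ℝ F] {g : E → F} {V W : E → E} {X : F → F} {y : E}
    (hg : ContDiffAt ℝ ∞ g y) (hV : DifferentiableAt ℝ V y) (hW : DifferentiableAt ℝ W y)
    (hX : DifferentiableAt ℝ X (g y)) (hgV : ∀ᶠ z in 𝓝 y, fderiv ℝ g z (V z) = 0)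
    (hgW : ∀ᶠ z in 𝓝 y, fderiv ℝ g z (W z) = X (g z)) :
    fderiv ℝ g y (VectorField.lieBracket ℝ V W y) = 0 := by
  have hg' : DifferentiableAt ℝ g y := hg.differentiableAt (by simp)
  have hg2 : DifferentiableAt ℝ (fderiv ℝ g) y :=
    (hg.fderiv_right (m := 1) (by norm_cast)).differentiableAt (by simp)
  have h1 : HasFDerivAt (fun z => fderiv ℝ g z (V z)) _ y := hg2.hasFDerivAt.clm_apply hV.hasFDerivAt
  have h2 : HasFDerivAt (fun z => fderiv ℝ g z (W z)) _ y := hg2.hasFDerivAt.clm_apply hW.hasFDerivAt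
  have h3 : HasFDerivAt (fun z => fderiv ℝ g z (V z)) (0 : E →L[ℝ] F) y :=
    (hasFDerivAt_const (0 : F) y).congr_of_eventuallyEq hgV
  have h4 : HasFDerivAt (fun z => fderiv ℝ g z (W z)) _ y :=
    (hX.hasFDerivAt.comp y hg'.hasFDerivAt).congr_of_eventuallyEq hgW
  have h5 := DFunLike.congr_fun (h1.unique h3) (W y)
  have h6 := DFunLike.congr_fun (h2.unique h4) (V y)
  have hsymm : IsSymmSndFDerivAt ℝ g y := hg.isSymmSndFDerivAt (by
    rw [minSmoothness_of_isRCLikeNormedField]; exact ENat.LEInfty.out)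
  have h7 := hsymm.eq (V y) (W y)
  have h8 := hgV.self_of_nhds
  simp only [add_apply, ContinuousLinearMap.comp_apply,
    ContinuousLinearMap.flip_apply, zero_apply, h8, map_zero] at h5 h6
  rw [VectorField.lieBracket, map_sub]
  have h9 : fderiv ℝ g y (fderiv ℝ W y (V y)) = -(fderiv ℝ (fderiv ℝ g) y (V y)) (W y) :=
    eq_neg_of_add_eq_zero_left h6
  have h10 : fderiv ℝ g y (fderiv ℝ V y (W y)) = -(fderiv ℝ (fderiv ℝ g) y (W y)) (V y) :=
    eq_neg_of_add_eq_zero_left h5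
  rw [h9, h10, h7, sub_self]

namespace ManifoldForm

section VectorField

variable {F : Type*} [NormedAddCommGroup F] [NormedSpace ℝ F] {H : Type*} [TopologicalSpace H]
  {I : ModelWithCorners ℝ F H} {M : Type*} [TopologicalSpace M] [ChartedSpace H M]
  {F' : Type*} [NormedAddCommGroup F'] [NormedSpace ℝ F'] {H' : Type*} [TopologicalSpace H']
  {I' : ModelWithCorners ℝ F' H'} {M' : Type*} [TopologicalSpace M'] [ChartedSpace H' M']
  [I.Boundaryless] [I'.Boundaryless] [IsManifold I ∞ M] [IsManifold I' ∞ M']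

variable (I) in
/-- A vector field, given by its values in the model space, is smooth at a point. -/
def FieldSmoothAt (X : M → F) (x : M) : Prop :=
  ContMDiffAt I I.tangent ∞ (fun x' => (⟨x', X x'⟩ : TangentBundle I M)) x

variable (I) in
/-- The expression of a vector field in the chart at `x₀`. -/
def fieldRep (X : M → F) (x₀ : M) (y : F) : F :=
  chartDeriv I x₀ ((extChartAt I x₀).symm y) (X ((extChartAt I x₀).symm y))

theorem fieldRep_chart (X : M → F) {x₀ x : M} (hx : x ∈ (extChartAt I x₀).source) :
    fieldRep I X x₀ (extChartAt I x₀ x) = chartDeriv I x₀ x (X x) := by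
  rw [fieldRep, (extChartAt I x₀).left_inv hx]

theorem fieldSmoothAt_iff {X : M → F} {x₀ x : M} (hx : x ∈ (extChartAt I x₀).source) :
    FieldSmoothAt I X x ↔ ContMDiffAt I 𝓘(ℝ, F) ∞ (fun x' => chartDeriv I x₀ x' (X x')) x := by
  have := isManifold_one I M
  have hbase : ∀ x' ∈ (extChartAt I x₀).source,
      x' ∈ (trivializationAt F (TangentSpace I) x₀).baseSet := fun x' hx' => by
    rwa [TangentBundle.trivializationAt_baseSet, ← extChartAt_source (I := I)]
  have h1 := (trivializationAt F (TangentSpace I) x₀).contMDiffAt_section_iff (n := ∞)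
    (IB := I) (E := (TangentSpace I : M → Type _)) (s := fun x' => (X x' : TangentSpace I x')) (hbase x hx)
  refine h1.trans (Filter.EventuallyEq.contMDiffAt_iff ?_)
  filter_upwards [eventually_mem_source hx] with x' hx'
  have h2 := TangentBundle.continuousLinearMapAt_trivializationAt (I := I) (x₀ := x₀) (x := x')
    (by simpa using hx')
  refine Eq.trans ?_ (DFunLike.congr_fun h2 (X x'))
  symm
  exact ((trivializationAt F (TangentSpace I) x₀).linearMapAt_apply
    (R := ℝ) _).trans (if_pos (hbase x' hx'))

theorem fieldSmoothAt_iff_fieldRep {X : M → F} {x₀ x : M} (hx : x ∈ (extChartAt I x₀).source) :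
    FieldSmoothAt I X x ↔ ContDiffAt ℝ ∞ (fieldRep I X x₀) (extChartAt I x₀ x) := by
  rw [fieldSmoothAt_iff hx]
  refine ⟨fun h => contDiffAt_comp_chart_symm hx h, fun h => ?_⟩
  refine (contMDiffAt_comp_chart hx h).congr_of_eventuallyEq ?_
  filter_upwards [eventually_mem_source hx] with x' hx'
  exact (fieldRep_chart X hx').symm

/-- The Lie bracket with values in the model space. -/
theorem mlieBracket_eq_lieBracket_fieldRep {V W : M → F} {x : M} :
    ((VectorField.mlieBracket I V W x : TangentSpace I x) : F) =
      VectorField.lieBracket ℝ (fieldRep I V x) (fieldRep I W x) (extChartAt I x x) := by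
  have := isManifold_one I M
  let p : (M → F) → F → F := fun X y =>
    VectorField.mpullbackWithin 𝓘(ℝ, F) I (extChartAt I x).symm X (Set.range I) y
  have h1 : ∀ X : M → F, p X =ᶠ[𝓝 (extChartAt I x x)] fieldRep I X x := fun X => by
    refine eventually_nhds_chart (mem_extChartAt_source x) (.of_forall fun x' hx' => ?_)
    change (symmDeriv I x (extChartAt I x x')).inverse (X ((extChartAt I x).symm (extChartAt I x x')))
      = _
    rw [fieldRep_chart X hx', (extChartAt I x).left_inv hx']
    congr 1
    refine ContinuousLinearMap.inverse_eq ?_ ?_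
    · ext v
      exact symmDeriv_chartDeriv hx' v
    · ext v
      exact chartDeriv_symmDeriv hx' v
  have h2 : ((VectorField.mlieBracket I V W x : TangentSpace I x) : F) =
      (chartDeriv I x x).inverse (VectorField.lieBracketWithin ℝ (p V) (p W)
        ((extChartAt I x).symm ⁻¹' Set.univ ∩ Set.range I) (extChartAt I x x)) :=
    VectorField.mlieBracketWithin_apply
  rw [h2, chartDeriv_self, ContinuousLinearMap.inverse_id, Set.preimage_univ, Set.univ_inter,
    I.range_eq_univ, VectorField.lieBracketWithin_univ]
  exact (h1 V).lieBracket_vectorField_eq (h1 W)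

/-- `V` is `f`-related to `0` and `W` to `X`, so the bracket is `f`-related to `[0, X] = 0`. -/
theorem rawDeriv_mlieBracket_eq_zero {f : M → M'} {V W : M → F} {X : M' → F'} {x : M}
    (hf : ∀ᶠ x' in 𝓝 x, ContMDiffAt I I' ∞ f x')
    (hV : FieldSmoothAt I V x) (hW : FieldSmoothAt I W x) (hX : FieldSmoothAt I' X (f x))
    (hfV : ∀ᶠ x' in 𝓝 x, rawDeriv I I' f x' (V x') = 0)
    (hfW : ∀ᶠ x' in 𝓝 x, rawDeriv I I' f x' (W x') = X (f x')) :
    rawDeriv I I' f x (VectorField.mlieBracket I V W x) = 0 := by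
  have hx := mem_extChartAt_source (I := I) x
  have hs := mem_extChartAt_source (I := I') (f x)
  set g := extChartAt I' (f x) ∘ f ∘ (extChartAt I x).symm with hg
  have hgx : ∀ x' ∈ (extChartAt I x).source, g (extChartAt I x x') = extChartAt I' (f x) (f x') :=
    fun x' hx' => by rw [hg, Function.comp_apply, Function.comp_apply, (extChartAt I x).left_inv hx']
  have hfs : ∀ᶠ x' in 𝓝 x, f x' ∈ (extChartAt I' (f x)).source :=
    hf.self_of_nhds.continuousAt.eventually (eventually_mem_source hs)
  have h1 : fderiv ℝ g (extChartAt I x x) = rawDeriv I I' f x := by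
    rw [hg, fderiv_writtenInChart hx hs (hf.self_of_nhds.mdifferentiableAt (by simp)),
      chartDeriv_self, symmDeriv_self]
    rfl
  have h2 : ∀ (Z : M → F) (x' : M), x' ∈ (extChartAt I x).source →
      f x' ∈ (extChartAt I' (f x)).source → ContMDiffAt I I' ∞ f x' →
      fderiv ℝ g (extChartAt I x x') (fieldRep I Z x (extChartAt I x x')) =
        chartDeriv I' (f x) (f x') (rawDeriv I I' f x' (Z x')) := fun Z x' h1 h2 h3 => by
    rw [hg, fderiv_writtenInChart h1 h2 (h3.mdifferentiableAt (by simp)), fieldRep_chart Z h1,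
      ContinuousLinearMap.comp_apply, ContinuousLinearMap.comp_apply, symmDeriv_chartDeriv h1]
  rw [← h1, mlieBracket_eq_lieBracket_fieldRep]
  refine fderiv_apply_lieBracket_eq_zero (X := fieldRep I' X (f x))
    (contDiffAt_writtenInChart hx hs hf.self_of_nhds)
    (((fieldSmoothAt_iff_fieldRep hx).1 hV).differentiableAt (by simp))
    (((fieldSmoothAt_iff_fieldRep hx).1 hW).differentiableAt (by simp)) ?_ ?_ ?_
  · rw [hgx x hx]
    exact ((fieldSmoothAt_iff_fieldRep hs).1 hX).differentiableAt (by simp)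
  · refine eventually_nhds_chart hx ?_
    filter_upwards [hf, hfs, hfV] with x' h3 h4 h5 h6
    rw [h2 V x' h6 h4 h3, h5, map_zero]
  · refine eventually_nhds_chart hx ?_
    filter_upwards [hf, hfs, hfW] with x' h3 h4 h5 h6
    rw [h2 W x' h6 h4 h3, h5, hgx x' h6, fieldRep_chart X h4]

/-- Local solvability of `df(P) = X ∘ f`. -/
theorem exists_local_field [FiniteDimensional ℝ F] [FiniteDimensional ℝ F'] {f : M → M'}
    {X : M' → F'} {N : ℕ} {W : Set M} (hW : IsOpen W) (hf : ∀ x ∈ W, ContMDiffAt I I' ∞ f x)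
    (hN : ∀ x ∈ W, Module.finrank ℝ (LinearMap.ker (rawDeriv I I' f x).toLinearMap) = N)
    (hX : ∀ x ∈ W, FieldSmoothAt I' X (f x)) (hmem : ∀ x ∈ W, ∃ v, rawDeriv I I' f x v = X (f x))
    {x : M} (hx : x ∈ W) :
    ∃ P : M → F, ∀ᶠ x' in 𝓝 x, FieldSmoothAt I P x' ∧ rawDeriv I I' f x' (P x') = X (f x') := by
  have hxs := mem_extChartAt_source (I := I) x
  have hs := mem_extChartAt_source (I := I') (f x)
  set g := extChartAt I' (f x) ∘ f ∘ (extChartAt I x).symm with hg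
  have hgx : ∀ x' ∈ (extChartAt I x).source, g (extChartAt I x x') = extChartAt I' (f x) (f x') :=
    fun x' hx' => by rw [hg, Function.comp_apply, Function.comp_apply, (extChartAt I x).left_inv hx']
  have hfs : ∀ᶠ x' in 𝓝 x, f x' ∈ (extChartAt I' (f x)).source :=
    (hf x hx).continuousAt.eventually (eventually_mem_source hs)
  have hWx := hW.mem_nhds hx
  have hD : ∀ x' ∈ W, x' ∈ (extChartAt I x).source → f x' ∈ (extChartAt I' (f x)).source →
      fderiv ℝ g (extChartAt I x x') = (chartDeriv I' (f x) (f x')).comp ((rawDeriv I I' f x').comp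
        (symmDeriv I x (extChartAt I x x'))) := fun x' h1 h2 h3 =>
    fderiv_writtenInChart h2 h3 ((hf x' h1).mdifferentiableAt (by simp))
  obtain ⟨b, hb, hAb⟩ := exists_contDiffAt_solution (N := N) (A := fderiv ℝ g)
    (c := fun y => fieldRep I' X (f x) (g y)) (x₀ := extChartAt I x x)
    (by
      refine eventually_nhds_chart hxs ?_
      filter_upwards [hfs, hWx] with x' h1 h2 h3
      exact (contDiffAt_writtenInChart h3 h1 (hf x' h2)).fderiv_right (by norm_num))
    (by
      refine eventually_nhds_chart hxs ?_
      filter_upwards [hfs, hWx] with x' h1 h2 h3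
      have h4 := (fieldSmoothAt_iff_fieldRep h1).1 (hX x' h2)
      rw [← hgx x' h3] at h4
      exact h4.comp _ (contDiffAt_writtenInChart h3 h1 (hf x' h2)))
    (by
      refine eventually_nhds_chart hxs ?_
      filter_upwards [hfs, hWx] with x' h1 h2 h3
      rw [← hN x' h2, hD x' h2 h3 h1]
      -- Composing with the invertible derivatives of the charts does not change the dimension of
      -- the kernel.
      let e : F ≃ₗ[ℝ] F := LinearEquiv.ofLinearMap (symmDeriv I x (extChartAt I x x')).toLinearMap
        (chartDeriv I x x').toLinearMap (LinearMap.ext fun v => symmDeriv_chartDeriv h3 v)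
        (LinearMap.ext fun v => chartDeriv_symmDeriv h3 v)
      suffices hmap : Submodule.map (e : F →ₗ[ℝ] F) (LinearMap.ker
          ((chartDeriv I' (f x) (f x')).comp ((rawDeriv I I' f x').comp
            (symmDeriv I x (extChartAt I x x')))).toLinearMap) =
          LinearMap.ker (rawDeriv I I' f x').toLinearMap by
        rw [← hmap]
        exact (e.submoduleMap _).finrank_eq
      ext v
      simp only [Submodule.mem_map, LinearMap.mem_ker, ContinuousLinearMap.coe_coe,
        ContinuousLinearMap.comp_apply]
      constructor
      · rintro ⟨w, hw, rfl⟩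
        have := congrArg (symmDeriv I' (f x) (extChartAt I' (f x) (f x'))) hw
        rw [symmDeriv_chartDeriv h1, map_zero] at this
        exact this
      · intro hv
        refine ⟨chartDeriv I x x' v, ?_, symmDeriv_chartDeriv h3 v⟩
        rw [symmDeriv_chartDeriv h3, hv, map_zero])
    (by
      refine eventually_nhds_chart hxs ?_
      filter_upwards [hfs, hWx] with x' h1 h2 h3
      obtain ⟨v, hv⟩ := hmem x' h2
      refine ⟨chartDeriv I x x' v, ?_⟩
      rw [hD x' h2 h3 h1, hgx x' h3, fieldRep_chart X h1, ContinuousLinearMap.comp_apply,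
        ContinuousLinearMap.comp_apply, symmDeriv_chartDeriv h3, hv])
  refine ⟨fun x' => symmDeriv I x (extChartAt I x x') (b (extChartAt I x x')), ?_⟩
  have hφ : ContinuousAt (extChartAt I x) x := continuousAt_extChartAt x
  filter_upwards [hfs, hWx, eventually_mem_source hxs, hφ.eventually hb, hφ.eventually hAb]
    with x' h1 h2 h3 h4 h5
  refine ⟨?_, ?_⟩
  · rw [fieldSmoothAt_iff h3]
    refine (contMDiffAt_comp_chart h3 h4).congr_of_eventuallyEq ?_
    filter_upwards [eventually_mem_source h3] with x'' h6
    exact chartDeriv_symmDeriv h6 _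
  · rw [hD x' h2 h3 h1, hgx x' h3, fieldRep_chart X h1] at h5
    have := congrArg (symmDeriv I' (f x) (extChartAt I' (f x) (f x'))) h5
    rw [symmDeriv_chartDeriv h1, ContinuousLinearMap.comp_apply, ContinuousLinearMap.comp_apply,
      symmDeriv_chartDeriv h1] at this
    exact this

theorem FieldSmoothAt.sum_smul {ι : Type*} {s : Finset ι} {ρ : ι → M → ℝ} {P : ι → M → F} {x : M}
    (h : ∀ i ∈ s, (ContMDiffAt I 𝓘(ℝ, ℝ) ∞ (ρ i) x ∧ FieldSmoothAt I (P i) x) ∨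
      ∀ᶠ x' in 𝓝 x, ρ i x' = 0) :
    FieldSmoothAt I (fun x' => ∑ i ∈ s, ρ i x' • P i x') x := by
  have hx := mem_extChartAt_source (I := I) x
  rw [fieldSmoothAt_iff hx]
  have h1 : ContMDiffAt I 𝓘(ℝ, F) ∞
      (fun x' => ∑ i ∈ s, ρ i x' • chartDeriv I x x' (P i x')) x := by
    refine contMDiffAt_finsetSum fun i hi => ?_
    rcases h i hi with h2 | h2
    · exact h2.1.smul ((fieldSmoothAt_iff hx).1 h2.2)
    · refine (contMDiffAt_const (c := (0 : F))).congr_of_eventuallyEq ?_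
      filter_upwards [h2] with x' hx'
      rw [hx', zero_smul]
  refine h1.congr_of_eventuallyEq (.of_forall fun x' => ?_)
  simp only [map_sum, map_smul]

/-- A vector field `X` along a map `f` of constant rank with values in the range of `df` has a
smooth lift. -/
theorem exists_related_field [FiniteDimensional ℝ F] [FiniteDimensional ℝ F'] [T2Space M]
    [SecondCountableTopology M] {f : M → M'}
    {X : M' → F'} {N : ℕ} {W : Set M} (hW : IsOpen W) (hf : ∀ x ∈ W, ContMDiffAt I I' ∞ f x)
    (hN : ∀ x ∈ W, Module.finrank ℝ (LinearMap.ker (rawDeriv I I' f x).toLinearMap) = N)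
    (hX : ∀ x ∈ W, FieldSmoothAt I' X (f x)) (hmem : ∀ x ∈ W, ∃ v, rawDeriv I I' f x v = X (f x)) :
    ∃ P : M → F, ∀ x ∈ W, FieldSmoothAt I P x ∧ rawDeriv I I' f x (P x) = X (f x) := by
  -- The equation for `P` is affine, so local solutions are averaged with a partition of unity.
  choose P hP using fun x : W => exists_local_field hW hf hN hX hmem x.2
  choose U hPU hUo hxU using fun x => eventually_nhds_iff.1 (hP x)
  obtain ⟨ρ, hρ⟩ := exists_partition I hUo
  refine ⟨fun x => ∑ᶠ i, ρ i x • P i x, fun x hx => ?_⟩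
  have hxU' : x ∈ ⋃ i, U i := Set.mem_iUnion.2 ⟨⟨x, hx⟩, hxU ⟨x, hx⟩⟩
  obtain ⟨h1, ⟨s, h2, h3⟩, h4⟩ := hρ x hxU'
  have h5 : ∀ᶠ x' in 𝓝 x, ∑ᶠ i, ρ i x' • P i x' = ∑ i ∈ s, ρ i x' • P i x' := by
    filter_upwards [h2] with x' hx'
    refine finsum_eq_sum_of_support_subset _ fun i hi => ?_
    by_contra his
    exact hi (by simp only [hx' i his, zero_smul])
  constructor
  · have h6 : FieldSmoothAt I (fun x' => ∑ i ∈ s, ρ i x' • P i x') x :=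
      FieldSmoothAt.sum_smul fun i _ => by
        by_cases hi : x ∈ U i
        · exact .inl ⟨h1 i, (hPU i x hi).1⟩
        · exact .inr (h4 i hi)
    refine ContMDiffAt.congr_of_eventuallyEq h6 ?_
    filter_upwards [h5] with x' hx'
    rw [hx']
  · change rawDeriv I I' f x (∑ᶠ i, ρ i x • P i x) = _
    rw [h5.self_of_nhds, map_sum]
    have h7 : ∀ i ∈ s, rawDeriv I I' f x (ρ i x • P i x) = ρ i x • X (f x) := fun i _ => by
      rw [map_smul]
      by_cases hi : x ∈ U i
      · rw [(hPU i x hi).2]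
      · rw [(h4 i hi).self_of_nhds, zero_smul, zero_smul]
    rw [Finset.sum_congr rfl h7, ← Finset.sum_smul, h3.self_of_nhds, one_smul]

end VectorField

end ManifoldForm

/-! ### One-forms as fields of covectors -/

namespace ManifoldForm

section Covector

variable {F : Type*} [NormedAddCommGroup F] [NormedSpace ℝ F] {H : Type*} [TopologicalSpace H]
  {I : ModelWithCorners ℝ F H} {M : Type*} [TopologicalSpace M] [ChartedSpace H M]

/-- The covectors of a `1`-form, on the model space. -/
def Form.covector (β : Form I M 1) (s : M) : F →L[ℝ] ℝ :=
  (ContinuousAlternatingMap.ofSubsingletonLIE (𝕜 := ℝ) (E := F) (F := ℝ) (0 : Fin 1)).symm (β.raw s)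

theorem covector_apply (β : Form I M 1) (s : M) (v : F) : β.covector s v = β.raw s fun _ => v := by
  rfl

theorem covector_dFun (f : M → ℝ) (s : M) : (dFun I f).covector s = rawDeriv I 𝓘(ℝ, ℝ) f s := rfl

theorem covector_smul (c : M → ℝ) (β : Form I M 1) (s : M) :
    Form.covector (fun s => c s • β s : Form I M 1) s = c s • β.covector s := rfl

theorem linearIndependent_covector_iff {N : ℕ} {π : Fin N → Form I M 1} {s : M} :
    (LinearIndependent ℝ fun n => π n s) ↔ LinearIndependent ℝ fun n => (π n).covector s := by
  let e := (ContinuousAlternatingMap.ofSubsingletonLIE (𝕜 := ℝ) (E := F) (F := ℝ)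
    (0 : Fin 1)).symm.toLinearEquiv
  exact (LinearMap.linearIndependent_iff e.toLinearMap (v := fun n => (π n).raw s)
    (LinearMap.ker_eq_bot.2 e.injective)).symm

theorem eq_sum_smul_iff_covector {N : ℕ} {π : Fin N → Form I M 1} {η : Form I M 1} {s : M}
    {c : Fin N → ℝ} : η s = ∑ n, c n • π n s ↔ η.covector s = ∑ n, c n • (π n).covector s := by
  let e := (ContinuousAlternatingMap.ofSubsingletonLIE (𝕜 := ℝ) (E := F) (F := ℝ)
    (0 : Fin 1)).symm.toLinearEquiv
  have h : e (∑ n, c n • (π n).raw s) = ∑ n, c n • (π n).covector s := by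
    rw [map_sum]
    exact Finset.sum_congr rfl fun n _ => map_smul e _ _
  rw [← h]
  exact e.injective.eq_iff.symm

theorem linearIndependent_toLinearMap {N : ℕ} {α : Fin N → F →L[ℝ] ℝ} :
    LinearIndependent ℝ α ↔ LinearIndependent ℝ fun n => (α n).toLinearMap :=
  (LinearMap.linearIndependent_iff (ContinuousLinearMap.coeLM ℝ) (v := α)
    (LinearMap.ker_eq_bot.2 ContinuousLinearMap.coe_injective)).symm

theorem mem_span_of_covector {N : ℕ} {π : Fin N → Form I M 1} {η : Form I M 1} {s : M}
    (h : ∀ v, (∀ n, (π n).covector s v = 0) → η.covector s v = 0) :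
    η s ∈ Submodule.span ℝ (Set.range fun n => π n s) := by
  have h1 : (η.covector s).toLinearMap ∈
      Submodule.span ℝ (Set.range fun n => ((π n).covector s).toLinearMap) := by
    refine mem_span_of_iInf_ker_le_ker fun v hv => ?_
    rw [Submodule.mem_iInf] at hv
    exact h v hv
  obtain ⟨c, hc⟩ := (Submodule.mem_span_range_iff_exists_fun ℝ).1 h1
  refine (Submodule.mem_span_range_iff_exists_fun ℝ).2 ⟨c, (eq_sum_smul_iff_covector.2 ?_).symm⟩
  ext v
  rw [← ContinuousLinearMap.coe_coe, ← hc]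
  simp

theorem exists_covector_eq_sum {N : ℕ} {π : Fin N → Form I M 1} {η : Form I M 1} {s : M}
    (h : η s ∈ Submodule.span ℝ (Set.range fun n => π n s)) :
    ∃ c : Fin N → ℝ, η.covector s = ∑ n, c n • (π n).covector s := by
  obtain ⟨c, hc⟩ := (Submodule.mem_span_range_iff_exists_fun ℝ).1 h
  exact ⟨c, eq_sum_smul_iff_covector.1 hc.symm⟩

theorem linearIndependent_covector_smul {N : ℕ} {π : Fin N → Form I M 1} {f : Fin N → M → ℝ}
    {s : M} (h : LinearIndependent ℝ fun n => (π n).covector s) (hf : ∀ n, f n s ≠ 0) :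
    LinearIndependent ℝ fun n => Form.covector (fun s => f n s • π n s : Form I M 1) s :=
  h.units_smul fun n => Units.mk0 (f n s) (hf n)

theorem chartRep_covector [I.Boundaryless] [IsManifold I ∞ M] (β : Form I M 1) {x₀ x : M}
    (hx : x ∈ (extChartAt I x₀).source) (v : F) :
    chartRep I β x₀ (extChartAt I x₀ x) (fun _ => v) =
      β.covector x (symmDeriv I x₀ (extChartAt I x₀ x) v) := by
  rw [chartRep_chart _ hx, covector_apply]
  rfl

theorem smoothAt_smul_dFun [I.Boundaryless] [IsManifold I ∞ M] [FiniteDimensional ℝ F]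
    {f γ : M → ℝ} {V : Set M} (hV : IsOpen V) (hf : ContMDiffOn I 𝓘(ℝ, ℝ) ∞ f V)
    (hγ : ContMDiffOn I 𝓘(ℝ, ℝ) ∞ γ V) {s : M} (hs : s ∈ V) :
    SmoothAt (fun s => f s • dFun I γ s : Form I M 1) s := by
  refine SmoothAt.smul (hf.contMDiffAt (hV.mem_nhds hs)) (smoothAt_dFun ?_)
  filter_upwards [hV.mem_nhds hs] with s' hs'
  exact hγ.contMDiffAt (hV.mem_nhds hs')

theorem contDiffAt_covector {X : Type*} [NormedAddCommGroup X] [NormedSpace ℝ X]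
    {σ : X → F [⋀^Fin 1]→L[ℝ] ℝ} {x : X} (h : ContDiffAt ℝ ∞ σ x) :
    ContDiffAt ℝ ∞ (fun y => (ContinuousAlternatingMap.ofSubsingletonLIE (𝕜 := ℝ) (E := F) (F := ℝ)
      (0 : Fin 1)).symm (σ y)) x :=
  (ContinuousAlternatingMap.ofSubsingletonLIE (𝕜 := ℝ) (E := F) (F := ℝ)
    (0 : Fin 1)).symm.toContinuousLinearEquiv.contDiff.contDiffAt.comp x h

theorem extD_eq_zero [I.Boundaryless] [IsManifold I ∞ M] {k : ℕ} {σ : Form I M k} {x : M}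
    (h : ∀ᶠ x' in 𝓝 x, σ x' = 0) : extD I σ x = 0 := by
  have h1 : chartRep I σ x =ᶠ[𝓝 (extChartAt I x x)] 0 := by
    refine eventually_nhds_chart (mem_extChartAt_source x) ?_
    filter_upwards [h] with x' hx' hs
    rw [chartRep_chart _ hs]
    have : σ.raw x' = 0 := hx'
    rw [this]
    rfl
  have h2 : extDerivWithin (chartRep I σ x) (Set.range I) (extChartAt I x x) = 0 := by
    rw [I.range_eq_univ, extDerivWithin_univ, extDeriv, h1.fderiv_eq]
    ext v
    simp [ContinuousAlternatingMap.alternatizeUncurryFin_apply]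
  change (extD I σ).raw x = 0
  rw [raw_extD, h2]
  rfl

end Covector

end ManifoldForm

/-! ### `Prim^♭` as the annihilator of the image of `T𝓛` -/

namespace SingularLagrangian

open ManifoldForm

variable {D : ℕ} {Q : Type*} [TopologicalSpace Q] [ChartedSpace (EuclideanSpace ℝ (Fin D)) Q]
  [IsManifold (𝓡 D) ∞ Q] {L : PL D Q → ℝ}

/-- The vector field `X` with `i_X ω = β`. -/
def sharp (β : Form (IC D) (PC D Q) 1) (s : PC D Q) : CModel D := modelSharp D (β.covector s)

theorem modelFlat_sharp (β : Form (IC D) (PC D Q) 1) (s : PC D Q) :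
    modelFlat D (sharp β s) = β.covector s := modelFlat_modelSharp _

/-- Since `ω` has the same constant expression in every chart, raising an index is there the fixed
linear map `modelSharp`. -/
theorem fieldSmoothAt_sharp {β : Form (IC D) (PC D Q) 1} {s : PC D Q} (h : SmoothAt β s) :
    FieldSmoothAt (IC D) (sharp β) s := by
  have hs := mem_extChartAt_source (I := IC D) s
  rw [fieldSmoothAt_iff_fieldRep hs]
  have h1 := (modelSharp D).contDiff.contDiffAt.comp (extChartAt (IC D) s s)
    (contDiffAt_covector h)
  refine h1.congr_of_eventuallyEq (eventually_nhds_chart hs (.of_forall fun s' hs' => ?_))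
  rw [fieldRep_chart _ hs', Function.comp_apply, chartRep_chart _ hs']
  refine modelFlat_injective ?_
  rw [modelFlat_modelSharp]
  refine ContinuousLinearMap.ext fun w => ?_
  have h2 := raw_canonicalForm_symmDeriv hs' (chartDeriv (IC D) s s' (sharp β s')) w
  rw [symmDeriv_chartDeriv hs', raw_canonicalForm, ← modelFlat_apply, ← modelFlat_apply,
    modelFlat_sharp] at h2
  exact h2.symm

theorem IsAlmostRegular.contMDiff_fibreDeriv (h : IsAlmostRegular L) :
    ContMDiff (IL D) (IC D) ∞ (fibreDeriv L) := by
  obtain ⟨m, _, hm, h1, h2⟩ := h.submersion_onto_image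
  exact h1.contMDiff.comp h2.contMDiff

section Rank

variable {N₀ : ℕ}

/-- A one-form which annihilates the image of `T𝓛` belongs to `Prim^♭`. -/
theorem isPrimFlat_of_annihilates [T2Space Q] [SecondCountableTopology Q]
    (h𝓛 : ContMDiff (IL D) (IC D) ∞ (fibreDeriv L))
    (hM : ∀ u : PL D Q, Module.finrank ℝ (LinearMap.ker (hessian L u).toLinearMap) = N₀)
    (hΩ : ∀ u : PL D Q, Module.finrank ℝ (kerOmega L u) = 2 * N₀) {V : Set (PC D Q)}
    (hV : IsOpen V) {β : Form (IC D) (PC D Q) 1} (hβ : ∀ s ∈ imageIn L V, SmoothAt β s)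
    (hann : ∀ u, fibreDeriv L u ∈ V → ∀ w,
      β.covector (fibreDeriv L u) (rawDeriv (IL D) (IC D) (fibreDeriv L) u w) = 0) :
    IsPrimFlat L V β := by
  have : T2Space (PL D Q) := FiberBundle.t2Space_totalSpace _ _
  have : SecondCountableTopology (PL D Q) :=
    FiberBundle.secondCountableTopology_totalSpace _ _
  have hW : IsOpen (fibreDeriv L ⁻¹' V) := hV.preimage h𝓛.continuous
  -- The rank hypotheses on `M` and `Ω_L` make the image of `T𝓛` coisotropic, so it contains the
  -- dual vector of any covector annihilating it.
  have hmem : ∀ u, fibreDeriv L u ∈ V → ∃ v ∈ rawKerOmega L u,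
      rawDeriv (IL D) (IC D) (fibreDeriv L) u v = sharp β (fibreDeriv L u) := fun u hu => by
    obtain ⟨v, hv, hv'⟩ := LinearMap.exists_of_annihilates_range (N := N₀)
      (rawDeriv (IL D) (IC D) (fibreDeriv L) u).toLinearMap
      ((ContinuousLinearMap.coeLM ℝ).comp (modelFlat D).toLinearMap)
      (ContinuousLinearMap.coe_injective.comp modelFlat_injective)
      (finrank_LModel.trans finrank_CModel.symm)
      ((finrank_ker_rawDeriv_fibreDeriv h𝓛 u).trans (hM u)) (rawKerOmega L u)
      (fun v => mem_rawKerOmega h𝓛) (hΩ u) (β.covector (fibreDeriv L u)).toLinearMap (hann u hu)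
    refine ⟨v, hv, modelFlat_injective ?_⟩
    rw [modelFlat_sharp]
    exact ContinuousLinearMap.coe_injective hv'
  obtain ⟨P, hP⟩ := exists_related_field (I := IL D) (I' := IC D) (f := fibreDeriv L)
    (X := sharp β) (N := N₀) hW (fun u _ => h𝓛 u)
    (fun u _ => (finrank_ker_rawDeriv_fibreDeriv h𝓛 u).trans (hM u))
    (fun u hu => fieldSmoothAt_sharp (hβ _ ⟨⟨u, rfl⟩, hu⟩))
    (fun u hu => (hmem u hu).imp fun v hv => hv.2)
  refine ⟨P, ⟨fun u hu => (hP u hu).1.contMDiffWithinAt, fun u hu => ?_, ?_⟩, fun u hu (Y : CModel D) => ?_⟩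
  · refine (mem_rawKerOmega h𝓛 (v := P u)).2 fun w => ?_
    rw [(hP u hu).2, modelFlat_sharp]
    exact hann u hu w
  · intro V' hV' hVW G hG hGmem u hu
    have hev := hV'.mem_nhds hu
    have h1 : rawDeriv (IL D) (IC D) (fibreDeriv L) u
        (VectorField.mlieBracket (IL D) G P u) = 0 := by
      refine rawDeriv_mlieBracket_eq_zero (V := G) (X := sharp β) (.of_forall fun u => h𝓛 u)
        (hG.contMDiffAt hev) (hP u (hVW hu)).1
        (fieldSmoothAt_sharp (hβ _ ⟨⟨u, rfl⟩, hVW hu⟩)) ?_ ?_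
      · filter_upwards [hev] with u' hu'
        exact rawDeriv_eq_zero_of_mem_spaceG h𝓛 (hGmem u' hu')
      · filter_upwards [hev] with u' hu'
        exact (hP u' (hVW hu')).2
    refine (mem_vertical (v := VectorField.mlieBracket (IL D) G P u)).2 ?_
    exact (rawDeriv_fibreDeriv_fst h𝓛 u _).symm.trans (congrArg Prod.fst h1)
  · have h1 : modelFlat D (rawDeriv (IL D) (IC D) (fibreDeriv L) u (P u)) =
        β.covector (fibreDeriv L u) := by
      rw [(hP u hu).2, modelFlat_sharp]
    have h2 := raw_canonicalForm (fibreDeriv L u)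
      (rawDeriv (IL D) (IC D) (fibreDeriv L) u (P u)) Y
    rw [← modelFlat_apply, h1, covector_apply] at h2
    refine Eq.trans ?_ h2.symm
    change β.raw (fibreDeriv L u) ![Y] = _
    congr 1
    funext i
    fin_cases i
    rfl

/-- The one-forms in `Prim^♭` annihilate the image of `T𝓛`. -/
theorem IsPrimFlat.covector_rawDeriv (h𝓛 : ContMDiff (IL D) (IC D) ∞ (fibreDeriv L))
    {V : Set (PC D Q)} {β : Form (IC D) (PC D Q) 1} (h : IsPrimFlat L V β) {u : PL D Q}
    (hu : fibreDeriv L u ∈ V) (w : LModel D) :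
    β.covector (fibreDeriv L u) (rawDeriv (IL D) (IC D) (fibreDeriv L) u w) = 0 := by
  obtain ⟨P, hP, hβ⟩ := h
  have h1 := (mem_rawKerOmega h𝓛 (v := P u)).1 (hP.mem_ker u hu) w
  rw [modelFlat_apply, ← raw_canonicalForm (fibreDeriv L u)] at h1
  rw [← h1, covector_apply]
  refine Eq.trans ?_ (hβ u hu (rawDeriv (IL D) (IC D) (fibreDeriv L) u w))
  change _ = β.raw (fibreDeriv L u) ![rawDeriv (IL D) (IC D) (fibreDeriv L) u w]
  congr 1
  funext i
  fin_cases i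
  rfl

theorem finrank_range_rawDeriv (h𝓛 : ContMDiff (IL D) (IC D) ∞ (fibreDeriv L))
    (hM : ∀ u : PL D Q, Module.finrank ℝ (LinearMap.ker (hessian L u).toLinearMap) = N₀)
    (u : PL D Q) :
    Module.finrank ℝ (LinearMap.range (rawDeriv (IL D) (IC D) (fibreDeriv L) u).toLinearMap) + N₀ =
      Module.finrank ℝ (CModel D) := by
  rw [← hM u, finrank_CModel, ← finrank_LModel]
  have h1 := (rawDeriv (IL D) (IC D) (fibreDeriv L) u).toLinearMap.finrank_range_add_finrank_ker
  rw [finrank_ker_rawDeriv_fibreDeriv h𝓛] at h1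
  exact h1

theorem finrank_range_add_le_of_annihilates {c : ℕ} {α : Fin c → CModel D →L[ℝ] ℝ}
    {T : LModel D →L[ℝ] CModel D} (hind : LinearIndependent ℝ α) (h : ∀ n w, α n (T w) = 0) :
    LinearMap.range T.toLinearMap ≤ ⨅ n, LinearMap.ker (α n).toLinearMap ∧
    Module.finrank ℝ (⨅ n, LinearMap.ker (α n).toLinearMap : Submodule ℝ (CModel D)) + c =
      Module.finrank ℝ (CModel D) := by
  refine ⟨?_, LinearMap.finrank_iInf_ker_add (linearIndependent_toLinearMap.1 hind)⟩
  rintro _ ⟨w, rfl⟩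
  exact (Submodule.mem_iInf _).2 fun n => h n w

/-- The image of `T𝓛` is the common kernel of any `N₀` independent covectors which annihilate
it. -/
theorem exists_rawDeriv_eq (h𝓛 : ContMDiff (IL D) (IC D) ∞ (fibreDeriv L))
    (hM : ∀ u : PL D Q, Module.finrank ℝ (LinearMap.ker (hessian L u).toLinearMap) = N₀)
    {u : PL D Q} {α : Fin N₀ → CModel D →L[ℝ] ℝ} (hind : LinearIndependent ℝ α)
    (h : ∀ n w, α n (rawDeriv (IL D) (IC D) (fibreDeriv L) u w) = 0) {v : CModel D}
    (hv : ∀ n, α n v = 0) : ∃ w, rawDeriv (IL D) (IC D) (fibreDeriv L) u w = v := by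
  obtain ⟨h1, h2⟩ := finrank_range_add_le_of_annihilates hind h
  have h3 := Submodule.eq_of_le_of_finrank_eq h1 
    (Nat.add_right_cancel ((finrank_range_rawDeriv h𝓛 hM u).trans h2.symm))
  have h4 : v ∈ ⨅ n, LinearMap.ker (α n).toLinearMap := (Submodule.mem_iInf _).2 hv
  rw [← h3] at h4
  exact h4

end Rank

end SingularLagrangian

/-! ### Primary constraints, bases of `Prim^♭` and the Pfaff ideal -/

namespace SingularLagrangian

open ManifoldForm

variable {D N₀ : ℕ} {Q : Type*} [TopologicalSpace Q] [ChartedSpace (EuclideanSpace ℝ (Fin D)) Q]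
  [IsManifold (𝓡 D) ∞ Q] {L : PL D Q → ℝ}

theorem rawDeriv_eq_zero_of_comp_eq_zero (h𝓛 : ContMDiff (IL D) (IC D) ∞ (fibreDeriv L))
    {V : Set (PC D Q)} (hV : IsOpen V) {γ : PC D Q → ℝ} (hγ : ContMDiffOn (IC D) 𝓘(ℝ, ℝ) ∞ γ V)
    (h0 : ∀ s ∈ imageIn L V, γ s = 0) {u : PL D Q} (hu : fibreDeriv L u ∈ V) (w : LModel D) :
    rawDeriv (IC D) 𝓘(ℝ, ℝ) γ (fibreDeriv L u) (rawDeriv (IL D) (IC D) (fibreDeriv L) u w) = 0 := by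
  have h1 : (γ ∘ fibreDeriv L) =ᶠ[𝓝 u] fun _ => (0 : ℝ) := by
    filter_upwards [(hV.preimage h𝓛.continuous).mem_nhds hu] with u' hu'
    exact h0 _ ⟨⟨u', rfl⟩, hu'⟩
  have h2 := mfderiv_comp u ((hγ.contMDiffAt (hV.mem_nhds hu)).mdifferentiableAt (by simp))
    ((h𝓛 u).mdifferentiableAt (by simp))
  rw [h1.mfderiv_eq, mfderiv_const] at h2
  exact (DFunLike.congr_fun h2 w).symm

/-- The image of an almost regular Lagrangian's fibre derivative is locally cut out by `N₀`
independent functions. -/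
theorem IsAlmostRegular.exists_constraints (hreg : IsAlmostRegular L)
    (hM : ∀ u : PL D Q, Module.finrank ℝ (LinearMap.ker (hessian L u).toLinearMap) = N₀)
    {s : PC D Q} (hs : s ∈ Set.range (fibreDeriv L)) :
    ∃ (V : Set (PC D Q)) (γ : Fin N₀ → PC D Q → ℝ), IsOpen V ∧ s ∈ V ∧
      (∀ n, ContMDiffOn (IC D) 𝓘(ℝ, ℝ) ∞ (γ n) V) ∧
      (∀ y ∈ V, LinearIndependent ℝ fun n => rawDeriv (IC D) 𝓘(ℝ, ℝ) (γ n) y) ∧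
      imageIn L V = {y | y ∈ V ∧ ∀ n, γ n y = 0} := by
  have h𝓛 := hreg.contMDiff_fibreDeriv
  obtain ⟨m, _, hm, h1, h2⟩ := hreg.submersion_onto_image
  obtain ⟨u, rfl⟩ := hs
  have himm := h1.isImmersionAt (Set.rangeFactorization (fibreDeriv L) u)
  have hrank := himm.finrank_le_finrank_range_comp (h2.isSubmersionAt u)
  obtain ⟨c, V, γ, hV, huV, hdim, hγ, hind, hrange⟩ :=
    himm.exists_defining_functions Topology.IsInducing.subtypeVal
  rw [Subtype.range_coe] at hrange
  have hT := finrank_range_rawDeriv h𝓛 hM u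
  obtain ⟨h3, h4⟩ := finrank_range_add_le_of_annihilates (hind _ huV)
    fun n w => rawDeriv_eq_zero_of_comp_eq_zero h𝓛 hV (hγ n)
      (fun s hs => (hrange.subset hs).2 n) huV w
  have h5 := Submodule.finrank_mono h3
  have h6 : Module.finrank ℝ (EuclideanSpace ℝ (Fin m)) ≤ Module.finrank ℝ
    (LinearMap.range (rawDeriv (IL D) (IC D) (fibreDeriv L) u).toLinearMap) := hrank
  -- The rank `r` of `T𝓛` satisfies `r + N₀ = 2D` and `m + c = 2D`. The constraints give `r + c ≤
  -- 2D`, and the submersion onto the image gives `m ≤ r`; together they force `c = N₀`.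
  have hc : c = N₀ := by
    refine le_antisymm ?_ ?_
    · refine Nat.le_of_add_le_add_left (a := Module.finrank ℝ
        (LinearMap.range (rawDeriv (IL D) (IC D) (fibreDeriv L) u).toLinearMap)) ?_
      exact (Nat.add_le_add_right h5 c).trans (h4.trans hT.symm).le
    · refine Nat.le_of_add_le_add_left (a := Module.finrank ℝ (EuclideanSpace ℝ (Fin m))) ?_
      exact (Nat.add_le_add_right h6 N₀).trans (hT.trans hdim.symm).le
  subst hc
  exact ⟨V, γ, hV, huV, hγ, hind, hrange⟩

/-- The `γ n` vanish on the image, so their differentials annihilate the range of `T𝓛`, as do their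
multiples by functions. Being `N₀` independent covectors, they span the annihilator, where all
values of `Prim^♭` lie. -/
theorem isPrimFlatBasis_smul_dFun [T2Space Q] [SecondCountableTopology Q]
    (h𝓛 : ContMDiff (IL D) (IC D) ∞ (fibreDeriv L))
    (hM : ∀ u : PL D Q, Module.finrank ℝ (LinearMap.ker (hessian L u).toLinearMap) = N₀)
    (hΩ : ∀ u : PL D Q, Module.finrank ℝ (kerOmega L u) = 2 * N₀) {V : Set (PC D Q)}
    (hV : IsOpen V) {γ f : Fin N₀ → PC D Q → ℝ}
    (hγ : ∀ n, ContMDiffOn (IC D) 𝓘(ℝ, ℝ) ∞ (γ n) V)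
    (hind : ∀ y ∈ V, LinearIndependent ℝ fun n => rawDeriv (IC D) 𝓘(ℝ, ℝ) (γ n) y)
    (h0 : ∀ n, ∀ s ∈ imageIn L V, γ n s = 0)
    (hf : ∀ n, ContMDiffOn (IC D) 𝓘(ℝ, ℝ) ∞ (f n) V) (hf0 : ∀ n, ∀ s ∈ V, f n s ≠ 0) :
    IsPrimFlatBasis L V fun n s => f n s • dFun (IC D) (γ n) s := by
  have hsm : ∀ n, ∀ s ∈ V, SmoothAt (I := IC D) (fun s => f n s • dFun (IC D) (γ n) s) s :=
    fun n s hs => smoothAt_smul_dFun hV (hf n) (hγ n) hs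
  have hann : ∀ n u, fibreDeriv L u ∈ V → ∀ w,
      Form.covector (I := IC D) (fun s => f n s • dFun (IC D) (γ n) s) (fibreDeriv L u)
        (rawDeriv (IL D) (IC D) (fibreDeriv L) u w) = 0 := fun n u hu w => by
    rw [covector_smul, smul_apply, covector_dFun,
      rawDeriv_eq_zero_of_comp_eq_zero h𝓛 hV (hγ n) (h0 n) hu, smul_zero]
  have hind' : ∀ s ∈ V, LinearIndependent ℝ fun n =>
      Form.covector (I := IC D) (fun s => f n s • dFun (IC D) (γ n) s) s := fun s hs =>
    linearIndependent_covector_smul (π := fun n => dFun (IC D) (γ n)) (hind s hs)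
      fun n => hf0 n s hs
  refine ⟨fun n => smoothAlong_iff.2 ⟨V, hV, Set.inter_subset_right, hsm n⟩,
    fun n => isPrimFlat_of_annihilates h𝓛 hM hΩ hV (fun s hs => hsm n s hs.2) (hann n),
    fun s hs => ?_, ?_⟩
  · have h := (linearIndependent_covector_iff (s := s)
      (π := fun n s => f n s • dFun (IC D) (γ n) s)).2 (hind' s hs.2)
    exact h
  rintro V' hV' hVV η hη _ ⟨⟨u, rfl⟩, hu⟩
  have h := mem_span_of_covector (π := fun n s => f n s • dFun (IC D) (γ n) s) (η := η)
    (s := fibreDeriv L u) fun v hv => by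
      obtain ⟨w, rfl⟩ := exists_rawDeriv_eq h𝓛 hM (hind' _ (hVV hu))
        (fun n => hann n u (hVV hu)) hv
      exact hη.covector_rawDeriv h𝓛 hu w
  exact h

theorem wedge_eq_zero_of_right {V : Type*} [AddCommGroup V] [Module ℝ V] [TopologicalSpace V]
    {k : ℕ} (ξ : V [⋀^Fin k]→L[ℝ] ℝ) : wedge ξ (0 : V [⋀^Fin 1]→L[ℝ] ℝ) = 0 := by
  ext v
  rw [wedge_apply]
  simp

section Basis

variable {U : Set (PC D Q)} {π : Fin N₀ → Form (IC D) (PC D Q) 1}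

theorem IsPrimFlatBasis.exists_rawDeriv_eq (h𝓛 : ContMDiff (IL D) (IC D) ∞ (fibreDeriv L))
    (hM : ∀ u : PL D Q, Module.finrank ℝ (LinearMap.ker (hessian L u).toLinearMap) = N₀)
    (hπ : IsPrimFlatBasis L U π) {u : PL D Q} (hu : fibreDeriv L u ∈ U) {v : CModel D}
    (hv : ∀ n, (π n).covector (fibreDeriv L u) v = 0) :
    ∃ w, rawDeriv (IL D) (IC D) (fibreDeriv L) u w = v :=
  SingularLagrangian.exists_rawDeriv_eq h𝓛 hM
    (linearIndependent_covector_iff.1 (hπ.independent _ ⟨⟨u, rfl⟩, hu⟩))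
    (fun n => (hπ.mem n).covector_rawDeriv h𝓛 hu) hv

theorem IsPrimFlat.pullback_eq_zero (h𝓛 : ContMDiff (IL D) (IC D) ∞ (fibreDeriv L))
    {η : Form (IC D) (PC D Q) 1} (h : IsPrimFlat L U η) {u : PL D Q} (hu : fibreDeriv L u ∈ U) :
    (η.raw (fibreDeriv L u)).compContinuousLinearMap (rawDeriv (IL D) (IC D) (fibreDeriv L) u) =
      0 := by
  ext v
  refine Eq.trans ?_ (h.covector_rawDeriv h𝓛 hu (v 0))
  rw [covector_apply, ContinuousAlternatingMap.compContinuousLinearMap_apply]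
  congr 1
  funext i
  rw [Subsingleton.elim i 0]
  rfl

/-- The ideal generated by the Pfaff system is the kernel of `𝓛^*`. -/
theorem IsPrimFlatBasis.pfaffIdeal_eq [T2Space Q] [SecondCountableTopology Q]
    (h𝓛 : ContMDiff (IL D) (IC D) ∞ (fibreDeriv L))
    (hM : ∀ u : PL D Q, Module.finrank ℝ (LinearMap.ker (hessian L u).toLinearMap) = N₀)
    (hπ : IsPrimFlatBasis L U π) (k : ℕ) : pfaffIdeal L U π k = kerPullback L U k := by
  have : T2Space (PC D Q) := FiberBundle.t2Space_totalSpace _ _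
  have : SecondCountableTopology (PC D Q) :=
    FiberBundle.secondCountableTopology_totalSpace _ _
  ext σ
  cases k with
  | zero =>
    refine and_congr_right fun _ => ⟨fun h u hu => ?_, ?_⟩
    · change (σ.raw (fibreDeriv L u)).compContinuousLinearMap
        (rawDeriv (IL D) (IC D) (fibreDeriv L) u) = 0
      have h1 : σ.raw (fibreDeriv L u) = 0 := h _ ⟨⟨u, rfl⟩, hu⟩
      rw [h1]
      rfl
    · rintro h _ ⟨⟨u, rfl⟩, hu⟩
      have h1 : (σ.raw (fibreDeriv L u)).compContinuousLinearMap
        (rawDeriv (IL D) (IC D) (fibreDeriv L) u) = 0 := h u hu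
      change σ.raw (fibreDeriv L u) = 0
      ext v
      have h2 := DFunLike.congr_fun h1 fun i => i.elim0
      rw [ContinuousAlternatingMap.compContinuousLinearMap_apply] at h2
      refine Eq.trans ?_ h2
      congr 1
      exact Subsingleton.elim _ _
  | succ k =>
    refine and_congr_right fun hσ => ⟨?_, fun h => ?_⟩
    · rintro ⟨ξ, _, hξ⟩ u hu
      have h1 : σ.raw (fibreDeriv L u) =
        ∑ n, wedge ((ξ n).raw (fibreDeriv L u)) ((π n).raw (fibreDeriv L u)) :=
        hξ _ ⟨⟨u, rfl⟩, hu⟩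
      change (σ.raw (fibreDeriv L u)).compContinuousLinearMap
        (rawDeriv (IL D) (IC D) (fibreDeriv L) u) = 0
      have h2 : ∀ n, (wedge ((ξ n).raw (fibreDeriv L u))
          ((π n).raw (fibreDeriv L u))).compContinuousLinearMap
            (rawDeriv (IL D) (IC D) (fibreDeriv L) u) = 0 := fun n => by
        rw [wedge_compContinuousLinearMap, (hπ.mem n).pullback_eq_zero h𝓛 hu,
          wedge_eq_zero_of_right]
      rw [h1]
      ext v
      rw [ContinuousAlternatingMap.compContinuousLinearMap_apply,
        ContinuousAlternatingMap.sum_apply]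
      exact Finset.sum_eq_zero fun n _ => DFunLike.congr_fun (h2 n) v
    · refine exists_wedge_decomposition_along hπ.smooth hσ hπ.independent ?_
      rintro _ ⟨⟨u, rfl⟩, hu⟩ v hv
      choose w hw using fun i => hπ.exists_rawDeriv_eq h𝓛 hM hu (v := v i) (hv i)
      have h1 : (σ.raw (fibreDeriv L u)).compContinuousLinearMap
        (rawDeriv (IL D) (IC D) (fibreDeriv L) u) = 0 := h u hu
      have h2 := DFunLike.congr_fun h1 w
      rw [ContinuousAlternatingMap.compContinuousLinearMap_apply] at h2
      change σ.raw (fibreDeriv L u) v = 0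
      refine Eq.trans ?_ h2
      congr 1
      funext i
      exact (hw i).symm

/-- The differentials of smooth forms in `Prim^♭` are in the kernel of `𝓛^*`. -/
theorem IsPrimFlat.extD_mem_kerPullback (h𝓛 : ContMDiff (IL D) (IC D) ∞ (fibreDeriv L))
    (hU : IsOpen U) {η : Form (IC D) (PC D Q) 1} (hη : SmoothAlong (IC D) (imageIn L U) η)
    (h : IsPrimFlat L U η) : extD (IC D) η ∈ kerPullback L U 2 := by
  obtain ⟨W, hW, hUW, hηW⟩ := smoothAlong_iff.1 hη
  refine ⟨smoothAlong_iff.2 ⟨W, hW, hUW, fun s hs => SmoothAt.extD ?_⟩, fun u hu => ?_⟩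
  · filter_upwards [hW.mem_nhds hs] with s' hs'
    exact hηW s' hs'
  · rw [← extD_pullback (hηW _ (hUW ⟨⟨u, rfl⟩, hu⟩)) (.of_forall fun u => h𝓛 u)]
    -- The pullback of `η` vanishes on the whole open set `𝓛⁻¹(U)`, not only at `u`, so its
    -- differential vanishes at `u`.
    refine extD_eq_zero ?_
    filter_upwards [(hU.preimage h𝓛.continuous).mem_nhds hu] with u' hu'
    exact h.pullback_eq_zero h𝓛 hu'

theorem wedgeAll_eq_zero_of_mem_pfaffIdeal {k : ℕ} {σ : Form (IC D) (PC D Q) (k + 1)}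
    (h : σ ∈ pfaffIdeal L U π (k + 1)) {s : PC D Q} (hs : s ∈ imageIn L U) :
    wedgeAll (σ s) N₀ (fun n => π n s) = 0 := by
  obtain ⟨_, ξ, _, hξ⟩ := h
  have h1 : σ.raw s = ∑ n, wedge ((ξ n).raw s) ((π n).raw s) := hξ s hs
  have h2 : wedgeAll (σ.raw s) N₀ (fun n => (π n).raw s) = 0 := by
    rw [h1, wedgeAll_sum]
    exact Finset.sum_eq_zero fun n _ =>
      wedgeAll_wedge_of_mem ((ξ n).raw s) N₀ (fun n => (π n).raw s) n
  exact h2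

/-- Two bases of a family of covectors are related by a smooth invertible matrix. -/
theorem exists_transition_matrix {F : Type*} [NormedAddCommGroup F] [NormedSpace ℝ F]
    [FiniteDimensional ℝ F] {H : Type*} [TopologicalSpace H]
    {I : ModelWithCorners ℝ F H} {M : Type*} [TopologicalSpace M] [ChartedSpace H M]
    [I.Boundaryless] [IsManifold I ∞ M] {N : ℕ} {S : Set M} {α π : Fin N → Form I M 1} {s : M}
    (hs : s ∈ S) (hα : ∀ n, ∀ᶠ x in 𝓝 s, SmoothAt (α n) x)
    (hπ : ∀ n, ∀ᶠ x in 𝓝 s, SmoothAt (π n) x)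
    (hαi : LinearIndependent ℝ fun n => α n s) (hπi : LinearIndependent ℝ fun n => π n s)
    (hspan : ∀ᶠ x in 𝓝 s, x ∈ S → ∀ n, π n x ∈ Submodule.span ℝ (Set.range fun m => α m x)) :
    ∃ A : M → Matrix (Fin N) (Fin N) ℝ, ∀ᶠ x in 𝓝 s,
      (∀ n m, ContMDiffAt I 𝓘(ℝ, ℝ) ∞ (fun x => A x n m) x) ∧ (A x).det ≠ 0 ∧
      (x ∈ S → ∀ n, π n x = ∑ m, A x n m • α m x) := by
  have hx := mem_extChartAt_source (I := I) s
  have hc : ContinuousAt (extChartAt I s) s := continuousAt_extChartAt s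
  have hev : ∀ {σ : Form I M 1}, (∀ᶠ x in 𝓝 s, SmoothAt σ x) →
      ∀ᶠ y in 𝓝 (extChartAt I s s), ContDiffAt ℝ ∞ (chartRep I σ s) y := fun {σ} h =>
    eventually_nhds_chart hx (by
      filter_upwards [h] with x' h1 h2
      exact (smoothAt_iff h2).1 h1)
  obtain ⟨Y, hY, hdual⟩ := exists_contDiffAt_dual_vectors (fun n => hev (hα n))
    (linearIndependent_chartRep hαi)
  -- Coefficients are read off by pairing with a smooth frame dual to the `α m`. This defines them
  -- smoothly off `S` too, where the relation between the bases need not hold.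
  let a : Fin N → Fin N → F → ℝ := fun n m y => chartRep I (π n) s y fun _ => Y m y
  let A : M → Matrix (Fin N) (Fin N) ℝ := fun x => Matrix.of fun n m => a n m (extChartAt I s x)
  have hA : ∀ᶠ x in 𝓝 s, ∀ n m, ContMDiffAt I 𝓘(ℝ, ℝ) ∞ (fun x => A x n m) x := by
    filter_upwards [eventually_mem_source hx,
      hc.eventually (Filter.eventually_all.2 fun n => hev (hπ n)),
      hc.eventually (Filter.eventually_all.2 hY)] with x h1 h2 h3 n m
    exact contMDiffAt_comp_chart h1 (contDiffAt_alternating_apply (h2 n) fun _ => h3 m)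
  have hrel : ∀ᶠ x in 𝓝 s, x ∈ S → ∀ n, (π n).covector x = ∑ m, A x n m • (α m).covector x := by
    filter_upwards [eventually_mem_source hx, hc.eventually hdual, hspan] with x h1 h2 h3 h4 n
    obtain ⟨c, hc⟩ := exists_covector_eq_sum (h3 h4 n)
    have h6 : ∀ m, A x n m = c m := fun m => by
      change chartRep I (π n) s (extChartAt I s x) (fun _ => Y m (extChartAt I s x)) = _
      rw [chartRep_covector _ h1, hc, sum_apply]
      refine (Finset.sum_congr rfl fun i _ => (?_ : _ = c i * if i = m then 1 else 0)).trans
        (by simp)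
      rw [← h2 i m, chartRep_covector _ h1, smul_apply, smul_eq_mul]
    simp only [h6]
    exact hc
  have hdet : (A s).det ≠ 0 := by
    intro h0
    -- A left null vector of `A s` would be a linear relation among the `π n s`.
    obtain ⟨c, hc0, hc⟩ := Matrix.exists_vecMul_eq_zero_iff.2 h0
    refine hc0 (funext fun n => ?_)
    refine Fintype.linearIndependent_iff.1 (linearIndependent_covector_iff.1 hπi) c ?_ n
    simp only [hrel.self_of_nhds hs, Finset.smul_sum, smul_smul]
    rw [Finset.sum_comm]
    refine Finset.sum_eq_zero fun m _ => ?_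
    rw [← Finset.sum_smul]
    have := congrFun hc m
    simp only [Matrix.vecMul, dotProduct, Pi.zero_apply] at this
    rw [this, zero_smul]
  have hAc : ContinuousAt A s :=
    continuousAt_pi.2 fun n => continuousAt_pi.2 fun m => (hA.self_of_nhds n m).continuousAt
  have hdet' : ∀ᶠ x in 𝓝 s, (A x).det ≠ 0 :=
    (Continuous.matrix_det continuous_id).continuousAt.comp hAc |>.eventually_ne hdet
  refine ⟨A, ?_⟩
  clear_value A
  filter_upwards [hA, hrel, hdet'] with x h1 h2 h3
  refine ⟨h1, h3, fun hxS n => ?_⟩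
  have h := (eq_sum_smul_iff_covector (s := x) (η := π n) (π := α) (c := A x n)).2 (h2 hxS n)
  exact h

theorem IsPrimFlatBasis.exists_primaryConstraints [T2Space Q] [SecondCountableTopology Q]
    (hreg : IsAlmostRegular L)
    (hM : ∀ u : PL D Q, Module.finrank ℝ (LinearMap.ker (hessian L u).toLinearMap) = N₀)
    (hΩ : ∀ u : PL D Q, Module.finrank ℝ (kerOmega L u) = 2 * N₀)
    (hU : IsOpen U) (hπ : IsPrimFlatBasis L U π) {s : PC D Q} (hs : s ∈ imageIn L U) :
    ∃ V : Set (PC D Q), IsOpen V ∧ s ∈ V ∧ V ⊆ U ∧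
      ∃ γ : Fin N₀ → PC D Q → ℝ, IsPrimaryConstraints L V π γ := by
  have h𝓛 := hreg.contMDiff_fibreDeriv
  obtain ⟨V₀, γ, hV₀, hsV₀, hγ, hind, himg⟩ := hreg.exists_constraints hM hs.1
  obtain ⟨A, hA⟩ := exists_transition_matrix (I := IC D) (S := imageIn L (V₀ ∩ U))
    (α := fun n => dFun (IC D) (γ n)) (π := π) ⟨hs.1, hsV₀, hs.2⟩
    (fun n => by
      filter_upwards [hV₀.mem_nhds hsV₀] with x hx
      refine smoothAt_dFun ?_
      filter_upwards [hV₀.mem_nhds hx] with x' hx'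
      exact (hγ n).contMDiffAt (hV₀.mem_nhds hx'))
    (fun n => (hπ.smooth n).eventually hs)
    (linearIndependent_covector_iff.2 (hind s hsV₀)) (hπ.independent s hs)
    (.of_forall fun x hx n => by
      obtain ⟨⟨u, rfl⟩, hu⟩ := hx
      refine mem_span_of_covector fun v hv => ?_
      obtain ⟨w, rfl⟩ := SingularLagrangian.exists_rawDeriv_eq h𝓛 hM (hind _ hu.1)
        (fun n => rawDeriv_eq_zero_of_comp_eq_zero h𝓛 hV₀ (hγ n)
          (fun s hs => (himg.subset hs).2 n) hu.1) hv
      exact (hπ.mem n).covector_rawDeriv h𝓛 hu.2 w)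
  obtain ⟨V₁, hV₁, hV₁o, hsV₁⟩ := eventually_nhds_iff.1 hA
  -- `V₀` carries the constraints, `V₁` the smooth invertible matrix, and `U` the given basis.
  have hV : IsOpen (V₁ ∩ (V₀ ∩ U)) := hV₁o.inter (hV₀.inter hU)
  have hVV₀ : V₁ ∩ (V₀ ∩ U) ⊆ V₀ := fun x hx => hx.2.1
  have himgV : imageIn L (V₁ ∩ (V₀ ∩ U)) = {y | y ∈ V₁ ∩ (V₀ ∩ U) ∧ ∀ n, γ n y = 0} := by
    ext y
    refine ⟨fun hy => ⟨hy.2, (himg.subset ⟨hy.1, hVV₀ hy.2⟩).2⟩, fun hy => ⟨?_, hy.1⟩⟩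
    exact (himg.superset ⟨hVV₀ hy.1, hy.2⟩).1
  refine ⟨V₁ ∩ (V₀ ∩ U), hV, ⟨hsV₁, hsV₀, hs.2⟩, fun x hx => hx.2.2, γ,
    ⟨fun n => (hγ n).mono hVV₀, fun y hy => linearIndependent_covector_iff.2 (hind y (hVV₀ hy)),
      ⟨A, fun n m x hx => ((hV₁ x hx.1).1 n m).contMDiffWithinAt, fun x hx => (hV₁ x hx.1).2.1,
        fun x hx => (hV₁ x hx.2.1).2.2 ⟨hx.1, hx.2.2⟩⟩, fun f hf hf0 => ?_, himgV⟩⟩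
  exact isPrimFlatBasis_smul_dFun h𝓛 hM hΩ hV (fun n => (hγ n).mono hVV₀)
    (fun y hy => hind y (hVV₀ hy)) (fun n y hy => (himgV.subset hy).2 n) hf hf0

end Basis

end SingularLagrangian

end

open SingularLagrangian ManifoldForm
theorem mainTheorem9 {D N₀ : ℕ} {Q : Type*} [TopologicalSpace Q]
    [ChartedSpace (EuclideanSpace ℝ (Fin D)) Q] [IsManifold (𝓡 D) ∞ Q] [T2Space Q]
    [SecondCountableTopology Q] (L : PL D Q → ℝ) (hL : ContMDiff (IL D) 𝓘(ℝ, ℝ) ∞ L)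
    (hreg : IsAlmostRegular L)
    (hM : ∀ u : PL D Q, Module.finrank ℝ (LinearMap.ker (hessian L u).toLinearMap) = N₀)
    (hΩ : ∀ u : PL D Q, Module.finrank ℝ (kerOmega L u) = 2 * N₀) :
    (∀ s ∈ Set.range (fibreDeriv L), ∃ U : Set (PC D Q), IsOpen U ∧ s ∈ U ∧
      ∃ π : Fin N₀ → Form (IC D) (PC D Q) 1, IsPrimFlatBasis L U π) ∧
    ∀ U : Set (PC D Q), IsOpen U → ∀ π : Fin N₀ → Form (IC D) (PC D Q) 1,
      IsPrimFlatBasis L U π →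
        (∀ k : ℕ, pfaffIdeal L U π k = kerPullback L U k) ∧
        (∀ η : Form (IC D) (PC D Q) 1, SmoothAlong (IC D) (imageIn L U) η → IsPrimFlat L U η →
          extD (IC D) η ∈ pfaffIdeal L U π 2 ∧
          ∀ s ∈ imageIn L U, wedgeAll (extD (IC D) η s) N₀ (fun n => π n s) = 0) ∧
        (∀ s ∈ imageIn L U, ∃ V : Set (PC D Q), IsOpen V ∧ s ∈ V ∧ V ⊆ U ∧
          ∃ γ : Fin N₀ → PC D Q → ℝ, IsPrimaryConstraints L V π γ) := by
  have h𝓛 := hreg.contMDiff_fibreDeriv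
  refine ⟨fun s hs => ?_, fun U hU π hπ => ⟨hπ.pfaffIdeal_eq h𝓛 hM, fun η hη hη' => ?_,
    fun s hs => hπ.exists_primaryConstraints hreg hM hΩ hU hs⟩⟩
  · obtain ⟨V, γ, hV, hsV, hγ, hind, himg⟩ := hreg.exists_constraints hM hs
    -- The local basis consists of the differentials of the constraints, with all multipliers equal
    -- to `1`.
    exact ⟨V, hV, hsV, _, isPrimFlatBasis_smul_dFun (f := fun _ _ => 1) h𝓛 hM hΩ hV hγ hind
      (fun n s hs => (himg.subset hs).2 n) (fun n => contMDiffOn_const)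
      fun n s hs => one_ne_zero⟩
  · have h1 : extD (IC D) η ∈ pfaffIdeal L U π 2 := by
      rw [hπ.pfaffIdeal_eq h𝓛 hM]
      exact hη'.extD_mem_kerPullback h𝓛 hU hη
    exact ⟨h1, fun s hs => wedgeAll_eq_zero_of_mem_pfaffIdeal h1 hs⟩
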